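/- **Setting.** Let $p,q\in(0,1)$ be real numbers such that $p^aq^b=1$ with $a,b\in\mathbb Z$ only for $a=b=0$. Put $$\theta(z)=\prod_{j\ge 0}(1-zp^j)(1-p^{j+1}/z),\qquad E(s)=q^s\theta(q^{-2s}),$$ $$\alpha(x,z)=\frac{\theta(z)\theta(q^{2(x+1)})}{\theta(q^2z)\theta(q^{2x})},\qquad \beta(x,z)=\frac{\theta(q^2)\theta(q^{-2x}z)}{\theta(q^2z)\theta(q^{-2x})}.$$ Let $n\ge 0$, let $\mathfrak h$ be the space of traceless diagonal complex $n\times n$ matrices, $\omega(i)\in\mathfrak h^*$ the map $\mathrm{diag}(h_1,\dots,h_n)\mapsto h_i$, $\zeta_{ij}=\zeta(E_{ii}-E_{jj})$ for $\zeta\in\mathfrak h^*$, and $M$ the field of meromorphic functions on $\mathfrak h^*$. Let $R^{ab}_{xy}(\zeta,z)$ be $1$ if $a=b=x=y$; $\alpha(\zeta_{xy},z)$ if $a\ne b$, $x=a$, $y=b$; $\beta(\zeta_{xy},z)$ if $a\neq b$, $x=b$, $y=a$; and $0$ otherwise. **The algebra $\mathcal F=\mathcal F_{\mathrm{ell}}(M(n))$**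 is the unital $\mathbb C$-algebra generated by $e_{ij}(z)$ ($1\le i,j\le n$, $z\in\mathbb C^\times$) and two commuting copies of $M$, with elements written $f(\lambda)$ and $f(\rho)$, subject to $f(\lambda)e_{ij}(z)=e_{ij}(z)f(\lambda+\omega(i))$, $f(\rho)e_{ij}(z)=e_{ij}(z)f(\rho+\omega(j))$, and $$\sum_{x,y}\lim_{w\to z_1/z_2}\bigl(\varphi(w)R^{xy}_{ac}(\lambda,w)\bigr)e_{xb}(z_1)e_{yd}(z_2)=\sum_{x,y}\lim_{w\to z_1/z_2}\bigl(\varphi(w)R^{bd}_{xy}(\rho,w)\bigr)e_{cy}(z_2)e_{ax}(z_1)$$ for all $a,b,c,d$, all $z_1,z_2\in\mathbb C^\times$ and all meromorphic $\varphi$ on $\mathbb C^\times$ for which the limits exist as meromorphic functions. It is bigraded by $\mathfrak h^*\times\mathfrak h^*$: $e_{ij}(z)$ has bidegree $(\omega(i),\omega(j))$, and $f(\lambda),f(\rho)$ have bidegree $(0,0)$. **The left elliptic exterior algebra $\Lambda$** is the unital $\mathbb C$-algebra generated by $v_i(z)$ ($1\le i\le n$, $z\in\mathbb C^\times$) and a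 copy of $M$ (elements $f(\zeta)$), with relations $f(\zeta)v_i(z)=v_i(z)f(\zeta+\omega(i))$; $v_i(z)v_i(w)=0$; for $k\ne j$ and $z/w\notin p^{\mathbb Z}q^{-2}$, $$\alpha(\zeta_{kj},z/w)v_k(z)v_j(w)+\beta(\zeta_{kj},z/w)v_j(z)v_k(w)=0;$$ and $v_k(z)v_j(w)=0$ if $z/w\in p^{\mathbb Z}q^{-2}$. **The right elliptic exterior algebra $\Lambda'$** is generated by $w^i(z)$ and $f(\zeta)\in M$, with relations $f(\zeta)w^i(z)=w^i(z)f(\zeta+\omega(i))$; $w^i(z)w^i(w)=0$; for $k\neq j$ and $z_1/z_2\notin p^{\mathbb Z}q^{-2}$, $$\alpha(\zeta_{kj},z_1/z_2)w^j(z_2)w^k(z_1)+\beta(\zeta_{jk},z_1/z_2)w^k(z_2)w^j(z_1)=0;$$ and $w^j(z_2)w^k(z_1)=0$ if $z_1/z_2\in p^{\mathbb Z}q^{-2}$. Both are graded by $\mathfrak h^*$, with $v_i(z)$ and $w^i(z)$ in degree $\omega(i)$ and $f(\zeta)$ in degree $0$. Let $\mathcal F\widetilde\otimes\Lambda=\bigoplus_{\alpha,\beta}\mathcal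 F_{\alpha\beta}\otimes_{\mathbb C}\Lambda_\beta$ modulo $f(\rho)a\otimes v=a\otimes f(\zeta)v$, and $\Lambda'\widetilde\otimes\mathcal F=\bigoplus_{\alpha,\beta}\Lambda'_\alpha\otimes_{\mathbb C}\mathcal F_{\alpha\beta}$ modulo $v\otimes f(\lambda)a=f(\zeta)v\otimes a$; these are algebras with $(a\otimes b)(c\otimes d)=ac\otimes bd$. The coactions are the algebra homomorphisms $\Delta_\Lambda:\Lambda\to\mathcal F\widetilde\otimes\Lambda$ and $\Delta_{\Lambda'}:\Lambda'\to\Lambda'\widetilde\otimes\mathcal F$ given by $$\Delta_\Lambda(v_i(z))=\sum_j e_{ij}(z)\otimes v_j(z),\quad \Delta_\Lambda(f(\zeta))=f(\lambda)\otimes1,\qquad \Delta_{\Lambda'}(w^j(z))=\sum_i w^i(z)\otimes e_{ij}(z),\quad \Delta_{\Lambda'}(f(\zeta))=1\otimes f(\rho).$$ For $I=\{i_1<\dots<i_d\}\subseteq\{1,\dots,n\}$ put $$v_I(z)=\prod_{i<j\in I}E(\zeta_{ij}+1)^{-1}\;v_{i_d}(q^{2(d-1)}z)\cdots v_{i_2}(q^2z)v_{i_1}(z),\qquad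 w^I(z)=\prod_{i<j\in I}E(\zeta_{ij})\;w^{i_1}(z)w^{i_2}(q^2z)\cdots w^{i_d}(q^{2(d-1)}z).$$ **Theorem.** Let $z\in\mathbb C^\times$. There is exactly one family of elements $\overleftarrow\xi{}_I^J(z)\in\mathcal F$ (the left elliptic minors), and exactly one family $\overrightarrow\xi{}_I^J(z)\in\mathcal F$ (the right elliptic minors), where $I,J$ run over the subsets of $\{1,\dots,n\}$, such that for all $I$, respectively all $J$, $$\Delta_\Lambda(v_I(z))=\sum_J\overleftarrow\xi{}_I^J(z)\otimes v_J(z)\quad\text{in }\mathcal F\widetilde\otimes\Lambda,\qquad \Delta_{\Lambda'}(w^J(z))=\sum_I w^I(z)\otimes\overrightarrow\xi{}_I^J(z)\quad\text{in }\Lambda'\widetilde\otimes\mathcal F;$$ and for all subsets $I,J\subseteq\{1,\dots,n\}$ $$\overleftarrow\xi{}_I^J(z)=\overrightarrow\xi{}_I^J(z).$$ -/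

import Mathlib

open Filter Topology TensorProduct

noncomputable section

/-! ### Parameters and theta functions -/

/-- Real parameters `0 < p, q < 1` that are multiplicatively independent. -/
structure EllParams where
  p : ℝ
  q : ℝ
  p_pos : 0 < p
  p_lt_one : p < 1
  q_pos : 0 < q
  q_lt_one : q < 1
  generic : ∀ a b : ℤ, p ^ a * q ^ b = 1 → a = 0 ∧ b = 0

namespace EllParams

variable (P : EllParams)

/-- `p` as a unit of `ℂ`. -/
def pU : ℂˣ := Units.mk0 (P.p : ℂ) (by exact_mod_cast P.p_pos.ne')

/-- `q` as a unit of `ℂ`. -/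
def qU : ℂˣ := Units.mk0 (P.q : ℂ) (by exact_mod_cast P.q_pos.ne')

/-- The normalized Jacobi theta function `θ(z) = ∏_{j ≥ 0} (1 - z p^j) (1 - p^(j+1) / z)`. -/
def theta (z : ℂ) : ℂ :=
  ∏' j : ℕ, (1 - z * (P.p : ℂ) ^ j) * (1 - (P.p : ℂ) ^ (j + 1) / z)

/-- The complex power `q^s`, that is `exp (s log q)`. -/
def qpow (s : ℂ) : ℂ := (P.q : ℂ) ^ s

/-- `E(s) = q^s θ(q^(-2s))`. -/
def E (s : ℂ) : ℂ := P.qpow s * P.theta (P.qpow (-2 * s))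

/-- `α(x, z) = θ(z) θ(q^(2(x+1))) / (θ(q^2 z) θ(q^(2x)))`. -/
def alpha (x z : ℂ) : ℂ :=
  P.theta z * P.theta (P.qpow (2 * (x + 1))) /
    (P.theta ((P.q : ℂ) ^ 2 * z) * P.theta (P.qpow (2 * x)))

/-- `β(x, z) = θ(q^2) θ(q^(-2x) z) / (θ(q^2 z) θ(q^(-2x)))`. -/
def beta (x z : ℂ) : ℂ :=
  P.theta ((P.q : ℂ) ^ 2) * P.theta (P.qpow (-2 * x) * z) /
    (P.theta ((P.q : ℂ) ^ 2 * z) * P.theta (P.qpow (-2 * x)))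

lemma norm_p_lt_one : ‖(P.p : ℂ)‖ < 1 := by
  rw [Complex.norm_real, Real.norm_of_nonneg P.p_pos.le]; exact P.p_lt_one

lemma theta_factor (z : ℂ) (hz : z ≠ 0) (j : ℕ) :
    (1 - z * (P.p : ℂ) ^ j) * (1 - (P.p : ℂ) ^ (j + 1) / z) =
      1 + (-(z * (P.p : ℂ) ^ j) - (P.p : ℂ) ^ (j + 1) / z + (P.p : ℂ) ^ (j + 1 + j)) := by
  field_simp
  ring

lemma theta_factor_norm (z : ℂ) (j : ℕ) :
    ‖-(z * (P.p : ℂ) ^ j) - (P.p : ℂ) ^ (j + 1) / z + (P.p : ℂ) ^ (j + 1 + j)‖ ≤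
      (‖z‖ + ‖z‖⁻¹ + 1) * P.p ^ j := by
  have hp := P.p_pos
  have hp1 := P.p_lt_one
  have hn : ‖(P.p : ℂ)‖ = P.p := by rw [Complex.norm_real, Real.norm_of_nonneg P.p_pos.le]
  have hpj : 0 < P.p ^ j := by positivity
  have h1 : P.p ^ (j + 1) ≤ P.p ^ j := pow_le_pow_of_le_one hp.le hp1.le (by omega)
  have h2 : P.p ^ (j + 1 + j) ≤ P.p ^ j := pow_le_pow_of_le_one hp.le hp1.le (by omega)
  calc _ ≤ ‖z * (P.p : ℂ) ^ j‖ + ‖(P.p : ℂ) ^ (j + 1) / z‖ + ‖(P.p : ℂ) ^ (j + 1 + j)‖ := by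
        refine (norm_add_le _ _).trans ?_
        gcongr
        refine (norm_sub_le _ _).trans ?_
        rw [norm_neg]
    _ = ‖z‖ * P.p ^ j + P.p ^ (j + 1) * ‖z‖⁻¹ + P.p ^ (j + 1 + j) := by
        simp only [norm_mul, norm_inv, norm_pow, hn, div_eq_mul_inv]
    _ ≤ ‖z‖ * P.p ^ j + P.p ^ j * ‖z‖⁻¹ + P.p ^ j := by gcongr
    _ = _ := by ring

lemma theta_differentiableAt (z : ℂ) (hz : z ≠ 0) : DifferentiableAt ℂ P.theta z := by
  set r : ℝ := ‖z‖ / 2 with hr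
  set R : ℝ := ‖z‖ + 1 with hR
  have hzn : 0 < ‖z‖ := norm_pos_iff.mpr hz
  let K : Set ℂ := {w | r < ‖w‖} ∩ {w | ‖w‖ < R}
  have hK : IsOpen K :=
    (isOpen_lt continuous_const continuous_norm).inter (isOpen_lt continuous_norm continuous_const)
  have hzK : z ∈ K := ⟨half_lt_self hzn, lt_add_one ‖z‖⟩
  have hK0 : ∀ w ∈ K, w ≠ 0 := fun w hw h0 => by
    have := hw.1
    simp only [Set.mem_ofPred_eq, h0, norm_zero] at this
    linarith [half_pos hzn]
  let f : ℕ → ℂ → ℂ := fun j w =>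
    -(w * (P.p : ℂ) ^ j) - (P.p : ℂ) ^ (j + 1) / w + (P.p : ℂ) ^ (j + 1 + j)
  have hfd : ∀ j, DifferentiableOn ℂ (f j) K := fun j w hw => by
    have hw0 := hK0 w hw
    apply DifferentiableAt.differentiableWithinAt
    simp only [f]
    fun_prop (disch := assumption)
  have hsum : Summable fun j : ℕ => (R + r⁻¹ + 1) * P.p ^ j :=
    (summable_geometric_of_lt_one P.p_pos.le P.p_lt_one).mul_left _
  have hprod := Summable.hasProdLocallyUniformlyOn_nat_one_add (f := f) hK hsum
    (Eventually.of_forall fun j w hw => by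
      refine (P.theta_factor_norm w j).trans ?_
      have hw1 : r ≤ ‖w‖ := le_of_lt hw.1
      have hw2 : ‖w‖ ≤ R := le_of_lt hw.2
      have hr0 : 0 < r := half_pos hzn
      have := P.p_pos
      gcongr) (fun j => (hfd j).continuousOn)
  have hd : DifferentiableOn ℂ (fun w => ∏' j, (1 + f j w)) K :=
    hprod.differentiableOn (.of_forall fun s => by
      simpa [Finset.prod_fn] using DifferentiableOn.finsetProd
        (fun j _ => (differentiableOn_const (1 : ℂ)).add (hfd j))) hK
  have hEq : Set.EqOn P.theta (fun w => ∏' j, (1 + f j w)) K := fun w hw => by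
    simp only [theta, f]
    exact tprod_congr fun j => P.theta_factor w (hK0 w hw) j
  exact ((hd.congr hEq) z hzK).differentiableAt (hK.mem_nhds hzK)

lemma theta_ne_zero (z : ℂ) (hz : z ≠ 0) (h : ∀ k : ℤ, z ≠ (P.p : ℂ) ^ k) :
    P.theta z ≠ 0 := by
  have hp : (P.p : ℂ) ≠ 0 := by exact_mod_cast P.p_pos.ne'
  have h1 : P.theta z = ∏' j : ℕ, (1 + (-(z * (P.p : ℂ) ^ j) - (P.p : ℂ) ^ (j + 1) / z +
      (P.p : ℂ) ^ (j + 1 + j))) := tprod_congr fun j => P.theta_factor z hz j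
  rw [h1]
  apply tprod_one_add_ne_zero_of_summable
  · intro j
    rw [← P.theta_factor z hz j]
    apply mul_ne_zero
    · intro h0
      apply h (-j)
      rw [zpow_neg, zpow_natCast]
      exact eq_inv_of_mul_eq_one_left (sub_eq_zero.mp h0).symm
    · intro h0
      apply h (j + 1)
      have := (sub_eq_zero.mp h0).symm
      rw [div_eq_one_iff_eq hz] at this
      rw [← this]
      norm_cast
  · exact Summable.of_nonneg_of_le (fun _ => norm_nonneg _) (fun j => P.theta_factor_norm z j)
      ((summable_geometric_of_lt_one P.p_pos.le P.p_lt_one).mul_left _)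

lemma qpow_ne_zero (s : ℂ) : P.qpow s ≠ 0 := by
  have hq : (P.q : ℂ) ≠ 0 := by exact_mod_cast P.q_pos.ne'
  simp [qpow, Complex.cpow_eq_zero_iff, hq]

lemma theta_analyticAt (z : ℂ) (hz : z ≠ 0) : AnalyticAt ℂ P.theta z := by
  have h : DifferentiableOn ℂ P.theta {0}ᶜ := fun w hw =>
    (P.theta_differentiableAt w hw).differentiableWithinAt
  exact h.analyticAt (isOpen_compl_singleton.mem_nhds hz)

lemma qpow_analyticAt (s : ℂ) : AnalyticAt ℂ P.qpow s := by
  have hq : (P.q : ℂ) ∈ Complex.slitPlane := by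
    left; simpa using P.q_pos
  exact analyticAt_const.cpow analyticAt_id hq

end EllParams

/-! ### Meromorphic functions on a complex normed space -/

section Meromorphic

variable {W : Type*} [NormedAddCommGroup W] [NormedSpace ℂ W]

/-- `f` is locally a quotient `g / h` of holomorphic functions, where `h` does not vanish
identically near the point; the values of `f` on the zero set of `h` are irrelevant. -/
def IsMeroFun (f : W → ℂ) : Prop :=
  ∀ x, ∃ g h : W → ℂ, AnalyticAt ℂ g x ∧ AnalyticAt ℂ h x ∧ (∃ᶠ y in 𝓝 x, h y ≠ 0) ∧
    ∀ᶠ y in 𝓝 x, h y ≠ 0 → f y = g y / h y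

lemma frequently_mul_ne_zero {h₁ h₂ : W → ℂ} {x : W} (a₁ : AnalyticAt ℂ h₁ x)
    (a₂ : AnalyticAt ℂ h₂ x) (n₁ : ∃ᶠ y in 𝓝 x, h₁ y ≠ 0) (n₂ : ∃ᶠ y in 𝓝 x, h₂ y ≠ 0) :
    ∃ᶠ y in 𝓝 x, h₁ y * h₂ y ≠ 0 := by
  intro hc
  simp only [not_not] at hc
  obtain ⟨r, hr, hb⟩ := Metric.eventually_nhds_iff_ball.mp
    (hc.and (a₁.eventually_analyticAt.and a₂.eventually_analyticAt))
  obtain ⟨y, hy1, hy⟩ := (n₁.and_eventually (Metric.ball_mem_nhds x hr)).exists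
  have h2 : h₂ =ᶠ[𝓝 y] 0 := by
    filter_upwards [(hb y hy).2.1.continuousAt.eventually_ne hy1,
      Metric.isOpen_ball.mem_nhds hy] with w hw hwb
    simpa [hw] using (hb w hwb).1
  have := AnalyticOnNhd.eqOn_zero_of_preconnected_of_eventuallyEq_zero
    (fun w hw => (hb w hw).2.2) (convex_ball x r).isPreconnected hy h2
  exact n₂ (by filter_upwards [Metric.ball_mem_nhds x hr] with w hw; simpa using this hw)

lemma IsMeroFun.of_analytic {g : W → ℂ} (hg : ∀ x, AnalyticAt ℂ g x) : IsMeroFun g := fun x =>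
  ⟨g, fun _ => 1, hg x, analyticAt_const, (Eventually.of_forall fun _ => one_ne_zero).frequently,
    Eventually.of_forall fun y _ => by simp⟩

lemma IsMeroFun.div_analytic {g h : W → ℂ} (hg : ∀ x, AnalyticAt ℂ g x)
    (hh : ∀ x, AnalyticAt ℂ h x) : IsMeroFun (fun x => g x / h x) := by
  by_cases h0 : ∃ x, h x ≠ 0
  · obtain ⟨x₀, hx₀⟩ := h0
    intro x
    refine ⟨g, h, hg x, hh x, fun hc => hx₀ ?_, Eventually.of_forall fun _ _ => rfl⟩
    simp only [not_not] at hc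
    exact AnalyticOnNhd.eqOn_zero_of_preconnected_of_eventuallyEq_zero (U := Set.univ)
      (fun w _ => hh w) isPreconnected_univ (Set.mem_univ x) hc (Set.mem_univ x₀)
  · push Not at h0
    have : (fun x => g x / h x) = fun _ => 0 := by funext x; simp [h0 x]
    rw [this]
    exact IsMeroFun.of_analytic fun _ => analyticAt_const

lemma IsMeroFun.add {f₁ f₂ : W → ℂ} (m₁ : IsMeroFun f₁) (m₂ : IsMeroFun f₂) :
    IsMeroFun (f₁ + f₂) := by
  intro x
  obtain ⟨g₁, h₁, ag₁, ah₁, n₁, e₁⟩ := m₁ x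
  obtain ⟨g₂, h₂, ag₂, ah₂, n₂, e₂⟩ := m₂ x
  refine ⟨fun y => g₁ y * h₂ y + g₂ y * h₁ y, fun y => h₁ y * h₂ y,
    (ag₁.mul ah₂).add (ag₂.mul ah₁), ah₁.mul ah₂, frequently_mul_ne_zero ah₁ ah₂ n₁ n₂, ?_⟩
  filter_upwards [e₁, e₂] with y hy₁ hy₂ hne
  have k₁ := left_ne_zero_of_mul hne
  have k₂ := right_ne_zero_of_mul hne
  rw [Pi.add_apply, hy₁ k₁, hy₂ k₂]
  field_simp

lemma IsMeroFun.mul {f₁ f₂ : W → ℂ} (m₁ : IsMeroFun f₁) (m₂ : IsMeroFun f₂) :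
    IsMeroFun (f₁ * f₂) := by
  intro x
  obtain ⟨g₁, h₁, ag₁, ah₁, n₁, e₁⟩ := m₁ x
  obtain ⟨g₂, h₂, ag₂, ah₂, n₂, e₂⟩ := m₂ x
  refine ⟨fun y => g₁ y * g₂ y, fun y => h₁ y * h₂ y,
    ag₁.mul ag₂, ah₁.mul ah₂, frequently_mul_ne_zero ah₁ ah₂ n₁ n₂, ?_⟩
  filter_upwards [e₁, e₂] with y hy₁ hy₂ hne
  have k₁ := left_ne_zero_of_mul hne
  have k₂ := right_ne_zero_of_mul hne
  rw [Pi.mul_apply, hy₁ k₁, hy₂ k₂]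
  field_simp

lemma IsMeroFun.shift {f : W → ℂ} (m : IsMeroFun f) (a : W) :
    IsMeroFun (fun x => f (x + a)) := by
  intro x
  obtain ⟨g, h, ag, ah, n, e⟩ := m (x + a)
  have ht : Tendsto (fun y => y + a) (𝓝 x) (𝓝 (x + a)) := (continuous_add_const a).tendsto x
  have hta : AnalyticAt ℂ (fun y : W => y + a) x := analyticAt_id.add analyticAt_const
  refine ⟨fun y => g (y + a), fun y => h (y + a), AnalyticAt.fun_comp ag hta,
    AnalyticAt.fun_comp ah hta, ?_, ht.eventually e⟩
  have : Filter.map (fun y => y + a) (𝓝 x) = 𝓝 (x + a) := (Homeomorph.addRight a).map_nhds_eq x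
  rw [← this] at n
  exact n

variable (W)

/-- The algebra of functions on `W` that are locally quotients of holomorphic functions. -/
def meroFun : Subalgebra ℂ (W → ℂ) where
  carrier := {f | IsMeroFun f}
  mul_mem' := IsMeroFun.mul
  add_mem' := IsMeroFun.add
  algebraMap_mem' _ := IsMeroFun.of_analytic fun _ => analyticAt_const

/-- The ideal of those functions in `meroFun W` that vanish on a dense open set. -/
def meroNull : Ideal (meroFun W) where
  carrier := {f | Dense (interior {x | f.1 x = 0})}
  add_mem' {f g} hf hg := by
    refine (hf.inter_of_isOpen_left hg isOpen_interior).mono ?_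
    rw [← interior_inter]
    exact interior_mono fun x hx => by
      have h1 : f.1 x = 0 := hx.1
      have h2 : g.1 x = 0 := hx.2
      simp [h1, h2]
  zero_mem' := by simp
  smul_mem' c f hf := hf.mono (interior_mono fun x hx => by
    have h1 : f.1 x = 0 := hx
    simp [h1])

/-- The algebra of meromorphic functions on `W`: functions that are locally quotients of
holomorphic functions, where two of them are identified if they agree on a dense open set. -/
abbrev Mero : Type _ := meroFun W ⧸ meroNull W

variable {W}

/-- The meromorphic function represented by a function. -/
def Mero.mk (f : W → ℂ) (hf : IsMeroFun f) : Mero W :=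
  Ideal.Quotient.mk (meroNull W) (⟨f, hf⟩ : meroFun W)

/-- Translation on functions. -/
def meroFunShift (a : W) : meroFun W →ₐ[ℂ] meroFun W where
  toFun f := ⟨fun x => f.1 (x + a), IsMeroFun.shift f.2 a⟩
  map_one' := rfl
  map_mul' _ _ := rfl
  map_zero' := rfl
  map_add' _ _ := rfl
  commutes' _ := rfl

/-- The translation `(T_a f)(x) = f(x + a)` of meromorphic functions. -/
def Mero.shift (a : W) : Mero W →ₐ[ℂ] Mero W :=
  Ideal.quotientMapₐ (meroNull W) (meroFunShift a) fun f hf => by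
    have hf' : Dense (interior {x | f.1 x = 0}) := hf
    change Dense (interior {x | f.1 (x + a) = 0})
    have : {x | f.1 (x + a) = 0} = (Homeomorph.addRight a) ⁻¹' {x | f.1 x = 0} := rfl
    rw [this, ← (Homeomorph.addRight a).preimage_interior]
    exact hf'.preimage (Homeomorph.addRight a).isOpenMap

/-- `A(x) = lim_{w → w₀} φ(w) r(x, w)` as meromorphic functions of `x`: the limit is taken
pointwise, for all `x` in a dense open set. -/
def IsMeroLimit (φ : ℂ → ℂ) (r : W → ℂ → ℂ) (w₀ : ℂ) (A : Mero W) : Prop :=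
  ∃ f : meroFun W, Ideal.Quotient.mk (meroNull W) f = A ∧
    Dense (interior {x | Tendsto (fun w => φ w * r x w) (𝓝[≠] w₀) (𝓝 (f.1 x))})

end Meromorphic

/-! ### The Cartan subalgebra of `sl(n)` and the elliptic R-matrix -/

/-- The Cartan subalgebra of `sl(n)`: traceless diagonal matrices, given by their diagonals. -/
def cartan (n : ℕ) : Submodule ℂ (Fin n → ℂ) where
  carrier := {h | ∑ i, h i = 0}
  add_mem' {a b} ha hb := by
    have ha' : ∑ i, a i = 0 := ha
    have hb' : ∑ i, b i = 0 := hb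
    change ∑ i, (a + b) i = 0
    simp [Finset.sum_add_distrib, ha', hb']
  zero_mem' := by simp
  smul_mem' c x hx := by
    have hx' : ∑ i, x i = 0 := hx
    change ∑ i, (c • x) i = 0
    simp [← Finset.mul_sum, hx']

/-- The dual space of the Cartan subalgebra. -/
abbrev CartanDual (n : ℕ) : Type := cartan n →L[ℂ] ℂ

/-- The element `E_ii - E_jj` of the Cartan subalgebra. -/
def cartanDiff {n : ℕ} (i j : Fin n) : cartan n :=
  ⟨Pi.single i 1 - Pi.single j 1, by
    change ∑ k, ((Pi.single i (1 : ℂ) - Pi.single j (1 : ℂ)) : Fin n → ℂ) k = 0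
    simp [Finset.sum_sub_distrib]⟩

/-- The weight `ω(i)`, which sends `diag(h_1, …, h_n)` to `h_i`. -/
def wt {n : ℕ} (i : Fin n) : CartanDual n :=
  (ContinuousLinearMap.proj i).comp (cartan n).subtypeL

/-- The field of meromorphic functions on the dual of the Cartan subalgebra. -/
abbrev MF (n : ℕ) : Type := Mero (CartanDual n)

namespace EllParams

variable (P : EllParams) {n : ℕ}

/-- The matrix elements `R^{ab}_{xy}(ζ, z)` of the elliptic R-matrix, defined by
`R(ζ, z) (e_a ⊗ e_b) = ∑ R^{ab}_{xy}(ζ, z) e_x ⊗ e_y`, where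
`R(ζ, z) = ∑ E_ii ⊗ E_ii + ∑_{i ≠ j} α(ζ_ij, z) E_ii ⊗ E_jj + ∑_{i ≠ j} β(ζ_ij, z) E_ij ⊗ E_ji`
and `ζ_ij = ζ(E_ii - E_jj)`. -/
def Rmat (a b x y : Fin n) (ζ : CartanDual n) (z : ℂ) : ℂ :=
  if a = b then (if x = a ∧ y = a then 1 else 0)
  else if x = a ∧ y = b then P.alpha (ζ (cartanDiff x y)) z
  else if x = b ∧ y = a then P.beta (ζ (cartanDiff x y)) z
  else 0

lemma root_analyticAt (i j : Fin n) (ζ : CartanDual n) :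
    AnalyticAt ℂ (fun ζ : CartanDual n => ζ (cartanDiff i j)) ζ :=
  ContinuousLinearMap.analyticAt (𝕜 := ℂ)
    (ContinuousLinearMap.apply ℂ ℂ (cartanDiff i j) : CartanDual n →L[ℂ] ℂ) ζ

lemma theta_qpow_analyticAt {g : CartanDual n → ℂ} {ζ : CartanDual n} (hg : AnalyticAt ℂ g ζ)
    (c : ℂˣ) : AnalyticAt ℂ (fun ζ => P.theta (P.qpow (g ζ) * c)) ζ :=
  AnalyticAt.fun_comp (g := P.theta) (f := fun ζ => P.qpow (g ζ) * c)
    (P.theta_analyticAt _ (mul_ne_zero (P.qpow_ne_zero _) c.ne_zero))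
    (((P.qpow_analyticAt _).fun_comp hg).mul analyticAt_const)

lemma theta_qpow_analyticAt' {g : CartanDual n → ℂ} {ζ : CartanDual n} (hg : AnalyticAt ℂ g ζ) :
    AnalyticAt ℂ (fun ζ => P.theta (P.qpow (g ζ))) ζ := by
  simpa using P.theta_qpow_analyticAt hg 1

lemma alpha_mero (i j : Fin n) (z : ℂ) :
    IsMeroFun (fun ζ : CartanDual n => P.alpha (ζ (cartanDiff i j)) z) :=
  IsMeroFun.div_analytic
    (fun ζ => analyticAt_const.mul (P.theta_qpow_analyticAt'
      (analyticAt_const.mul ((root_analyticAt i j ζ).add analyticAt_const))))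
    (fun ζ => analyticAt_const.mul (P.theta_qpow_analyticAt'
      (analyticAt_const.mul (root_analyticAt i j ζ))))

lemma beta_mero (i j : Fin n) (z : ℂˣ) :
    IsMeroFun (fun ζ : CartanDual n => P.beta (ζ (cartanDiff i j)) z) :=
  IsMeroFun.div_analytic
    (fun ζ => analyticAt_const.mul (P.theta_qpow_analyticAt
      (analyticAt_const.mul (root_analyticAt i j ζ)) z))
    (fun ζ => analyticAt_const.mul (P.theta_qpow_analyticAt'
      (analyticAt_const.mul (root_analyticAt i j ζ))))

lemma E_analyticAt {g : CartanDual n → ℂ} {ζ : CartanDual n} (hg : AnalyticAt ℂ g ζ) :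
    AnalyticAt ℂ (fun ζ => P.E (g ζ)) ζ :=
  ((P.qpow_analyticAt _).fun_comp hg).mul
    (P.theta_qpow_analyticAt' (analyticAt_const.mul hg))

/-- `α(ζ_ij, z)` as a meromorphic function of `ζ`. -/
def alphaM (i j : Fin n) (z : ℂˣ) : MF n :=
  Mero.mk (fun ζ => P.alpha (ζ (cartanDiff i j)) z) (P.alpha_mero i j z)

/-- `β(ζ_ij, z)` as a meromorphic function of `ζ`. -/
def betaM (i j : Fin n) (z : ℂˣ) : MF n :=
  Mero.mk (fun ζ => P.beta (ζ (cartanDiff i j)) z) (P.beta_mero i j z)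

/-- `F_I(ζ)⁻¹ = ∏_{i < j in I} E(ζ_ij + 1)⁻¹`. -/
def FlowInv (I : Finset (Fin n)) : MF n :=
  ∏ i ∈ I, ∏ j ∈ I with i < j, Mero.mk (fun ζ => 1 / P.E (ζ (cartanDiff i j) + 1))
    (IsMeroFun.div_analytic (fun _ => analyticAt_const)
      fun ζ => P.E_analyticAt ((root_analyticAt i j ζ).add analyticAt_const))

/-- `F^I(ζ) = ∏_{i < j in I} E(ζ_ij)`. -/
def Fup (I : Finset (Fin n)) : MF n :=
  ∏ i ∈ I, ∏ j ∈ I with i < j, Mero.mk (fun ζ => P.E (ζ (cartanDiff i j)))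
    (IsMeroFun.of_analytic fun ζ => P.E_analyticAt (root_analyticAt i j ζ))

end EllParams

/-! ### The algebra `F_ell(M(n))` -/

/-- Generators of `F_ell(M(n))`: two copies `f(λ)`, `f(ρ)` of the meromorphic functions, and the
elements `e_ij(z)`. -/
inductive FGen (n : ℕ) : Type
  | l (f : MF n) : FGen n
  | r (f : MF n) : FGen n
  | e (i j : Fin n) (z : ℂˣ) : FGen n

namespace FGen

variable {n : ℕ}

/-- The generator `f(λ)` in the free algebra. -/
abbrev L (f : MF n) : FreeAlgebra ℂ (FGen n) := FreeAlgebra.ι ℂ (FGen.l f)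

/-- The generator `f(ρ)` in the free algebra. -/
abbrev R (f : MF n) : FreeAlgebra ℂ (FGen n) := FreeAlgebra.ι ℂ (FGen.r f)

/-- The generator `e_ij(z)` in the free algebra. -/
abbrev X (i j : Fin n) (z : ℂˣ) : FreeAlgebra ℂ (FGen n) := FreeAlgebra.ι ℂ (FGen.e i j z)

end FGen

open FGen in
/-- Defining relations of `F_ell(M(n))`: the maps `f ↦ f(λ)` and `f ↦ f(ρ)` are algebra
homomorphisms with commuting images, they commute with `e_ij(z)` up to translation, and the
RLL-relations hold, including all residual ones that arise after multiplying the R-matrix by a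
meromorphic function `φ` of the spectral variable and passing to the limit. -/
inductive FRel (P : EllParams) (n : ℕ) :
    FreeAlgebra ℂ (FGen n) → FreeAlgebra ℂ (FGen n) → Prop
  | l_scalar (c : ℂ) : FRel P n (L (algebraMap ℂ (MF n) c)) (algebraMap ℂ _ c)
  | l_add (f g : MF n) : FRel P n (L (f + g)) (L f + L g)
  | l_mul (f g : MF n) : FRel P n (L (f * g)) (L f * L g)
  | r_scalar (c : ℂ) : FRel P n (R (algebraMap ℂ (MF n) c)) (algebraMap ℂ _ c)
  | r_add (f g : MF n) : FRel P n (R (f + g)) (R f + R g)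
  | r_mul (f g : MF n) : FRel P n (R (f * g)) (R f * R g)
  | l_r (f g : MF n) : FRel P n (L f * R g) (R g * L f)
  | l_e (f : MF n) (i j : Fin n) (z : ℂˣ) :
      FRel P n (L f * X i j z) (X i j z * L (Mero.shift (wt i) f))
  | r_e (f : MF n) (i j : Fin n) (z : ℂˣ) :
      FRel P n (R f * X i j z) (X i j z * R (Mero.shift (wt j) f))
  | rll (a b c d : Fin n) (z₁ z₂ : ℂˣ) (φ : ℂ → ℂ) (hφ : MeromorphicOn φ {0}ᶜ)
      (A B : Fin n → Fin n → MF n)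
      (hA : ∀ x y, IsMeroLimit φ (P.Rmat x y a c) ((z₁ / z₂ : ℂˣ) : ℂ) (A x y))
      (hB : ∀ x y, IsMeroLimit φ (P.Rmat b d x y) ((z₁ / z₂ : ℂˣ) : ℂ) (B x y)) :
      FRel P n (∑ x, ∑ y, L (A x y) * X x b z₁ * X y d z₂)
        (∑ x, ∑ y, R (B x y) * X c y z₂ * X a x z₁)

/-- The algebra `F_ell(M(n))`. -/
abbrev FEll (P : EllParams) (n : ℕ) : Type := RingQuot (FRel P n)

namespace FEll

variable (P : EllParams) {n : ℕ}

/-- The left moment map `f ↦ f(λ)`. -/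
def l (f : MF n) : FEll P n := RingQuot.mkAlgHom ℂ (FRel P n) (FGen.L f)

/-- The right moment map `f ↦ f(ρ)`. -/
def r (f : MF n) : FEll P n := RingQuot.mkAlgHom ℂ (FRel P n) (FGen.R f)

/-- The generators `e_ij(z)`. -/
def e (i j : Fin n) (z : ℂˣ) : FEll P n := RingQuot.mkAlgHom ℂ (FRel P n) (FGen.X i j z)

/-- Monomials in the generators, with their bidegree: `e_ij(z)` has bidegree `(ω(i), ω(j))`, and
`f(λ)`, `f(ρ)` have bidegree `(0, 0)`. -/
inductive IsMonomial : FEll P n → CartanDual n → CartanDual n → Prop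
  | one : IsMonomial 1 0 0
  | l_mul (f : MF n) {a : FEll P n} {α β : CartanDual n} :
      IsMonomial a α β → IsMonomial (l P f * a) α β
  | r_mul (f : MF n) {a : FEll P n} {α β : CartanDual n} :
      IsMonomial a α β → IsMonomial (r P f * a) α β
  | e_mul (i j : Fin n) (z : ℂˣ) {a : FEll P n} {α β : CartanDual n} :
      IsMonomial a α β → IsMonomial (e P i j z * a) (wt i + α) (wt j + β)

/-- The bigraded component of bidegree `(α, β)`. -/
def component (α β : CartanDual n) : Submodule ℂ (FEll P n) :=
  Submodule.span ℂ {a | IsMonomial P a α β}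

end FEll

/-! ### The left and right elliptic exterior algebras -/

/-- Generators of an elliptic exterior algebra: the meromorphic functions `f(ζ)`, and elements
`v_i(z)` (respectively `w^i(z)`). -/
inductive ExtGen (n : ℕ) : Type
  | f (f : MF n) : ExtGen n
  | v (i : Fin n) (z : ℂˣ) : ExtGen n

namespace ExtGen

variable {n : ℕ}

/-- The generator `f(ζ)` in the free algebra. -/
abbrev C (f : MF n) : FreeAlgebra ℂ (ExtGen n) := FreeAlgebra.ι ℂ (ExtGen.f f)

/-- The generator `v_i(z)` (or `w^i(z)`) in the free algebra. -/
abbrev V (i : Fin n) (z : ℂˣ) : FreeAlgebra ℂ (ExtGen n) := FreeAlgebra.ι ℂ (ExtGen.v i z)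

end ExtGen

/-- `u = p^k q^(-2)` for some integer `k`; these are the poles of `α` and `β`. -/
def EllParams.IsPole (P : EllParams) (u : ℂˣ) : Prop := ∃ k : ℤ, u = P.pU ^ k * P.qU ^ (-2 : ℤ)

open ExtGen in
/-- Defining relations of the left elliptic exterior algebra. -/
inductive LeftExtRel (P : EllParams) (n : ℕ) :
    FreeAlgebra ℂ (ExtGen n) → FreeAlgebra ℂ (ExtGen n) → Prop
  | scalar (c : ℂ) : LeftExtRel P n (C (algebraMap ℂ (MF n) c)) (algebraMap ℂ _ c)
  | add (f g : MF n) : LeftExtRel P n (C (f + g)) (C f + C g)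
  | mul (f g : MF n) : LeftExtRel P n (C (f * g)) (C f * C g)
  | f_v (f : MF n) (i : Fin n) (z : ℂˣ) :
      LeftExtRel P n (C f * V i z) (V i z * C (Mero.shift (wt i) f))
  | v_v (i : Fin n) (z w : ℂˣ) : LeftExtRel P n (V i z * V i w) 0
  | wedge (k j : Fin n) (hkj : k ≠ j) (z w : ℂˣ) (h : ¬ P.IsPole (z / w)) :
      LeftExtRel P n
        (C (P.alphaM k j (z / w)) * V k z * V j w + C (P.betaM k j (z / w)) * V j z * V k w) 0
  | pole (k j : Fin n) (z w : ℂˣ) (h : P.IsPole (z / w)) : LeftExtRel P n (V k z * V j w) 0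

/-- The left elliptic exterior algebra `Λ`. -/
abbrev LeftExt (P : EllParams) (n : ℕ) : Type := RingQuot (LeftExtRel P n)

open ExtGen in
/-- Defining relations of the right elliptic exterior algebra. -/
inductive RightExtRel (P : EllParams) (n : ℕ) :
    FreeAlgebra ℂ (ExtGen n) → FreeAlgebra ℂ (ExtGen n) → Prop
  | scalar (c : ℂ) : RightExtRel P n (C (algebraMap ℂ (MF n) c)) (algebraMap ℂ _ c)
  | add (f g : MF n) : RightExtRel P n (C (f + g)) (C f + C g)
  | mul (f g : MF n) : RightExtRel P n (C (f * g)) (C f * C g)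
  | f_w (f : MF n) (i : Fin n) (z : ℂˣ) :
      RightExtRel P n (C f * V i z) (V i z * C (Mero.shift (wt i) f))
  | w_w (i : Fin n) (z w : ℂˣ) : RightExtRel P n (V i z * V i w) 0
  | wedge (k j : Fin n) (hkj : k ≠ j) (z w : ℂˣ) (h : ¬ P.IsPole (z / w)) :
      RightExtRel P n
        (C (P.alphaM k j (z / w)) * V j w * V k z + C (P.betaM j k (z / w)) * V k w * V j z) 0
  | pole (k j : Fin n) (z w : ℂˣ) (h : P.IsPole (z / w)) : RightExtRel P n (V j w * V k z) 0

/-- The right elliptic exterior algebra `Λ'`. -/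
abbrev RightExt (P : EllParams) (n : ℕ) : Type := RingQuot (RightExtRel P n)

namespace LeftExt

variable (P : EllParams) {n : ℕ}

/-- The element `f(ζ)`. -/
def f (f : MF n) : LeftExt P n := RingQuot.mkAlgHom ℂ (LeftExtRel P n) (ExtGen.C f)

/-- The generators `v_i(z)`. -/
def v (i : Fin n) (z : ℂˣ) : LeftExt P n := RingQuot.mkAlgHom ℂ (LeftExtRel P n) (ExtGen.V i z)

/-- Monomials in the generators, with their degree: `v_i(z)` has degree `ω(i)`. -/
inductive IsMonomial : LeftExt P n → CartanDual n → Prop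
  | one : IsMonomial 1 0
  | f_mul (g : MF n) {a : LeftExt P n} {α : CartanDual n} :
      IsMonomial a α → IsMonomial (f P g * a) α
  | v_mul (i : Fin n) (z : ℂˣ) {a : LeftExt P n} {α : CartanDual n} :
      IsMonomial a α → IsMonomial (v P i z * a) (wt i + α)

/-- The graded component of degree `α`. -/
def component (α : CartanDual n) : Submodule ℂ (LeftExt P n) :=
  Submodule.span ℂ {a | IsMonomial P a α}

/-- For a list `[i_1, …, i_d]`, the product `v_{i_d}(q^{2(d-1)} z) ⋯ v_{i_2}(q^2 z) v_{i_1}(z)`. -/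
def word : List (Fin n) → ℂˣ → LeftExt P n
  | [], _ => 1
  | i :: t, z => word t (P.qU ^ 2 * z) * v P i z

/-- `v_I(z) = F_I(ζ)⁻¹ v_{i_d}(q^{2(d-1)} z) ⋯ v_{i_1}(z)` for `I = {i_1 < ⋯ < i_d}`. -/
def vI (I : Finset (Fin n)) (z : ℂˣ) : LeftExt P n := f P (P.FlowInv I) * word P I.sort z

end LeftExt

namespace RightExt

variable (P : EllParams) {n : ℕ}

/-- The element `f(ζ)`. -/
def f (f : MF n) : RightExt P n := RingQuot.mkAlgHom ℂ (RightExtRel P n) (ExtGen.C f)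

/-- The generators `w^i(z)`. -/
def w (i : Fin n) (z : ℂˣ) : RightExt P n :=
  RingQuot.mkAlgHom ℂ (RightExtRel P n) (ExtGen.V i z)

/-- Monomials in the generators, with their degree: `w^i(z)` has degree `ω(i)`. -/
inductive IsMonomial : RightExt P n → CartanDual n → Prop
  | one : IsMonomial 1 0
  | f_mul (g : MF n) {a : RightExt P n} {α : CartanDual n} :
      IsMonomial a α → IsMonomial (f P g * a) α
  | w_mul (i : Fin n) (z : ℂˣ) {a : RightExt P n} {α : CartanDual n} :
      IsMonomial a α → IsMonomial (w P i z * a) (wt i + α)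

/-- The graded component of degree `α`. -/
def component (α : CartanDual n) : Submodule ℂ (RightExt P n) :=
  Submodule.span ℂ {a | IsMonomial P a α}

/-- For a list `[i_1, …, i_d]`, the product `w^{i_1}(z) w^{i_2}(q^2 z) ⋯ w^{i_d}(q^{2(d-1)} z)`. -/
def word : List (Fin n) → ℂˣ → RightExt P n
  | [], _ => 1
  | i :: t, z => w P i z * word t (P.qU ^ 2 * z)

/-- `w^I(z) = F^I(ζ) w^{i_1}(z) ⋯ w^{i_d}(q^{2(d-1)} z)` for `I = {i_1 < ⋯ < i_d}`. -/
def wI (I : Finset (Fin n)) (z : ℂˣ) : RightExt P n := f P (P.Fup I) * word P I.sort z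

end RightExt

/-! ### The matrix tensor products and the coactions -/

section LeftTensor

variable (P : EllParams) (n : ℕ)

/-- The subalgebra `⨁_{α, β} F_{αβ} ⊗ Λ_β` of `F ⊗_ℂ Λ`, where `F = F_ell(M(n))`. -/
def leftGraded : Subalgebra ℂ (FEll P n ⊗[ℂ] LeftExt P n) :=
  Algebra.adjoin ℂ {t | ∃ α β, ∃ a ∈ FEll.component P α β, ∃ v ∈ LeftExt.component P β,
    t = a ⊗ₜ[ℂ] v}

/-- The balancing relations `f(ρ) ⊗ 1 = 1 ⊗ f(ζ)`. -/
def LeftBalance (s t : leftGraded P n) : Prop :=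
  ∃ f : MF n, (s : FEll P n ⊗[ℂ] LeftExt P n) = FEll.r P f ⊗ₜ[ℂ] 1 ∧
    (t : FEll P n ⊗[ℂ] LeftExt P n) = 1 ⊗ₜ[ℂ] LeftExt.f P f

/-- The algebra `F ⊗̃ Λ`: the quotient of `⨁_{α, β} F_{αβ} ⊗ Λ_β` by the relations
`f(ρ) a ⊗ v = a ⊗ f(ζ) v`. -/
abbrev LeftTensor : Type := RingQuot (LeftBalance P n)

/-- The subalgebra `⨁_{α, β} Λ'_α ⊗ F_{αβ}` of `Λ' ⊗_ℂ F`, where `F = F_ell(M(n))`. -/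
def rightGraded : Subalgebra ℂ (RightExt P n ⊗[ℂ] FEll P n) :=
  Algebra.adjoin ℂ {t | ∃ α β, ∃ v ∈ RightExt.component P α, ∃ a ∈ FEll.component P α β,
    t = v ⊗ₜ[ℂ] a}

/-- The balancing relations `f(ζ) ⊗ 1 = 1 ⊗ f(λ)`. -/
def RightBalance (s t : rightGraded P n) : Prop :=
  ∃ f : MF n, (s : RightExt P n ⊗[ℂ] FEll P n) = RightExt.f P f ⊗ₜ[ℂ] 1 ∧
    (t : RightExt P n ⊗[ℂ] FEll P n) = 1 ⊗ₜ[ℂ] FEll.l P f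

/-- The algebra `Λ' ⊗̃ F`: the quotient of `⨁_{α, β} Λ'_α ⊗ F_{αβ}` by the relations
`v ⊗ f(λ) a = f(ζ) v ⊗ a`. -/
abbrev RightTensor : Type := RingQuot (RightBalance P n)

end LeftTensor

/-! ### Well-definedness of the coactions -/

section Coaction

variable (P : EllParams) {n : ℕ}

namespace EllParams

/-- `R^{ab}_{xy}(ζ, z)` as a meromorphic function of `ζ`, for fixed `z`. -/
def RmatM (a b x y : Fin n) (z : ℂˣ) : MF n :=
  if a = b then (if x = a ∧ y = a then 1 else 0)
  else if x = a ∧ y = b then P.alphaM x y z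
  else if x = b ∧ y = a then P.betaM x y z
  else 0

lemma RmatM_ne_zero {a b x y : Fin n} {z : ℂˣ} (h : P.RmatM a b x y z ≠ 0) :
    (x = a ∧ y = b) ∨ (x = b ∧ y = a) := by
  unfold RmatM at h
  split_ifs at h with h1 h2 h3 h4
  · exact Or.inl ⟨h2.1, h2.2.trans h1⟩
  · exact absurd rfl h
  · exact Or.inl h3
  · exact Or.inr h4
  · exact absurd rfl h

lemma theta_ne_zero_of_not_pole {u : ℂˣ} (h : ¬ P.IsPole u) :
    P.theta ((P.q : ℂ) ^ 2 * u) ≠ 0 := by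
  have hq : (P.q : ℂ) ≠ 0 := P.qU.ne_zero
  apply P.theta_ne_zero _ (mul_ne_zero (pow_ne_zero _ hq) u.ne_zero)
  intro k hk
  refine h ⟨k, Units.ext ?_⟩
  have : (((P.pU ^ k * P.qU ^ (-2 : ℤ) : ℂˣ)) : ℂ) = (P.p : ℂ) ^ k * ((P.q : ℂ) ^ 2)⁻¹ := by
    rw [Units.val_mul, Units.val_zpow_eq_zpow_val, Units.val_zpow_eq_zpow_val, zpow_neg]
    rfl
  rw [this, ← hk]
  field_simp

lemma tendsto_theta_mul (c u : ℂ) (hc : c ≠ 0) (hu : u ≠ 0) :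
    Tendsto (fun w => P.theta (c * w)) (𝓝[≠] u) (𝓝 (P.theta (c * u))) := by
  have h1 : ContinuousAt P.theta (c * u) :=
    (P.theta_differentiableAt _ (mul_ne_zero hc hu)).continuousAt
  have h2 : ContinuousAt (fun w : ℂ => c * w) u := by fun_prop
  exact (ContinuousAt.comp (f := fun w : ℂ => c * w) (g := P.theta) h1 h2).tendsto.mono_left
    nhdsWithin_le_nhds

lemma tendsto_alpha (x : ℂ) {u : ℂˣ} (h : ¬ P.IsPole u) :
    Tendsto (fun w => P.alpha x w) (𝓝[≠] (u : ℂ)) (𝓝 (P.alpha x u)) := by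
  have hq : (P.q : ℂ) ≠ 0 := P.qU.ne_zero
  simp only [alpha, mul_div_mul_comm]
  refine Tendsto.mul_const _ (Tendsto.div ?_ (P.tendsto_theta_mul _ _ (pow_ne_zero 2 hq) u.ne_zero)
    (P.theta_ne_zero_of_not_pole h))
  simpa using P.tendsto_theta_mul 1 u one_ne_zero u.ne_zero

lemma tendsto_beta (x : ℂ) {u : ℂˣ} (h : ¬ P.IsPole u) :
    Tendsto (fun w => P.beta x w) (𝓝[≠] (u : ℂ)) (𝓝 (P.beta x u)) := by
  have hq : (P.q : ℂ) ≠ 0 := P.qU.ne_zero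
  simp only [beta, mul_comm (P.theta ((P.q : ℂ) ^ 2)), mul_div_mul_comm]
  exact Tendsto.mul_const _ (Tendsto.div (P.tendsto_theta_mul _ _ (P.qpow_ne_zero _) u.ne_zero)
    (P.tendsto_theta_mul _ _ (pow_ne_zero 2 hq) u.ne_zero) (P.theta_ne_zero_of_not_pole h))

lemma RmatM_limit (a b x y : Fin n) {u : ℂˣ} (h : ¬ P.IsPole u) :
    IsMeroLimit (fun _ => 1) (P.Rmat a b x y) (u : ℂ) (P.RmatM a b x y u) := by
  unfold RmatM Rmat
  split_ifs
  · exact ⟨1, rfl, by simp⟩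
  · exact ⟨0, rfl, by simp⟩
  · exact ⟨⟨_, P.alpha_mero x y u⟩, rfl, by simp [P.tendsto_alpha _ h]⟩
  · exact ⟨⟨_, P.beta_mero x y u⟩, rfl, by simp [P.tendsto_beta _ h]⟩
  · exact ⟨0, rfl, by simp⟩

end EllParams

lemma sum_swap_pairs {ι κ A : Type*} [Fintype ι] [Fintype κ] [AddCommMonoid A]
    (f : ι → ι → κ → κ → A) :
    ∑ x, ∑ y, ∑ b, ∑ d, f x y b d = ∑ b, ∑ d, ∑ x, ∑ y, f x y b d := by
  calc _ = ∑ x, ∑ b, ∑ y, ∑ d, f x y b d := Finset.sum_congr rfl fun x _ => Finset.sum_comm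
    _ = ∑ b, ∑ x, ∑ y, ∑ d, f x y b d := Finset.sum_comm
    _ = ∑ b, ∑ x, ∑ d, ∑ y, f x y b d :=
      Finset.sum_congr rfl fun b _ => Finset.sum_congr rfl fun x _ => Finset.sum_comm
    _ = _ := Finset.sum_congr rfl fun b _ => Finset.sum_comm

namespace EllParams

lemma sum_upper_fixed {A : Type*} [AddCommMonoid A] (a b : Fin n) (u : ℂˣ)
    (X : MF n → Fin n → Fin n → A) (h0 : ∀ x y, X 0 x y = 0) :
    ∑ x, ∑ y, X (P.RmatM a b x y u) x y =
      if a = b then X 1 a a else X (P.alphaM a b u) a b + X (P.betaM b a u) b a := by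
  rw [← Finset.sum_product', Finset.univ_product_univ]
  split_ifs with hab
  · subst hab
    rw [Finset.sum_eq_single (a, a)]
    · simp [RmatM]
    · rintro ⟨x, y⟩ - hne
      have : P.RmatM a a x y u = 0 := by
        by_contra hc
        have := P.RmatM_ne_zero hc
        aesop
      simp only [this, h0]
    · simp
  · rw [Finset.sum_eq_add (a, b) (b, a)]
    · have hba : b ≠ a := fun h => hab h.symm
      simp [RmatM, hab, hba]
    · intro h
      exact hab (Prod.ext_iff.mp h).1
    · rintro ⟨x, y⟩ - hne
      have : P.RmatM a b x y u = 0 := by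
        by_contra hc
        have := P.RmatM_ne_zero hc
        aesop
      simp only [this, h0]
    · simp
    · simp

lemma sum_lower_fixed {A : Type*} [AddCommMonoid A] (x y : Fin n) (u : ℂˣ)
    (X : MF n → Fin n → Fin n → A) (h0 : ∀ a b, X 0 a b = 0) :
    ∑ a, ∑ b, X (P.RmatM a b x y u) a b =
      if x = y then X 1 x x else X (P.alphaM x y u) x y + X (P.betaM x y u) y x := by
  rw [← Finset.sum_product', Finset.univ_product_univ]
  split_ifs with hxy
  · subst hxy
    rw [Finset.sum_eq_single (x, x)]
    · simp [RmatM]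
    · rintro ⟨a, b⟩ - hne
      have : P.RmatM a b x x u = 0 := by
        by_contra hc
        have := P.RmatM_ne_zero hc
        aesop
      simp only [this, h0]
    · simp
  · rw [Finset.sum_eq_add (x, y) (y, x)]
    · have hyx : y ≠ x := fun h => hxy h.symm
      simp [RmatM, hxy, hyx]
    · intro h
      exact hxy (Prod.ext_iff.mp h).1
    · rintro ⟨a, b⟩ - hne
      have : P.RmatM a b x y u = 0 := by
        by_contra hc
        have := P.RmatM_ne_zero hc
        aesop
      simp only [this, h0]
    · simp
    · simp

end EllParams

namespace FEll

lemma l_scalar (c : ℂ) : l P (algebraMap ℂ (MF n) c) = algebraMap ℂ (FEll P n) c := by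
  rw [l, RingQuot.mkAlgHom_rel ℂ (FRel.l_scalar c), AlgHom.commutes]

lemma r_scalar (c : ℂ) : r P (algebraMap ℂ (MF n) c) = algebraMap ℂ (FEll P n) c := by
  rw [r, RingQuot.mkAlgHom_rel ℂ (FRel.r_scalar c), AlgHom.commutes]

lemma l_add (f g : MF n) : l P (f + g) = l P f + l P g := by
  simp only [l, RingQuot.mkAlgHom_rel ℂ (FRel.l_add f g), map_add]

lemma r_add (f g : MF n) : r P (f + g) = r P f + r P g := by
  simp only [r, RingQuot.mkAlgHom_rel ℂ (FRel.r_add f g), map_add]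

lemma l_mul (f g : MF n) : l P (f * g) = l P f * l P g := by
  simp only [l, RingQuot.mkAlgHom_rel ℂ (FRel.l_mul f g), map_mul]

lemma r_mul (f g : MF n) : r P (f * g) = r P f * r P g := by
  simp only [r, RingQuot.mkAlgHom_rel ℂ (FRel.r_mul f g), map_mul]

lemma l_zero : l P (0 : MF n) = 0 := by
  simpa using l_scalar P (n := n) 0

lemma r_zero : r P (0 : MF n) = 0 := by
  simpa using r_scalar P (n := n) 0

lemma l_e (f : MF n) (i j : Fin n) (z : ℂˣ) :
    l P f * e P i j z = e P i j z * l P (Mero.shift (wt i) f) := by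
  simp only [l, e, ← map_mul, RingQuot.mkAlgHom_rel ℂ (FRel.l_e f i j z)]

lemma r_e (f : MF n) (i j : Fin n) (z : ℂˣ) :
    r P f * e P i j z = e P i j z * r P (Mero.shift (wt j) f) := by
  simp only [r, e, ← map_mul, RingQuot.mkAlgHom_rel ℂ (FRel.r_e f i j z)]

lemma rll (a b c d : Fin n) (z₁ z₂ : ℂˣ) (h : ¬ P.IsPole (z₁ / z₂)) :
    ∑ x, ∑ y, l P (P.RmatM x y a c (z₁ / z₂)) * e P x b z₁ * e P y d z₂ =
      ∑ x, ∑ y, r P (P.RmatM b d x y (z₁ / z₂)) * e P c y z₂ * e P a x z₁ := by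
  have := RingQuot.mkAlgHom_rel ℂ (FRel.rll (P := P) a b c d z₁ z₂ (fun _ => 1)
    (fun _ _ => MeromorphicAt.const 1 _) _ _ (fun x y => P.RmatM_limit x y a c h)
    (fun x y => P.RmatM_limit b d x y h))
  simp only [map_sum, map_mul] at this
  exact this

lemma l_mem (f : MF n) : l P f ∈ component P (0 : CartanDual n) 0 :=
  Submodule.subset_span (by simpa using IsMonomial.l_mul (P := P) f .one)

lemma r_mem (f : MF n) : r P f ∈ component P (0 : CartanDual n) 0 :=
  Submodule.subset_span (by simpa using IsMonomial.r_mul (P := P) f .one)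

lemma one_mem : (1 : FEll P n) ∈ component P (0 : CartanDual n) 0 :=
  Submodule.subset_span .one

lemma e_mem (i j : Fin n) (z : ℂˣ) : e P i j z ∈ component P (wt i) (wt j) :=
  Submodule.subset_span (by simpa using IsMonomial.e_mul (P := P) i j z .one)

lemma ee_mem (i j k m : Fin n) (z w : ℂˣ) :
    e P i j z * e P k m w ∈ component P (wt i + wt k) (wt j + wt m) :=
  Submodule.subset_span (by
    simpa using IsMonomial.e_mul (P := P) i j z (IsMonomial.e_mul k m w .one))

end FEll

namespace LeftExt

lemma f_scalar (c : ℂ) : f P (algebraMap ℂ (MF n) c) = algebraMap ℂ (LeftExt P n) c := by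
  rw [f, RingQuot.mkAlgHom_rel ℂ (LeftExtRel.scalar c), AlgHom.commutes]

lemma f_add (g h : MF n) : f P (g + h) = f P g + f P h := by
  simp only [f, RingQuot.mkAlgHom_rel ℂ (LeftExtRel.add g h), map_add]

lemma f_mul (g h : MF n) : f P (g * h) = f P g * f P h := by
  simp only [f, RingQuot.mkAlgHom_rel ℂ (LeftExtRel.mul g h), map_mul]

lemma f_zero : f P (0 : MF n) = 0 := by
  simpa using f_scalar P (n := n) 0

lemma f_one : f P (1 : MF n) = 1 := by
  simpa using f_scalar P (n := n) 1

lemma v_v (i : Fin n) (z w : ℂˣ) : v P i z * v P i w = 0 := by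
  have := RingQuot.mkAlgHom_rel ℂ (LeftExtRel.v_v (P := P) i z w)
  simp only [map_mul, map_zero] at this
  exact this

lemma pole (k j : Fin n) (z w : ℂˣ) (h : P.IsPole (z / w)) : v P k z * v P j w = 0 := by
  by_cases hkj : k = j
  · rw [hkj, v_v]
  · have := RingQuot.mkAlgHom_rel ℂ (LeftExtRel.pole (P := P) k j z w h)
    simp only [map_mul, map_zero] at this
    exact this

lemma wedge (x y : Fin n) (z w : ℂˣ) (h : ¬ P.IsPole (z / w)) :
    ∑ b, ∑ d, f P (P.RmatM b d x y (z / w)) * (v P b z * v P d w) = 0 := by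
  rw [P.sum_lower_fixed x y (z / w) (fun g b d => f P g * (v P b z * v P d w))
    (fun _ _ => by simp only [f_zero, zero_mul])]
  split_ifs with hxy
  · rw [v_v, mul_zero]
  · have := RingQuot.mkAlgHom_rel ℂ (LeftExtRel.wedge (P := P) x y hxy z w h)
    simp only [map_mul, map_add, map_zero, mul_assoc] at this
    exact this

lemma f_mem (g : MF n) : f P g ∈ component P (0 : CartanDual n) :=
  Submodule.subset_span (by simpa using IsMonomial.f_mul (P := P) g .one)

lemma one_mem : (1 : LeftExt P n) ∈ component P (0 : CartanDual n) :=
  Submodule.subset_span .one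

lemma v_mem (i : Fin n) (z : ℂˣ) : v P i z ∈ component P (wt i) :=
  Submodule.subset_span (by simpa using IsMonomial.v_mul (P := P) i z .one)

lemma vv_mem (i j : Fin n) (z w : ℂˣ) : v P i z * v P j w ∈ component P (wt i + wt j) :=
  Submodule.subset_span (by
    simpa using IsMonomial.v_mul (P := P) i z (IsMonomial.v_mul j w .one))

end LeftExt

namespace RightExt

lemma f_scalar (c : ℂ) : f P (algebraMap ℂ (MF n) c) = algebraMap ℂ (RightExt P n) c := by
  rw [f, RingQuot.mkAlgHom_rel ℂ (RightExtRel.scalar c), AlgHom.commutes]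

lemma f_zero : f P (0 : MF n) = 0 := by
  simpa using f_scalar P (n := n) 0

lemma w_w (i : Fin n) (z w' : ℂˣ) : w P i z * w P i w' = 0 := by
  have := RingQuot.mkAlgHom_rel ℂ (RightExtRel.w_w (P := P) i z w')
  simp only [map_mul, map_zero] at this
  exact this

lemma pole (k j : Fin n) (z₁ z₂ : ℂˣ) (h : P.IsPole (z₁ / z₂)) : w P j z₂ * w P k z₁ = 0 := by
  by_cases hkj : k = j
  · rw [hkj, w_w]
  · have := RingQuot.mkAlgHom_rel ℂ (RightExtRel.pole (P := P) k j z₁ z₂ h)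
    simp only [map_mul, map_zero] at this
    exact this

lemma wedge (x y : Fin n) (z₁ z₂ : ℂˣ) (h : ¬ P.IsPole (z₁ / z₂)) :
    ∑ a, ∑ c, f P (P.RmatM x y a c (z₁ / z₂)) * (w P c z₂ * w P a z₁) = 0 := by
  rw [P.sum_upper_fixed x y (z₁ / z₂) (fun g a c => f P g * (w P c z₂ * w P a z₁))
    (fun _ _ => by simp only [f_zero, zero_mul])]
  split_ifs with hxy
  · rw [w_w, mul_zero]
  · have := RingQuot.mkAlgHom_rel ℂ (RightExtRel.wedge (P := P) x y hxy z₁ z₂ h)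
    simp only [map_mul, map_add, map_zero, mul_assoc] at this
    exact this

lemma f_mem (g : MF n) : f P g ∈ component P (0 : CartanDual n) :=
  Submodule.subset_span (by simpa using IsMonomial.f_mul (P := P) g .one)

lemma one_mem : (1 : RightExt P n) ∈ component P (0 : CartanDual n) :=
  Submodule.subset_span .one

lemma w_mem (i : Fin n) (z : ℂˣ) : w P i z ∈ component P (wt i) :=
  Submodule.subset_span (by simpa using IsMonomial.w_mul (P := P) i z .one)

lemma ww_mem (i j : Fin n) (z z' : ℂˣ) : w P i z * w P j z' ∈ component P (wt i + wt j) :=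
  Submodule.subset_span (by
    simpa using IsMonomial.w_mul (P := P) i z (IsMonomial.w_mul j z' .one))

end RightExt

namespace LeftTensor

/-- The class in `F ⊗̃ Λ` of an element of `⨁ F_{αβ} ⊗ Λ_β`. -/
def mk : leftGraded P n →ₐ[ℂ] LeftTensor P n := RingQuot.mkAlgHom ℂ (LeftBalance P n)

lemma mem_graded {α β : CartanDual n} {a : FEll P n} {v : LeftExt P n}
    (ha : a ∈ FEll.component P α β) (hv : v ∈ LeftExt.component P β) :
    a ⊗ₜ[ℂ] v ∈ leftGraded P n :=
  Algebra.subset_adjoin ⟨α, β, a, ha, v, hv, rfl⟩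

/-- `f(λ) ⊗ 1`. -/
def lElt (f : MF n) : leftGraded P n :=
  ⟨FEll.l P f ⊗ₜ 1, mem_graded P (FEll.l_mem P f) (LeftExt.one_mem P)⟩

/-- `f(ρ) ⊗ 1`. -/
def rElt (f : MF n) : leftGraded P n :=
  ⟨FEll.r P f ⊗ₜ 1, mem_graded P (FEll.r_mem P f) (LeftExt.one_mem P)⟩

/-- `1 ⊗ f(ζ)`. -/
def fElt (f : MF n) : leftGraded P n :=
  ⟨1 ⊗ₜ LeftExt.f P f, mem_graded P (FEll.one_mem P) (LeftExt.f_mem P f)⟩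

/-- `e_ij(z) ⊗ v_j(z)`. -/
def evElt (i j : Fin n) (z : ℂˣ) : leftGraded P n :=
  ⟨FEll.e P i j z ⊗ₜ LeftExt.v P j z, mem_graded P (FEll.e_mem P i j z) (LeftExt.v_mem P j z)⟩

lemma mk_rElt (f : MF n) : mk P (rElt P f) = mk P (fElt P f) :=
  RingQuot.mkAlgHom_rel ℂ ⟨f, rfl, rfl⟩

open Classical in
/-- An auxiliary element: `e_cy(w) e_ax(z) ⊗ v_b(z) v_d(w)`, if this has matching degrees. -/
def aux (a c x y b d : Fin n) (z w : ℂˣ) : leftGraded P n :=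
  if h : (FEll.e P c y w * FEll.e P a x z) ⊗ₜ[ℂ] (LeftExt.v P b z * LeftExt.v P d w) ∈
    leftGraded P n then ⟨_, h⟩ else 0

lemma aux_coe (a c x y b d : Fin n) (z w : ℂˣ) (h : (x = b ∧ y = d) ∨ (x = d ∧ y = b)) :
    (aux P a c x y b d z w : FEll P n ⊗[ℂ] LeftExt P n) =
      (FEll.e P c y w * FEll.e P a x z) ⊗ₜ[ℂ] (LeftExt.v P b z * LeftExt.v P d w) := by
  have hm : (FEll.e P c y w * FEll.e P a x z) ⊗ₜ[ℂ] (LeftExt.v P b z * LeftExt.v P d w) ∈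
      leftGraded P n := by
    refine mem_graded P (FEll.ee_mem P c y a x w z) ?_
    have hv := LeftExt.vv_mem P b d z w
    rcases h with ⟨rfl, rfl⟩ | ⟨rfl, rfl⟩
    · rwa [add_comm]
    · exact hv
  rw [aux, dif_pos hm]

lemma mk_wedge (a c : Fin n) (z w : ℂˣ) (h : ¬ P.IsPole (z / w)) :
    ∑ x, ∑ y, mk P (lElt P (P.RmatM x y a c (z / w))) *
      ((∑ b, mk P (evElt P x b z)) * (∑ d, mk P (evElt P y d w))) = 0 := by
  have key : ∀ b d, ∑ x, ∑ y, lElt P (P.RmatM x y a c (z / w)) *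
      (evElt P x b z * evElt P y d w) =
      ∑ x, ∑ y, rElt P (P.RmatM b d x y (z / w)) * aux P a c x y b d z w := by
    intro b d
    apply Subtype.ext
    have h1 := congrArg (fun t => t ⊗ₜ[ℂ] (LeftExt.v P b z * LeftExt.v P d w))
      (FEll.rll P a b c d z w h)
    simp only [TensorProduct.sum_tmul] at h1
    push_cast
    simp only [lElt, evElt, rElt, Algebra.TensorProduct.tmul_mul_tmul, one_mul]
    simp only [mul_assoc] at h1
    rw [h1]
    refine Finset.sum_congr rfl fun x _ => Finset.sum_congr rfl fun y _ => ?_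
    by_cases h0 : P.RmatM b d x y (z / w) = 0
    · simp [h0, FEll.r_zero]
    · rw [aux_coe P a c x y b d z w (P.RmatM_ne_zero h0)]
      simp
  have key2 : ∀ x y, ∑ b, ∑ d, fElt P (P.RmatM b d x y (z / w)) * aux P a c x y b d z w = 0 := by
    intro x y
    apply Subtype.ext
    have h1 := congrArg (fun t => (FEll.e P c y w * FEll.e P a x z) ⊗ₜ[ℂ] t)
      (LeftExt.wedge P x y z w h)
    simp only [TensorProduct.tmul_sum, TensorProduct.tmul_zero] at h1
    push_cast
    rw [← h1]
    refine Finset.sum_congr rfl fun b _ => Finset.sum_congr rfl fun d _ => ?_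
    by_cases h0 : P.RmatM b d x y (z / w) = 0
    · simp [h0, fElt, LeftExt.f_zero]
    · rw [aux_coe P a c x y b d z w (P.RmatM_ne_zero h0)]
      simp [fElt]
  calc _ = ∑ b, ∑ d, mk P (∑ x, ∑ y, lElt P (P.RmatM x y a c (z / w)) *
      (evElt P x b z * evElt P y d w)) := by
        simp only [map_sum]
        rw [← sum_swap_pairs]
        refine Finset.sum_congr rfl fun x _ => Finset.sum_congr rfl fun y _ => ?_
        rw [Finset.sum_mul_sum]
        simp only [Finset.mul_sum, map_mul]
    _ = ∑ b, ∑ d, ∑ x, ∑ y, mk P (fElt P (P.RmatM b d x y (z / w)) * aux P a c x y b d z w) := by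
        refine Finset.sum_congr rfl fun b _ => Finset.sum_congr rfl fun d _ => ?_
        rw [key b d]
        simp only [map_sum, map_mul, mk_rElt]
    _ = ∑ x, ∑ y, mk P (∑ b, ∑ d, fElt P (P.RmatM b d x y (z / w)) *
          aux P a c x y b d z w) := by
        simp only [map_sum]
        rw [sum_swap_pairs]
    _ = 0 := by simp [key2]

lemma mk_pole (i j : Fin n) (z w : ℂˣ) (h : P.IsPole (z / w)) :
    (∑ b, mk P (evElt P i b z)) * (∑ d, mk P (evElt P j d w)) = 0 := by
  rw [Finset.sum_mul_sum]
  refine Finset.sum_eq_zero fun b _ => Finset.sum_eq_zero fun d _ => ?_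
  rw [← map_mul]
  have : evElt P i b z * evElt P j d w = 0 := by
    apply Subtype.ext
    simp [evElt, LeftExt.pole P b d z w h]
  rw [this, map_zero]

lemma lElt_zero : lElt P (0 : MF n) = 0 := Subtype.ext (by simp [lElt, FEll.l_zero])

lemma lElt_scalar (c : ℂ) : lElt P (algebraMap ℂ (MF n) c) = algebraMap ℂ _ c :=
  Subtype.ext (by
    simp only [lElt, FEll.l_scalar, Subalgebra.coe_algebraMap]
    rw [Algebra.TensorProduct.algebraMap_apply])

lemma lElt_one : lElt P (1 : MF n) = 1 := by
  simpa using lElt_scalar P (n := n) 1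

end LeftTensor

/-- The left coaction on generators: `v_i(z) ↦ ∑_j e_ij(z) ⊗ v_j(z)` and `f(ζ) ↦ f(λ) ⊗ 1`. -/
def leftCoactionGen : ExtGen n → LeftTensor P n
  | .f g => LeftTensor.mk P (LeftTensor.lElt P g)
  | .v i z => ∑ j, LeftTensor.mk P (LeftTensor.evElt P i j z)

open LeftTensor in
lemma leftCoaction_wd ⦃s t : FreeAlgebra ℂ (ExtGen n)⦄ (h : LeftExtRel P n s t) :
    FreeAlgebra.lift ℂ (leftCoactionGen P) s = FreeAlgebra.lift ℂ (leftCoactionGen P) t := by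
  induction h with
  | scalar c =>
    simp only [FreeAlgebra.lift_ι_apply, leftCoactionGen, lElt_scalar, AlgHom.commutes]
  | add f g =>
    simp only [FreeAlgebra.lift_ι_apply, leftCoactionGen, map_add]
    rw [← map_add]
    congr 1
    exact Subtype.ext (by simp [lElt, FEll.l_add, TensorProduct.add_tmul])
  | mul f g =>
    simp only [FreeAlgebra.lift_ι_apply, leftCoactionGen, map_mul]
    rw [← map_mul]
    congr 1
    exact Subtype.ext (by simp [lElt, FEll.l_mul])
  | f_v f i z =>
    simp only [FreeAlgebra.lift_ι_apply, leftCoactionGen, map_mul, Finset.mul_sum, Finset.sum_mul]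
    refine Finset.sum_congr rfl fun j _ => ?_
    rw [← map_mul, ← map_mul]
    congr 1
    exact Subtype.ext (by simp [lElt, evElt, FEll.l_e])
  | v_v i z w =>
    simp only [FreeAlgebra.lift_ι_apply, leftCoactionGen, map_mul, map_zero]
    by_cases h : P.IsPole (z / w)
    · exact mk_pole P i i z w h
    · have := mk_wedge P i i z w h
      rw [P.sum_lower_fixed i i (z / w) (fun g x y => mk P (lElt P g) *
        ((∑ b, mk P (evElt P x b z)) * (∑ d, mk P (evElt P y d w))))
        (fun _ _ => by simp [lElt_zero]), if_pos rfl] at this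
      simpa [lElt_one] using this
  | wedge k j hkj z w h =>
    simp only [FreeAlgebra.lift_ι_apply, leftCoactionGen, map_mul, map_zero, map_add]
    have := mk_wedge P k j z w h
    rw [P.sum_lower_fixed k j (z / w) (fun g x y => mk P (lElt P g) *
      ((∑ b, mk P (evElt P x b z)) * (∑ d, mk P (evElt P y d w))))
      (fun _ _ => by simp [lElt_zero]), if_neg hkj] at this
    simpa only [mul_assoc] using this
  | pole k j z w h =>
    simp only [FreeAlgebra.lift_ι_apply, leftCoactionGen, map_mul, map_zero]
    exact mk_pole P k j z w h

/-- The left coaction `Λ → F ⊗̃ Λ`: the algebra homomorphism with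
`v_i(z) ↦ ∑_j e_ij(z) ⊗ v_j(z)` and `f(ζ) ↦ f(λ) ⊗ 1`. -/
def leftCoaction : LeftExt P n →ₐ[ℂ] LeftTensor P n :=
  RingQuot.liftAlgHom ℂ ⟨FreeAlgebra.lift ℂ (leftCoactionGen P), leftCoaction_wd P⟩

namespace RightTensor

/-- The class in `Λ' ⊗̃ F` of an element of `⨁ Λ'_α ⊗ F_{αβ}`. -/
def mk : rightGraded P n →ₐ[ℂ] RightTensor P n := RingQuot.mkAlgHom ℂ (RightBalance P n)

lemma mem_graded {α β : CartanDual n} {a : FEll P n} {v : RightExt P n}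
    (hv : v ∈ RightExt.component P α) (ha : a ∈ FEll.component P α β) :
    v ⊗ₜ[ℂ] a ∈ rightGraded P n :=
  Algebra.subset_adjoin ⟨α, β, v, hv, a, ha, rfl⟩

/-- `1 ⊗ f(λ)`. -/
def lElt (f : MF n) : rightGraded P n :=
  ⟨1 ⊗ₜ FEll.l P f, mem_graded P (RightExt.one_mem P) (FEll.l_mem P f)⟩

/-- `1 ⊗ f(ρ)`. -/
def rElt (f : MF n) : rightGraded P n :=
  ⟨1 ⊗ₜ FEll.r P f, mem_graded P (RightExt.one_mem P) (FEll.r_mem P f)⟩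

/-- `f(ζ) ⊗ 1`. -/
def fElt (f : MF n) : rightGraded P n :=
  ⟨RightExt.f P f ⊗ₜ 1, mem_graded P (RightExt.f_mem P f) (FEll.one_mem P)⟩

/-- `w^i(z) ⊗ e_ij(z)`. -/
def weElt (i j : Fin n) (z : ℂˣ) : rightGraded P n :=
  ⟨RightExt.w P i z ⊗ₜ FEll.e P i j z, mem_graded P (RightExt.w_mem P i z) (FEll.e_mem P i j z)⟩

lemma mk_fElt (f : MF n) : mk P (fElt P f) = mk P (lElt P f) :=
  RingQuot.mkAlgHom_rel ℂ ⟨f, rfl, rfl⟩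

open Classical in
/-- An auxiliary element: `w^c(z₂) w^a(z₁) ⊗ e_xb(z₁) e_yd(z₂)`, if this has matching degrees. -/
def aux (a c x y b d : Fin n) (z₁ z₂ : ℂˣ) : rightGraded P n :=
  if h : (RightExt.w P c z₂ * RightExt.w P a z₁) ⊗ₜ[ℂ] (FEll.e P x b z₁ * FEll.e P y d z₂) ∈
    rightGraded P n then ⟨_, h⟩ else 0

lemma aux_coe (a c x y b d : Fin n) (z₁ z₂ : ℂˣ) (h : (a = x ∧ c = y) ∨ (a = y ∧ c = x)) :
    (aux P a c x y b d z₁ z₂ : RightExt P n ⊗[ℂ] FEll P n) =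
      (RightExt.w P c z₂ * RightExt.w P a z₁) ⊗ₜ[ℂ] (FEll.e P x b z₁ * FEll.e P y d z₂) := by
  have hm : (RightExt.w P c z₂ * RightExt.w P a z₁) ⊗ₜ[ℂ] (FEll.e P x b z₁ * FEll.e P y d z₂) ∈
      rightGraded P n := by
    refine mem_graded P ?_ (FEll.ee_mem P x b y d z₁ z₂)
    have hv := RightExt.ww_mem P c a z₂ z₁
    rcases h with ⟨rfl, rfl⟩ | ⟨rfl, rfl⟩
    · rwa [add_comm]
    · exact hv
  rw [aux, dif_pos hm]

lemma mk_wedge (b d : Fin n) (z₁ z₂ : ℂˣ) (h : ¬ P.IsPole (z₁ / z₂)) :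
    ∑ x, ∑ y, mk P (rElt P (P.RmatM b d x y (z₁ / z₂))) *
      ((∑ c, mk P (weElt P c y z₂)) * (∑ a, mk P (weElt P a x z₁))) = 0 := by
  have key : ∀ c a, ∑ x, ∑ y, rElt P (P.RmatM b d x y (z₁ / z₂)) *
      (weElt P c y z₂ * weElt P a x z₁) =
      ∑ x, ∑ y, lElt P (P.RmatM x y a c (z₁ / z₂)) * aux P a c x y b d z₁ z₂ := by
    intro c a
    apply Subtype.ext
    have h1 := congrArg (fun t => (RightExt.w P c z₂ * RightExt.w P a z₁) ⊗ₜ[ℂ] t)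
      (FEll.rll P a b c d z₁ z₂ h)
    simp only [TensorProduct.tmul_sum] at h1
    push_cast
    simp only [lElt, weElt, rElt, Algebra.TensorProduct.tmul_mul_tmul, one_mul]
    simp only [mul_assoc] at h1
    rw [← h1]
    refine Finset.sum_congr rfl fun x _ => Finset.sum_congr rfl fun y _ => ?_
    by_cases h0 : P.RmatM x y a c (z₁ / z₂) = 0
    · simp [h0, FEll.l_zero]
    · rw [aux_coe P a c x y b d z₁ z₂ (P.RmatM_ne_zero h0)]
      simp
  have key2 : ∀ x y, ∑ a, ∑ c, fElt P (P.RmatM x y a c (z₁ / z₂)) *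
      aux P a c x y b d z₁ z₂ = 0 := by
    intro x y
    apply Subtype.ext
    have h1 := congrArg (fun t => t ⊗ₜ[ℂ] (FEll.e P x b z₁ * FEll.e P y d z₂))
      (RightExt.wedge P x y z₁ z₂ h)
    simp only [TensorProduct.sum_tmul, TensorProduct.zero_tmul] at h1
    push_cast
    rw [← h1]
    refine Finset.sum_congr rfl fun a _ => Finset.sum_congr rfl fun c _ => ?_
    by_cases h0 : P.RmatM x y a c (z₁ / z₂) = 0
    · simp [h0, fElt, RightExt.f_zero]
    · rw [aux_coe P a c x y b d z₁ z₂ (P.RmatM_ne_zero h0)]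
      simp [fElt]
  calc _ = ∑ c, ∑ a, mk P (∑ x, ∑ y, rElt P (P.RmatM b d x y (z₁ / z₂)) *
      (weElt P c y z₂ * weElt P a x z₁)) := by
        simp only [map_sum]
        rw [← sum_swap_pairs]
        refine Finset.sum_congr rfl fun x _ => Finset.sum_congr rfl fun y _ => ?_
        rw [Finset.sum_mul_sum]
        simp only [Finset.mul_sum, map_mul]
    _ = ∑ c, ∑ a, ∑ x, ∑ y, mk P (fElt P (P.RmatM x y a c (z₁ / z₂)) *
          aux P a c x y b d z₁ z₂) := by
        refine Finset.sum_congr rfl fun c _ => Finset.sum_congr rfl fun a _ => ?_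
        rw [key c a]
        simp only [map_sum, map_mul, mk_fElt]
    _ = ∑ x, ∑ y, mk P (∑ a, ∑ c, fElt P (P.RmatM x y a c (z₁ / z₂)) *
          aux P a c x y b d z₁ z₂) := by
        simp only [map_sum]
        rw [Finset.sum_comm, sum_swap_pairs]
    _ = 0 := by simp [key2]

lemma mk_pole (i j : Fin n) (z₁ z₂ : ℂˣ) (h : P.IsPole (z₁ / z₂)) :
    (∑ c, mk P (weElt P c j z₂)) * (∑ a, mk P (weElt P a i z₁)) = 0 := by
  rw [Finset.sum_mul_sum]
  refine Finset.sum_eq_zero fun c _ => Finset.sum_eq_zero fun a _ => ?_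
  rw [← map_mul]
  have : weElt P c j z₂ * weElt P a i z₁ = 0 := by
    apply Subtype.ext
    simp [weElt, RightExt.pole P a c z₁ z₂ h]
  rw [this, map_zero]

lemma rElt_zero : rElt P (0 : MF n) = 0 := Subtype.ext (by simp [rElt, FEll.r_zero])

lemma rElt_scalar (c : ℂ) : rElt P (algebraMap ℂ (MF n) c) = algebraMap ℂ _ c :=
  Subtype.ext (by
    simp only [rElt, FEll.r_scalar, Subalgebra.coe_algebraMap]
    rw [Algebra.TensorProduct.algebraMap_apply, Algebra.algebraMap_eq_smul_one,
      Algebra.algebraMap_eq_smul_one, TensorProduct.tmul_smul, TensorProduct.smul_tmul'])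

lemma rElt_one : rElt P (1 : MF n) = 1 := by
  simpa using rElt_scalar P (n := n) 1

end RightTensor

/-- The right coaction on generators: `w^j(z) ↦ ∑_i w^i(z) ⊗ e_ij(z)` and
`f(ζ) ↦ 1 ⊗ f(ρ)`. -/
def rightCoactionGen : ExtGen n → RightTensor P n
  | .f g => RightTensor.mk P (RightTensor.rElt P g)
  | .v j z => ∑ i, RightTensor.mk P (RightTensor.weElt P i j z)

open RightTensor in
lemma rightCoaction_wd ⦃s t : FreeAlgebra ℂ (ExtGen n)⦄ (h : RightExtRel P n s t) :
    FreeAlgebra.lift ℂ (rightCoactionGen P) s = FreeAlgebra.lift ℂ (rightCoactionGen P) t := by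
  induction h with
  | scalar c =>
    simp only [FreeAlgebra.lift_ι_apply, rightCoactionGen, rElt_scalar, AlgHom.commutes]
  | add f g =>
    simp only [FreeAlgebra.lift_ι_apply, rightCoactionGen, map_add]
    rw [← map_add]
    congr 1
    exact Subtype.ext (by simp [rElt, FEll.r_add, TensorProduct.tmul_add])
  | mul f g =>
    simp only [FreeAlgebra.lift_ι_apply, rightCoactionGen, map_mul]
    rw [← map_mul]
    congr 1
    exact Subtype.ext (by simp [rElt, FEll.r_mul])
  | f_w f i z =>
    simp only [FreeAlgebra.lift_ι_apply, rightCoactionGen, map_mul, Finset.mul_sum, Finset.sum_mul]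
    refine Finset.sum_congr rfl fun j _ => ?_
    rw [← map_mul, ← map_mul]
    congr 1
    exact Subtype.ext (by simp [rElt, weElt, FEll.r_e])
  | w_w i z w =>
    simp only [FreeAlgebra.lift_ι_apply, rightCoactionGen, map_mul, map_zero]
    by_cases h : P.IsPole (w / z)
    · exact mk_pole P i i w z h
    · have := mk_wedge P i i w z h
      rw [P.sum_upper_fixed i i (w / z) (fun g x y => mk P (rElt P g) *
        ((∑ c, mk P (weElt P c y z)) * (∑ a, mk P (weElt P a x w))))
        (fun _ _ => by simp [rElt_zero]), if_pos rfl] at this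
      simpa [rElt_one] using this
  | wedge k j hkj z w h =>
    simp only [FreeAlgebra.lift_ι_apply, rightCoactionGen, map_mul, map_zero, map_add]
    have := mk_wedge P k j z w h
    rw [P.sum_upper_fixed k j (z / w) (fun g x y => mk P (rElt P g) *
      ((∑ c, mk P (weElt P c y w)) * (∑ a, mk P (weElt P a x z))))
      (fun _ _ => by simp [rElt_zero]), if_neg hkj] at this
    simpa only [mul_assoc] using this
  | pole k j z w h =>
    simp only [FreeAlgebra.lift_ι_apply, rightCoactionGen, map_mul, map_zero]
    exact mk_pole P k j z w h

/-- The right coaction `Λ' → Λ' ⊗̃ F`: the algebra homomorphism with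
`w^j(z) ↦ ∑_i w^i(z) ⊗ e_ij(z)` and `f(ζ) ↦ 1 ⊗ f(ρ)`. -/
def rightCoaction : RightExt P n →ₐ[ℂ] RightTensor P n :=
  RingQuot.liftAlgHom ℂ ⟨FreeAlgebra.lift ℂ (rightCoactionGen P), rightCoaction_wd P⟩

end Coaction

/-! ### Elliptic minors -/

/-- The family `ξ I J` is the family of left elliptic minors at `z`: it satisfies
`Δ_Λ(v_I(z)) = ∑_J ξ_I^J(z) ⊗ v_J(z)` in `F ⊗̃ Λ` for all subsets `I`. -/
def IsLeftMinors (P : EllParams) {n : ℕ} (z : ℂˣ)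
    (ξ : Finset (Fin n) → Finset (Fin n) → FEll P n) : Prop :=
  ∀ I, ∃ h : ∑ J, ξ I J ⊗ₜ[ℂ] LeftExt.vI P J z ∈ leftGraded P n,
    leftCoaction P (LeftExt.vI P I z) = LeftTensor.mk P ⟨_, h⟩

/-- The family `ξ I J` is the family of right elliptic minors at `z`: it satisfies
`Δ_Λ'(w^J(z)) = ∑_I w^I(z) ⊗ ξ_I^J(z)` in `Λ' ⊗̃ F` for all subsets `J`. -/
def IsRightMinors (P : EllParams) {n : ℕ} (z : ℂˣ)
    (ξ : Finset (Fin n) → Finset (Fin n) → FEll P n) : Prop :=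
  ∀ J, ∃ h : ∑ I, RightExt.wI P I z ⊗ₜ[ℂ] ξ I J ∈ rightGraded P n,
    rightCoaction P (RightExt.wI P J z) = RightTensor.mk P ⟨_, h⟩

end

/-!
The minors are the coefficients of the coactions on the elements `v_I(z)` and `w^I(z)`. Two facts
make them well defined.

*Existence.* At parameters with quotient `q^2` the relations of `Λ` and `Λ'` say that
`c_ji v_i v_j = c_ij v_j v_i`, where `c_ij` is `E(ζ_ji + 1)` for `Λ` and `E(ζ_ij)⁻¹` for `Λ'`.
Hence the normalized words `v_I(z)` and `w^I(z)` do not depend on the order of their factors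
(`ExchangeData.word_perm`), and applying the coaction factor by factor expresses the coaction on a
word in terms of such words, with coefficients that are given recursively by a Laplace expansion
(`CoactionData.coaction_word`).

*Uniqueness.* The algebra `Λ` acts on functions on the subsets of `{1, …, n}` with values in the
meromorphic functions: `v_i(q^(2m) z)` adds `i` to sets of size `m` with a suitable factor
(`LeftExt.exists_rep`), and similarly for `Λ'` (`RightExt.exists_rep`). Here `v_I(z)` maps the
basis vector of the empty set to the one of `I`. Such a representation induces one of `F ⊗̃ Λ`
with coefficients in `F`, from which the coefficients of `∑_J ξ_J ⊗ v_J(z)` can be read off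
(`coeff_eq_of_proj_eq`). By uniqueness, minors may be expanded along an arbitrary row (left
minors, `leftMinor_expand`) or column (right minors, `rightMinor_expand`).

*Left and right minors agree.* This is shown by induction on the size `N + 1` of the minors.
Multiplied by `q^(N-1) θ(q^2 w)`, the R-matrix has the limit with entries
`E(N) E(ζ_ij + 1) / E(ζ_ij)` and `-E(1) E(ζ_ij + N) / E(ζ_ij)` at `w = q^(-2N)`, which gives an
exchange relation between `e_ab(z)` and `e_cd(q^(2N) z)` (`FEll.residual_rll`). Multiply it by
minors of size `N - 1` and sum over the rows and columns that are removed. By induction, the terms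
of the first kind combine to all but one summand of the expansion of the left (respectively right)
minor of size `N + 1`. The terms of the second kind combine to the missing summand, because of the
identity
`E(1) ∑_a E(y_a + N) / E(y_a) ∏_{k ≠ a} E(y_k - y_a + 1) / E(y_k - y_a)
  = E(N) ∏_k E(y_k + 1) / E(y_k)`
in `N` variables (`EllParams.E_partial_fractions`, `exchange_resummation`). The latter holds since
the difference of both sides extends to an entire function of a simultaneous translation of all
`y_k`, and is quasi-periodic with a multiplier that only the zero function admits. Finally, `E(N)`
can be cancelled: it is nonzero as `p` and `q` are multiplicatively independent.
-/

/-! ### Theta functions -/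

namespace EllParams

variable (P : EllParams)

lemma p_ne_zero : (P.p : ℂ) ≠ 0 := P.pU.ne_zero

lemma q_ne_zero : (P.q : ℂ) ≠ 0 := P.qU.ne_zero

/-- The function `k(z) = ∏_{j ≥ 0} (1 - z p^(j+1)) (1 - p^(j+1) / z)`, which is `θ(z) / (1 - z)`.
It is invariant under `z ↦ 1 / z`, and both functional equations of `θ` follow from this. -/
noncomputable def thetaReg (z : ℂ) : ℂ :=
  ∏' j : ℕ, (1 - z * (P.p : ℂ) ^ (j + 1)) * (1 - (P.p : ℂ) ^ (j + 1) / z)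

lemma summable_mul_pow_succ (c : ℂ) : Summable fun j : ℕ => ‖-(c * (P.p : ℂ) ^ (j + 1))‖ := by
  have h : Summable fun j : ℕ => ‖c‖ * P.p * P.p ^ j :=
    (summable_geometric_of_lt_one P.p_pos.le P.p_lt_one).mul_left _
  refine h.congr fun j => ?_
  rw [norm_neg, norm_mul, norm_pow, Complex.norm_real, Real.norm_of_nonneg P.p_pos.le]
  ring

lemma multipliable_one_sub_mul_pow (c : ℂ) :
    Multipliable fun j : ℕ => (1 - c * (P.p : ℂ) ^ (j + 1)) := by
  simpa [sub_eq_add_neg] using multipliable_one_add_of_summable (P.summable_mul_pow_succ c)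

/-- The half product `∏_{j ≥ 0} (1 - c p^(j+1))`. -/
noncomputable def halfProd (c : ℂ) : ℂ := ∏' j : ℕ, (1 - c * (P.p : ℂ) ^ (j + 1))

lemma thetaReg_eq (z : ℂ) : P.thetaReg z = P.halfProd z * P.halfProd z⁻¹ := by
  rw [thetaReg, halfProd, halfProd, ← (P.multipliable_one_sub_mul_pow z).tprod_mul
    (P.multipliable_one_sub_mul_pow z⁻¹)]
  exact tprod_congr fun j => by rw [div_eq_inv_mul]

lemma thetaReg_inv (z : ℂ) : P.thetaReg z⁻¹ = P.thetaReg z := by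
  rw [thetaReg_eq, thetaReg_eq, inv_inv, mul_comm]

lemma tprod_one_sub_mul_pow (z : ℂ) :
    ∏' j : ℕ, (1 - z * (P.p : ℂ) ^ j) = (1 - z) * P.halfProd z := by
  have h : Multipliable fun j : ℕ => (1 - z * (P.p : ℂ) ^ (j + 1)) :=
    P.multipliable_one_sub_mul_pow z
  have := tprod_eq_zero_mul' (f := fun j : ℕ => (1 - z * (P.p : ℂ) ^ j)) h
  simpa [halfProd] using this

lemma multipliable_one_sub_mul_pow' (z : ℂ) :
    Multipliable fun j : ℕ => (1 - z * (P.p : ℂ) ^ j) := by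
  have h : Summable fun j : ℕ => ‖z‖ * P.p ^ j :=
    (summable_geometric_of_lt_one P.p_pos.le P.p_lt_one).mul_left _
  have : Summable fun j : ℕ => ‖-(z * (P.p : ℂ) ^ j)‖ := h.congr fun j => by
    rw [norm_neg, norm_mul, norm_pow, Complex.norm_real, Real.norm_of_nonneg P.p_pos.le]
  simpa [sub_eq_add_neg] using multipliable_one_add_of_summable this

lemma theta_eq (z : ℂ) : P.theta z = (1 - z) * P.thetaReg z := by
  have h1 : P.theta z = (∏' j : ℕ, (1 - z * (P.p : ℂ) ^ j)) * P.halfProd z⁻¹ := by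
    rw [theta, halfProd, ← (P.multipliable_one_sub_mul_pow' z).tprod_mul
      (P.multipliable_one_sub_mul_pow z⁻¹)]
    exact tprod_congr fun j => by rw [div_eq_inv_mul]
  rw [h1, tprod_one_sub_mul_pow, thetaReg_eq, mul_assoc]

lemma theta_p_mul (z : ℂ) (hz : z ≠ 0) : P.theta (P.p * z) = -z⁻¹ * P.theta z := by
  have hp := P.p_ne_zero
  have h1 : P.theta (P.p * z) = P.halfProd z * (∏' j : ℕ, (1 - z⁻¹ * (P.p : ℂ) ^ j)) := by
    rw [theta, halfProd, ← (P.multipliable_one_sub_mul_pow z).tprod_mul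
      (P.multipliable_one_sub_mul_pow' z⁻¹)]
    refine tprod_congr fun j => ?_
    congr 2
    · ring
    · rw [pow_succ']
      field_simp
  rw [h1, tprod_one_sub_mul_pow, theta_eq, thetaReg_eq]
  field_simp
  ring

lemma theta_inv (z : ℂ) (hz : z ≠ 0) : P.theta z⁻¹ = -z⁻¹ * P.theta z := by
  rw [theta_eq, theta_eq, thetaReg_inv]
  field_simp
  ring

lemma halfProd_continuous : Continuous P.halfProd := by
  refine continuous_iff_continuousAt.mpr fun z => ?_
  let f : ℕ → ℂ → ℂ := fun j w => -(w * (P.p : ℂ) ^ (j + 1))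
  have hsum : Summable fun j : ℕ => (‖z‖ + 1) * P.p * P.p ^ j :=
    (summable_geometric_of_lt_one P.p_pos.le P.p_lt_one).mul_left _
  have hK : IsOpen (Metric.ball (0 : ℂ) (‖z‖ + 1)) := Metric.isOpen_ball
  have hfc : ∀ j, ContinuousOn (f j) (Metric.ball (0 : ℂ) (‖z‖ + 1)) := fun j => by
    simp only [f]; fun_prop
  have hprod := Summable.hasProdLocallyUniformlyOn_nat_one_add (f := f) hK hsum
    (Eventually.of_forall fun j w hw => by
      have hw' : ‖w‖ ≤ ‖z‖ + 1 := (mem_ball_zero_iff.mp hw).le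
      have := P.p_pos
      simp only [f]
      rw [norm_neg, norm_mul, norm_pow, Complex.norm_real, Real.norm_of_nonneg P.p_pos.le,
        pow_succ', mul_assoc]
      gcongr) hfc
  have hc : ContinuousOn (fun w => ∏' j, (1 + f j w)) (Metric.ball (0 : ℂ) (‖z‖ + 1)) :=
    hprod.continuousOn (Eventually.of_forall fun s => by
      simpa [Finset.prod_fn] using continuousOn_finsetProd s
        (fun j _ => continuousOn_const.add (hfc j))).frequently
  have hEq : P.halfProd = fun w => ∏' j, (1 + f j w) := by
    funext w
    exact tprod_congr fun j => by simp [f, sub_eq_add_neg]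
  rw [hEq]
  exact hc.continuousAt (hK.mem_nhds (by simp))

lemma halfProd_one_ne_zero : P.halfProd 1 ≠ 0 := by
  have h := tprod_one_add_ne_zero_of_summable (f := fun j : ℕ => -(1 * (P.p : ℂ) ^ (j + 1)))
    (fun j => by
      rw [one_mul, ← sub_eq_add_neg]
      refine sub_ne_zero.mpr fun h => ?_
      have h1 : P.p ^ (j + 1) = 1 := by exact_mod_cast h.symm
      exact (pow_lt_one₀ P.p_pos.le P.p_lt_one (Nat.succ_ne_zero j)).ne h1)
    (P.summable_mul_pow_succ 1)
  simpa [halfProd, sub_eq_add_neg] using h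

/-- The zero of `θ` at `1` is simple. -/
lemma theta_hasDerivAt_one : ∃ c : ℂ, c ≠ 0 ∧ HasDerivAt P.theta c 1 := by
  refine ⟨-P.thetaReg 1, ?_, ?_⟩
  · rw [thetaReg_eq, inv_one]
    exact neg_ne_zero.mpr (mul_ne_zero P.halfProd_one_ne_zero P.halfProd_one_ne_zero)
  · have hc : ContinuousAt P.thetaReg 1 := by
      have : P.thetaReg = fun z => P.halfProd z * P.halfProd z⁻¹ := funext P.thetaReg_eq
      rw [this]
      exact P.halfProd_continuous.continuousAt.mul
        (ContinuousAt.comp (f := fun z : ℂ => z⁻¹) P.halfProd_continuous.continuousAt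
          (continuousAt_inv₀ one_ne_zero))
    rw [hasDerivAt_iff_tendsto_slope]
    refine ((hc.tendsto.mono_left nhdsWithin_le_nhds).neg).congr' ?_
    filter_upwards [self_mem_nhdsWithin] with z hz
    have hz' : z - 1 ≠ 0 := sub_ne_zero.mpr hz
    rw [slope_def_field, P.theta_eq z, P.theta_eq 1]
    field_simp
    ring

lemma theta_zpow_mul (k : ℤ) :
    ∃ c : ℂ, c ≠ 0 ∧ ∀ z : ℂ, z ≠ 0 → P.theta (P.p ^ k * z) = c * z ^ (-k) * P.theta z := by
  have hp := P.p_ne_zero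
  induction k using Int.induction_on with
  | zero => exact ⟨1, one_ne_zero, fun z hz => by simp⟩
  | succ k ih =>
    obtain ⟨c, hc, h⟩ := ih
    refine ⟨-c * ((P.p : ℂ) ^ k)⁻¹, by simp [hc, hp], fun z hz => ?_⟩
    have h1 : (P.p : ℂ) ^ ((k : ℤ) + 1) * z = P.p * ((P.p : ℂ) ^ (k : ℤ) * z) := by
      rw [zpow_add_one₀ hp]; ring
    rw [h1, P.theta_p_mul _ (mul_ne_zero (zpow_ne_zero _ hp) hz), h z hz, neg_add,
      zpow_add₀ hz, zpow_neg_one, zpow_natCast]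
    field_simp
  | pred k ih =>
    obtain ⟨c, hc, h⟩ := ih
    refine ⟨-c * (P.p : ℂ) ^ (-(k : ℤ) - 1), by simp [hc, hp, zpow_ne_zero], fun z hz => ?_⟩
    have hz1 : (P.p : ℂ) ^ (-(k : ℤ) - 1) * z ≠ 0 := mul_ne_zero (zpow_ne_zero _ hp) hz
    have h1 : (P.p : ℂ) ^ (-(k : ℤ)) * z = P.p * ((P.p : ℂ) ^ (-(k : ℤ) - 1) * z) := by
      rw [zpow_sub_one₀ hp]; field_simp
    have h2 := P.theta_p_mul _ hz1
    rw [← h1, h z hz] at h2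
    have h3 : P.theta ((P.p : ℂ) ^ (-(k : ℤ) - 1) * z) =
        -((P.p : ℂ) ^ (-(k : ℤ) - 1) * z) * (c * z ^ (- -(k : ℤ)) * P.theta z) := by
      rw [h2]; field_simp
    rw [h3, show -(-(k : ℤ) - 1) = - -(k : ℤ) + 1 by ring, zpow_add_one₀ hz]
    ring

/-! ### The function `E` -/

lemma qpow_add (s t : ℂ) : P.qpow (s + t) = P.qpow s * P.qpow t :=
  Complex.cpow_add _ _ P.q_ne_zero

lemma qpow_zero : P.qpow 0 = 1 := Complex.cpow_zero _

lemma qpow_neg (s : ℂ) : P.qpow (-s) = (P.qpow s)⁻¹ := Complex.cpow_neg _ _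

lemma qpow_eq_exp (s : ℂ) : P.qpow s = Complex.exp (Complex.log P.q * s) :=
  Complex.cpow_def_of_ne_zero P.q_ne_zero s

lemma qpow_natCast (k : ℕ) : P.qpow k = (P.q : ℂ) ^ k := Complex.cpow_natCast _ _

lemma qpow_intCast (k : ℤ) : P.qpow k = (P.q : ℂ) ^ k := Complex.cpow_intCast _ _

lemma qpow_mul_intCast (s : ℂ) (k : ℤ) : P.qpow (s * k) = P.qpow s ^ k := by
  rw [qpow_eq_exp, qpow_eq_exp, ← Complex.exp_int_mul]; congr 1; ring

lemma theta_qpow (s : ℂ) : P.theta (P.qpow (-2 * s)) = P.qpow (-s) * P.E s := by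
  rw [E, ← mul_assoc, ← qpow_add, neg_add_cancel, qpow_zero, one_mul]

lemma E_neg (s : ℂ) : P.E (-s) = -P.E s := by
  have h := P.theta_inv (P.qpow (-2 * s)) (P.qpow_ne_zero _)
  rw [← qpow_neg] at h
  rw [E, E, show -2 * -s = -(-2 * s) by ring, h, show -(-2 * s) = s + s by ring, qpow_neg,
    qpow_add]
  have := P.qpow_ne_zero s
  field_simp

/-- Every zero of `E` is a quasi-period of `E`. -/
lemma E_quasi_of_zero {s : ℂ} (h : P.E s = 0) :
    ∃ u κ : ℂ, u ≠ 0 ∧ ∀ t, P.E (t + s) = u * Complex.exp (κ * t) * P.E t := by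
  have h0 : P.theta (P.qpow (-2 * s)) = 0 :=
    (mul_eq_zero.mp h).resolve_left (P.qpow_ne_zero s)
  have h1 : ∃ k : ℤ, P.qpow (-2 * s) = (P.p : ℂ) ^ k := by
    by_contra hc
    push Not at hc
    exact P.theta_ne_zero _ (P.qpow_ne_zero _) hc h0
  obtain ⟨k, hk⟩ := h1
  obtain ⟨c, hc, hθ⟩ := P.theta_zpow_mul k
  refine ⟨P.qpow s * c, Complex.log P.q * (2 * k), mul_ne_zero (P.qpow_ne_zero s) hc, fun t => ?_⟩
  have h2 : P.qpow (-2 * (t + s)) = (P.p : ℂ) ^ k * P.qpow (-2 * t) := by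
    rw [mul_add, qpow_add, hk, mul_comm]
  have h3 : P.qpow (-2 * t) ^ (-k) = Complex.exp (Complex.log P.q * (2 * k) * t) := by
    rw [← qpow_mul_intCast, qpow_eq_exp]
    congr 1; push_cast; ring
  rw [E, E, h2, hθ _ (P.qpow_ne_zero _), h3, qpow_add]
  ring

lemma qpow_hasDerivAt (s : ℂ) : HasDerivAt P.qpow (Complex.log P.q * P.qpow s) s := by
  have h : P.qpow = fun s => Complex.exp (Complex.log P.q * s) := funext P.qpow_eq_exp
  rw [h]
  have := ((hasDerivAt_id s).const_mul (Complex.log P.q)).cexp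
  simpa [mul_comm] using this

lemma log_q_ne_zero : Complex.log P.q ≠ 0 := by
  rw [← Complex.ofReal_log P.q_pos.le]
  exact_mod_cast (Real.log_neg P.q_pos P.q_lt_one).ne

lemma E_zero : P.E 0 = 0 := by
  rw [E, mul_zero, qpow_zero, theta_eq]; simp

lemma E_differentiable : Differentiable ℂ P.E := fun s => by
  have h1 : DifferentiableAt ℂ P.qpow s := (P.qpow_hasDerivAt s).differentiableAt
  have h2 : DifferentiableAt ℂ (fun s => P.qpow (-2 * s)) s :=
    DifferentiableAt.comp (g := P.qpow) (f := fun s : ℂ => -2 * s) s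
      (P.qpow_hasDerivAt _).differentiableAt (by fun_prop)
  exact h1.mul (DifferentiableAt.comp (g := P.theta) (f := fun s => P.qpow (-2 * s)) s
    (P.theta_differentiableAt _ (P.qpow_ne_zero _)) h2)

lemma E_deriv_zero : deriv P.E 0 ≠ 0 := by
  obtain ⟨c, hc, hθ⟩ := P.theta_hasDerivAt_one
  have h1 : HasDerivAt (fun s => P.qpow (-2 * s)) (Complex.log P.q * (-2)) 0 := by
    have := (P.qpow_hasDerivAt (-2 * 0)).comp (0 : ℂ) ((hasDerivAt_id (0 : ℂ)).const_mul (-2))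
    simpa [Function.comp_def, qpow_zero] using this
  have h2 : HasDerivAt (fun s => P.theta (P.qpow (-2 * s))) (c * (Complex.log P.q * (-2))) 0 :=
    HasDerivAt.comp (0 : ℂ) (h₂ := P.theta) (h := fun s => P.qpow (-2 * s))
      (by simpa [qpow_zero] using hθ) h1
  have h3 := (P.qpow_hasDerivAt 0).mul h2
  have h4 : HasDerivAt P.E (c * (Complex.log P.q * (-2))) 0 := by
    have h5 : P.theta 1 = 0 := by rw [theta_eq]; simp
    rw [mul_zero, qpow_zero, h5, mul_zero, zero_add, one_mul] at h3
    exact h3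
  rw [h4.deriv]
  exact mul_ne_zero hc (mul_ne_zero P.log_q_ne_zero (by norm_num))

/-- All zeros of `E` are simple. -/
lemma E_deriv_ne_zero {s : ℂ} (h : P.E s = 0) : deriv P.E s ≠ 0 := by
  obtain ⟨u, κ, hu, hE⟩ := P.E_quasi_of_zero h
  have h1 : HasDerivAt (fun t => P.E (t + s)) (deriv P.E s) 0 := by
    have := (P.E_differentiable (0 + s)).hasDerivAt.comp_add_const 0 s
    rwa [zero_add] at this
  have h2 : HasDerivAt (fun t => u * Complex.exp (κ * t) * P.E t) (u * deriv P.E 0) 0 := by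
    have h3 : HasDerivAt (fun t => u * Complex.exp (κ * t))
        (u * (Complex.exp (κ * 0) * (κ * 1))) 0 :=
      (((hasDerivAt_id (0 : ℂ)).const_mul κ).cexp).const_mul u
    have := h3.mul (P.E_differentiable 0).hasDerivAt
    rw [E_zero, mul_zero, mul_zero, Complex.exp_zero, mul_one, zero_add] at this
    exact this
  rw [funext hE] at h1
  rw [h1.unique h2]
  exact mul_ne_zero hu P.E_deriv_zero

lemma dense_setOf_E_ne_zero : Dense {s : ℂ | P.E s ≠ 0} := by
  have hA : AnalyticOnNhd ℂ P.E Set.univ := fun s _ =>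
    P.E_differentiable.analyticAt s
  intro s
  rw [mem_closure_iff_frequently]
  rcases (hA s (Set.mem_univ s)).eventually_eq_zero_or_eventually_ne_zero with h | h
  · exfalso
    have h0 : P.E = 0 := by
      funext t
      exact hA.eqOn_zero_of_preconnected_of_eventuallyEq_zero isPreconnected_univ
        (Set.mem_univ s) h (Set.mem_univ t)
    exact P.E_deriv_zero (by rw [h0]; simp)
  · exact h.frequently.filter_mono nhdsWithin_le_nhds

end EllParams

/-! ### A partial fraction identity for `E` -/

/-- An entire function is divisible by another one with only simple zeros if it vanishes at these
zeros. -/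
lemma exists_entire_quotient {H D : ℂ → ℂ} (hH : Differentiable ℂ H) (hD : Differentiable ℂ D)
    (h : ∀ s, D s = 0 → H s = 0 ∧ deriv D s ≠ 0) :
    ∃ g : ℂ → ℂ, Differentiable ℂ g ∧ ∀ s, H s = g s * D s := by
  classical
  refine ⟨fun s => if D s = 0 then deriv H s / deriv D s else H s / D s, fun s₀ => ?_,
    fun s => ?_⟩
  · by_cases h0 : D s₀ = 0
    · obtain ⟨hH0, hD0⟩ := h s₀ h0
      have key : ∀ {f : ℂ → ℂ}, Differentiable ℂ f → Differentiable ℂ (dslope f s₀) := fun hf =>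
        differentiableOn_univ.mp
          ((Complex.differentiableOn_dslope univ_mem).mpr hf.differentiableOn)
      have hne : dslope D s₀ s₀ ≠ 0 := by rwa [dslope_same]
      refine (((key hH) s₀).div ((key hD) s₀) hne).congr_of_eventuallyEq ?_
      filter_upwards [((key hD) s₀).continuousAt.eventually_ne hne] with s hs
      by_cases hss : s = s₀
      · simp [hss, h0]
      · have h1 : s - s₀ ≠ 0 := sub_ne_zero.mpr hss
        have h2 : D s = (s - s₀) * dslope D s₀ s := by
          simpa [h0] using (sub_smul_dslope D s₀ s).symm
        have h3 : H s = (s - s₀) * dslope H s₀ s := by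
          simpa [hH0] using (sub_smul_dslope H s₀ s).symm
        have h4 : D s ≠ 0 := by rw [h2]; exact mul_ne_zero h1 hs
        rw [if_neg h4, Pi.div_apply, h3, h2, mul_div_mul_left _ _ h1]
    · refine ((hH s₀).div (hD s₀) h0).congr_of_eventuallyEq ?_
      filter_upwards [(hD s₀).continuousAt.eventually_ne h0] with s hs
      rw [if_neg hs, Pi.div_apply]
  · by_cases h0 : D s = 0
    · simp [h0, (h s h0).1]
    · simp [h0]

/-- A continuous function whose norm has a real and an imaginary period is bounded. -/
lemma isBounded_range_of_periodic {h : ℂ → ℂ} (hc : Continuous h) {τ b : ℝ} (hτ : 0 < τ)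
    (hb : 0 < b) (h1 : Function.Periodic (fun s => ‖h s‖) (τ : ℂ))
    (h2 : Function.Periodic (fun s => ‖h s‖) (b * Complex.I)) :
    Bornology.IsBounded (Set.range h) := by
  obtain ⟨C, hC⟩ := ((isCompact_closedBall (0 : ℂ) (τ + b)).image hc).isBounded.exists_norm_le
  refine isBounded_iff_forall_norm_le.mpr ⟨C, ?_⟩
  rintro _ ⟨s, rfl⟩
  set m := ⌊s.re / τ⌋
  set k := ⌊s.im / b⌋
  set s' : ℂ := s - m * (τ : ℂ) - k * (b * Complex.I) with hs'
  have e1 : ‖h s'‖ = ‖h s‖ := by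
    have e2 := (h2.int_mul k).sub_eq (s - m * (τ : ℂ))
    have e3 := (h1.int_mul m).sub_eq s
    rw [hs', e2, e3]
  rw [← e1]
  refine hC _ ⟨s', ?_, rfl⟩
  have hre : s'.re = s.re - m * τ := by simp [hs']
  have him : s'.im = s.im - k * b := by simp [hs']
  have a1 : (m : ℝ) * τ ≤ s.re := (le_div_iff₀ hτ).mp (Int.floor_le _)
  have a2 : s.re < (m + 1) * τ := (div_lt_iff₀ hτ).mp (Int.lt_floor_add_one _)
  have a3 : (k : ℝ) * b ≤ s.im := (le_div_iff₀ hb).mp (Int.floor_le _)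
  have a4 : s.im < (k + 1) * b := (div_lt_iff₀ hb).mp (Int.lt_floor_add_one _)
  rw [mem_closedBall_zero_iff]
  refine (Complex.norm_le_abs_re_add_abs_im s').trans ?_
  rw [hre, him, abs_of_nonneg (by linarith), abs_of_nonneg (by linarith)]
  linarith

namespace EllParams

variable (P : EllParams)

/-- The real quasi-period of `E`, with `q^(2τ) = p`. -/
noncomputable def realPeriod : ℝ := Real.log P.p / (2 * Real.log P.q)

/-- The imaginary quasi-period of `E`, with `q^(b i) = -1`. -/
noncomputable def imagPeriod : ℝ := -Real.pi / Real.log P.q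

lemma log_q_neg : Real.log P.q < 0 := Real.log_neg P.q_pos P.q_lt_one

lemma log_p_neg : Real.log P.p < 0 := Real.log_neg P.p_pos P.p_lt_one

lemma realPeriod_pos : 0 < P.realPeriod :=
  div_pos_of_neg_of_neg P.log_p_neg (by linarith [P.log_q_neg])

lemma imagPeriod_pos : 0 < P.imagPeriod :=
  div_pos_of_neg_of_neg (by linarith [Real.pi_pos]) P.log_q_neg

lemma qpow_two_realPeriod : P.qpow (2 * P.realPeriod) = P.p := by
  have h : Real.log P.q ≠ 0 := P.log_q_neg.ne
  rw [qpow_eq_exp, ← Complex.ofReal_log P.q_pos.le]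
  have h2 : (Real.log P.q : ℂ) * (2 * (P.realPeriod : ℂ)) = ((Real.log P.p : ℝ) : ℂ) := by
    rw [realPeriod]; push_cast
    have h' : (Real.log P.q : ℂ) ≠ 0 := by exact_mod_cast h
    field_simp
  rw [h2, ← Complex.ofReal_exp, Real.exp_log P.p_pos]

lemma qpow_imagPeriod : P.qpow (P.imagPeriod * Complex.I) = -1 := by
  have h' : (Real.log P.q : ℂ) ≠ 0 := by exact_mod_cast P.log_q_neg.ne
  rw [qpow_eq_exp, ← Complex.ofReal_log P.q_pos.le, imagPeriod]
  have : (Real.log P.q : ℂ) * (((-Real.pi / Real.log P.q : ℝ) : ℂ) * Complex.I) =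
      -(Real.pi * Complex.I) := by
    push_cast; field_simp
  rw [this, Complex.exp_neg, Complex.exp_pi_mul_I]
  norm_num

lemma E_sub_realPeriod (s : ℂ) :
    P.E (s - P.realPeriod) = -P.qpow (-P.realPeriod) * P.qpow (2 * s) * P.E s := by
  have h1 : P.qpow (-2 * (s - P.realPeriod)) = P.p * P.qpow (-2 * s) := by
    rw [show -2 * (s - (P.realPeriod : ℂ)) = 2 * P.realPeriod + -2 * s by ring, qpow_add,
      qpow_two_realPeriod]
  rw [E, E, h1, P.theta_p_mul _ (P.qpow_ne_zero _), ← qpow_neg, sub_eq_add_neg, qpow_add,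
    show -(-2 * s) = 2 * s by ring]
  ring

lemma E_add_imagPeriod (s : ℂ) : P.E (s + P.imagPeriod * Complex.I) = -P.E s := by
  have h1 : P.qpow (-2 * (s + P.imagPeriod * Complex.I)) = P.qpow (-2 * s) := by
    rw [mul_add, qpow_add, show (-2 : ℂ) * (P.imagPeriod * Complex.I) =
      (P.imagPeriod * Complex.I) * ((-2 : ℤ) : ℂ) by push_cast; ring, qpow_mul_intCast,
      qpow_imagPeriod]
    norm_num
  rw [E, E, h1, qpow_add, qpow_imagPeriod]
  ring

/-- There are no nonzero entire functions with one period and with multiplier `q^(2N)`, `N ≥ 1`,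
along the other quasi-period: a suitable exponential factor makes them bounded, hence constant, and
then `p^m = q^(2N)` for some integer `m`. -/
lemma eq_zero_of_quasiPeriodic {g : ℂ → ℂ} (hg : Differentiable ℂ g) {N : ℕ} (hN : N ≠ 0)
    (h1 : ∀ s, g (s - P.realPeriod) = P.qpow (2 * N) * g s)
    (h2 : ∀ s, g (s + P.imagPeriod * Complex.I) = g s) : ∀ s, g s = 0 := by
  set κ : ℝ := 2 * N * Real.log P.q / P.realPeriod with hκ
  set h : ℂ → ℂ := fun s => g s * Complex.exp (κ * s) with hh
  have hτ := P.realPeriod_pos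
  have hd : Differentiable ℂ h := by simp only [hh]; fun_prop
  have p1 : ∀ s, h (s - P.realPeriod) = h s := by
    intro s
    simp only [hh]
    have : (κ : ℂ) * (s - P.realPeriod) = κ * s - Complex.log P.q * (2 * N) := by
      have h' : (P.realPeriod : ℂ) ≠ 0 := by exact_mod_cast hτ.ne'
      rw [hκ, ← Complex.ofReal_log P.q_pos.le]; push_cast; field_simp
    rw [h1, this, Complex.exp_sub, qpow_eq_exp]
    field_simp
  have p2 : ∀ s, h (s + P.imagPeriod * Complex.I) =
      Complex.exp ((κ * P.imagPeriod : ℝ) * Complex.I) * h s := by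
    intro s
    simp only [hh]
    rw [h2, mul_add, Complex.exp_add]
    push_cast
    ring_nf
  have hbd : Bornology.IsBounded (Set.range h) := by
    refine isBounded_range_of_periodic hd.continuous hτ P.imagPeriod_pos (fun s => ?_)
      (fun s => ?_)
    · have := p1 (s + P.realPeriod)
      rw [add_sub_cancel_right] at this
      simp only [this]
    · simp only [p2, norm_mul, Complex.norm_exp_ofReal_mul_I, one_mul]
  have hconst : ∀ s, h s = h 0 := fun s => hd.apply_eq_apply_of_bounded hbd s 0
  by_contra hne
  push Not at hne
  obtain ⟨s, hs⟩ := hne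
  have h0 : h 0 ≠ 0 := by
    rw [← hconst s]
    exact mul_ne_zero hs (Complex.exp_ne_zero _)
  have e1 : Complex.exp ((κ * P.imagPeriod : ℝ) * Complex.I) = 1 := by
    have := p2 0
    rw [hconst] at this
    exact (mul_eq_right₀ h0).mp this.symm
  obtain ⟨m, hm⟩ := Complex.exp_eq_one_iff.mp e1
  have e2 : κ * P.imagPeriod = m * (2 * Real.pi) := by
    have : ((κ * P.imagPeriod : ℝ) : ℂ) * Complex.I = (m * (2 * Real.pi) : ℝ) * Complex.I := by
      rw [hm]; push_cast; ring
    exact_mod_cast mul_right_cancel₀ Complex.I_ne_zero this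
  have hlq := P.log_q_neg.ne
  have hlp := P.log_p_neg.ne
  have e3 : (m : ℝ) * Real.log P.p + (2 * N : ℤ) * Real.log P.q = 0 := by
    rw [hκ, realPeriod, imagPeriod] at e2
    have hpi := Real.pi_ne_zero
    field_simp at e2
    push_cast
    linarith
  have e4 : P.p ^ m * P.q ^ (2 * N : ℤ) = 1 := by
    have hp := P.p_pos
    have hq := P.q_pos
    apply Real.log_injOn_pos (Set.mem_Ioi.mpr (by positivity)) (Set.mem_Ioi.mpr one_pos)
    rw [Real.log_mul (by positivity) (by positivity), Real.log_zpow, Real.log_zpow, Real.log_one]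
    exact e3
  have := (P.generic _ _ e4).2
  omega

lemma E_natCast_ne_zero {N : ℕ} (hN : N ≠ 0) : P.E N ≠ 0 := by
  refine mul_ne_zero (P.qpow_ne_zero _) (P.theta_ne_zero _ (P.qpow_ne_zero _) fun k hk => ?_)
  have h1 : P.qpow (-2 * N) = (P.q : ℂ) ^ (-2 * (N : ℤ)) := by
    rw [← qpow_intCast]; push_cast; rfl
  rw [h1] at hk
  have h2 : P.p ^ k * P.q ^ (2 * (N : ℤ)) = 1 := by
    have h3 : P.q ^ (-2 * (N : ℤ)) = P.p ^ k := by exact_mod_cast hk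
    rw [← h3, ← zpow_add₀ P.q_pos.ne']
    simp
  have := (P.generic _ _ h2).2
  omega

/-- The identity
`E(1) ∑_a E(y_a + N) / E(y_a) ∏_{k ≠ a} E(y_k - y_a + 1) / E(y_k - y_a)
  = E(N) ∏_k E(y_k + 1) / E(y_k)`
for `N` variables. After the substitution `y_k ↦ y_k + s`, the difference of both sides has
removable singularities, and it is quasi-periodic with a multiplier that forces it to vanish. -/
theorem E_partial_fractions {ι : Type*} [DecidableEq ι] (K : Finset ι) (hK : K.Nonempty)
    (y : ι → ℂ) (h1 : ∀ a ∈ K, P.E (y a) ≠ 0)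
    (h2 : ∀ a ∈ K, ∀ k ∈ K, k ≠ a → P.E (y k - y a) ≠ 0) :
    P.E 1 * ∑ a ∈ K, P.E (y a + K.card) / P.E (y a) *
        ∏ k ∈ K.erase a, P.E (y k - y a + 1) / P.E (y k - y a) =
      P.E K.card * ∏ k ∈ K, P.E (y k + 1) / P.E (y k) := by
  set N := K.card with hN
  have hN0 : N ≠ 0 := by rw [hN]; exact hK.card_pos.ne'
  set A : ι → ℂ := fun a => ∏ k ∈ K.erase a, P.E (y k - y a + 1) / P.E (y k - y a) with hA
  set D : ℂ → ℂ := fun s => ∏ k ∈ K, P.E (y k + s) with hD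
  set H : ℂ → ℂ := fun s => P.E 1 * ∑ a ∈ K, P.E (y a + s + N) * A a *
      ∏ k ∈ K.erase a, P.E (y k + s) - P.E N * ∏ k ∈ K, P.E (y k + s + 1) with hH
  have dE : ∀ c : ℂ, Differentiable ℂ fun s => P.E (c + s) := fun c =>
    P.E_differentiable.comp ((differentiable_const c).add differentiable_id)
  have dE' : ∀ c d : ℂ, Differentiable ℂ fun s => P.E (c + s + d) := fun c d =>
    P.E_differentiable.comp (((differentiable_const c).add differentiable_id).add
      (differentiable_const d))
  have dD : Differentiable ℂ D := by
    simp only [hD]; exact Differentiable.fun_finsetProd fun k _ => dE _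
  have dH : Differentiable ℂ H := by
    simp only [hH]
    refine ((Differentiable.fun_sum fun a _ => ?_).const_mul _).sub
      ((Differentiable.fun_finsetProd fun k _ => dE' _ _).const_mul _)
    exact ((dE' _ _).mul (differentiable_const _)).mul
      (Differentiable.fun_finsetProd fun k _ => dE _)
  -- All zeros of `D` are simple, and `H` vanishes there.
  have hz : ∀ s, D s = 0 → H s = 0 ∧ deriv D s ≠ 0 := by
    intro s hs
    obtain ⟨a, ha, has⟩ := Finset.prod_eq_zero_iff.mp hs
    obtain ⟨u, κ, hu, hE⟩ := P.E_quasi_of_zero has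
    have hk : ∀ k, P.E (y k + s) = u * Complex.exp (κ * (y k - y a)) * P.E (y k - y a) := by
      intro k
      rw [← hE]; congr 1; ring
    have hk1 : ∀ k, P.E (y k + s + 1) =
        u * Complex.exp (κ * (y k - y a + 1)) * P.E (y k - y a + 1) := by
      intro k
      rw [← hE]; congr 1; ring
    have hne : ∀ k ∈ K.erase a, P.E (y k + s) ≠ 0 := by
      intro k hkK
      rw [hk]
      exact mul_ne_zero (mul_ne_zero hu (Complex.exp_ne_zero _))
        (h2 a ha k (Finset.mem_of_mem_erase hkK) (Finset.ne_of_mem_erase hkK))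
    constructor
    · have e1 : ∑ b ∈ K, P.E (y b + s + N) * A b * ∏ k ∈ K.erase b, P.E (y k + s) =
          P.E (y a + s + N) * A a * ∏ k ∈ K.erase a, P.E (y k + s) := by
        refine Finset.sum_eq_single_of_mem a ha fun b _ hba => ?_
        rw [Finset.prod_eq_zero (Finset.mem_erase.mpr ⟨hba.symm, ha⟩) has, mul_zero]
      have e2 : A a * ∏ k ∈ K.erase a, P.E (y k + s) =
          (∏ k ∈ K.erase a, Complex.exp (-κ)) * ∏ k ∈ K.erase a, P.E (y k + s + 1) := by
        rw [hA, ← Finset.prod_mul_distrib, ← Finset.prod_mul_distrib]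
        refine Finset.prod_congr rfl fun k hkK => ?_
        have h3 := h2 a ha k (Finset.mem_of_mem_erase hkK) (Finset.ne_of_mem_erase hkK)
        rw [hk, hk1, mul_add, Complex.exp_add, mul_one, Complex.exp_neg]
        field_simp
      have e3 : P.E (y a + s + N) = u * Complex.exp (κ * N) * P.E N := by
        rw [← hE]; congr 1; ring
      have e4 : P.E (y a + s + 1) = u * Complex.exp κ * P.E 1 := by
        rw [hk1]; simp
      have e5 : Complex.exp (κ * N) * ∏ k ∈ K.erase a, Complex.exp (-κ) = Complex.exp κ := by
        rw [Finset.prod_const, Finset.card_erase_of_mem ha, ← hN, ← Complex.exp_nat_mul,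
          ← Complex.exp_add, Nat.cast_sub (Nat.one_le_iff_ne_zero.mpr hN0)]
        congr 1; push_cast; ring
      simp only [hH]
      rw [e1, mul_assoc (P.E (y a + s + N)), e2, ← Finset.mul_prod_erase K _ ha, e3, e4, ← e5]
      ring
    · have hd : HasDerivAt D (∑ k ∈ K, (∏ j ∈ K.erase k, P.E (y j + s)) •
          deriv (fun t => P.E (y k + t)) s) s := by
        have := HasDerivAt.fun_finsetProd (u := K) (f := fun k t => P.E (y k + t)) (x := s)
          fun k _ => (dE (y k) s).hasDerivAt
        simpa [hD] using this
      rw [hd.deriv, Finset.sum_eq_single_of_mem a ha fun b _ hba => by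
        rw [Finset.prod_eq_zero (Finset.mem_erase.mpr ⟨hba.symm, ha⟩) has, zero_smul]]
      refine smul_ne_zero (Finset.prod_ne_zero_iff.mpr hne) ?_
      rw [deriv_comp_const_add]
      exact P.E_deriv_ne_zero has
  obtain ⟨g, hg, hHg⟩ := exists_entire_quotient dH dD hz
  have key : ∀ {f₁ f₂ : ℂ → ℂ}, Continuous f₁ → Continuous f₂ → (∀ s, D s ≠ 0 → f₁ s = f₂ s) →
      ∀ s, f₁ s = f₂ s := by
    intro f₁ f₂ c₁ c₂ h s
    have hdense : Dense {s | D s ≠ 0} := by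
      have hA : AnalyticOnNhd ℂ D Set.univ := fun s _ => dD.analyticAt s
      intro s
      rw [mem_closure_iff_frequently]
      rcases (hA s (Set.mem_univ s)).eventually_eq_zero_or_eventually_ne_zero with h | h
      · exfalso
        refine (hz s h.self_of_nhds).2 ?_
        rw [EventuallyEq.deriv_eq (f := fun _ => (0 : ℂ)) h, deriv_const]
      · exact h.frequently.filter_mono nhdsWithin_le_nhds
    exact congrFun (Continuous.ext_on hdense c₁ c₂ fun s hs => h s hs) s
  have hg0 : ∀ s, g s = 0 := by
    refine P.eq_zero_of_quasiPeriodic hg hN0 ?_ ?_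
    · refine key (hg.continuous.comp (continuous_id.sub continuous_const))
        (continuous_const.mul hg.continuous) fun s hs => ?_
      set μ : ι → ℂ := fun k => -P.qpow (-P.realPeriod) * P.qpow (2 * (y k + s)) with hμ
      have m0 : ∀ k, P.E (y k + (s - P.realPeriod)) = μ k * P.E (y k + s) := fun k => by
        rw [← add_sub_assoc, E_sub_realPeriod]
      have m1 : ∀ (k : ι) (c : ℂ), P.E (y k + (s - P.realPeriod) + c) =
          P.qpow (2 * c) * (μ k * P.E (y k + s + c)) := fun k c => by
        rw [show y k + (s - P.realPeriod) + c = y k + s + c - P.realPeriod by ring,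
          E_sub_realPeriod, mul_add 2 (y k + s), qpow_add]
        ring
      have hD1 : D (s - P.realPeriod) = (∏ k ∈ K, μ k) * D s := by
        simp only [hD, m0, Finset.prod_mul_distrib]
      have hH1 : H (s - P.realPeriod) = P.qpow (2 * N) * (∏ k ∈ K, μ k) * H s := by
        simp only [hH, m1, m0, Finset.prod_mul_distrib, mul_sub, Finset.prod_const, ← hN]
        congr 1
        · rw [Finset.mul_sum, Finset.mul_sum, Finset.mul_sum]
          refine Finset.sum_congr rfl fun a ha => ?_
          rw [← Finset.mul_prod_erase K μ ha]
          ring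
        · have : P.qpow (2 * 1) ^ N = P.qpow (2 * N) := by
            rw [show (2 * N : ℂ) = 2 * 1 * ((N : ℤ) : ℂ) by push_cast; ring, qpow_mul_intCast,
              zpow_natCast]
          rw [this]
          ring
      have hμ0 : ∏ k ∈ K, μ k ≠ 0 := Finset.prod_ne_zero_iff.mpr fun k _ =>
        mul_ne_zero (neg_ne_zero.mpr (P.qpow_ne_zero _)) (P.qpow_ne_zero _)
      have := hHg (s - P.realPeriod)
      rw [hH1, hD1, hHg s] at this
      refine mul_right_cancel₀ (mul_ne_zero hμ0 hs) ?_
      linear_combination -this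
    · refine key (hg.continuous.comp (continuous_id.add continuous_const)) hg.continuous
        fun s hs => ?_
      have m0 : ∀ k, P.E (y k + (s + P.imagPeriod * Complex.I)) = -1 * P.E (y k + s) := fun k => by
        rw [← add_assoc, E_add_imagPeriod, neg_one_mul]
      have m1 : ∀ (k : ι) (c : ℂ), P.E (y k + (s + P.imagPeriod * Complex.I) + c) =
          -1 * P.E (y k + s + c) := fun k c => by
        rw [show y k + (s + P.imagPeriod * Complex.I) + c =
          y k + s + c + P.imagPeriod * Complex.I by ring, E_add_imagPeriod, neg_one_mul]
      have hD1 : D (s + P.imagPeriod * Complex.I) = (∏ k ∈ K, (-1 : ℂ)) * D s := by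
        simp only [hD, m0, Finset.prod_mul_distrib]
      have hH1 : H (s + P.imagPeriod * Complex.I) = (∏ k ∈ K, (-1 : ℂ)) * H s := by
        simp only [hH, m1, m0, Finset.prod_mul_distrib, mul_sub]
        congr 1
        · rw [Finset.mul_sum, Finset.mul_sum, Finset.mul_sum]
          refine Finset.sum_congr rfl fun a ha => ?_
          rw [← Finset.mul_prod_erase K (fun _ => (-1 : ℂ)) ha]
          ring
        · ring
      have hμ0 : ∏ k ∈ K, (-1 : ℂ) ≠ 0 := Finset.prod_ne_zero_iff.mpr fun k _ => by norm_num
      have := hHg (s + P.imagPeriod * Complex.I)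
      rw [hH1, hD1, hHg s] at this
      refine mul_right_cancel₀ (mul_ne_zero hμ0 hs) ?_
      linear_combination -this
  have hH0 := hHg 0
  rw [hg0, zero_mul] at hH0
  simp only [hH, add_zero] at hH0
  have hD0 : ∏ k ∈ K, P.E (y k) ≠ 0 := Finset.prod_ne_zero_iff.mpr h1
  refine mul_right_cancel₀ hD0 ?_
  have e1 : (∏ k ∈ K, P.E (y k + 1) / P.E (y k)) * ∏ k ∈ K, P.E (y k) = ∏ k ∈ K, P.E (y k + 1) := by
    rw [← Finset.prod_mul_distrib]
    exact Finset.prod_congr rfl fun k hk => div_mul_cancel₀ _ (h1 k hk)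
  rw [mul_assoc (P.E N), e1, ← sub_eq_zero.mp hH0, mul_assoc, Finset.sum_mul]
  congr 1
  refine Finset.sum_congr rfl fun a ha => ?_
  rw [← Finset.mul_prod_erase K _ ha]
  have := h1 a ha
  simp only [hA]
  field_simp

end EllParams

/-! ### Meromorphic functions of the differences `ζ_ij` -/

lemma meroFun_mk_eq {W : Type*} [NormedAddCommGroup W] [NormedSpace ℂ W] {f g : meroFun W}
    {U : Set W} (hU : IsOpen U) (hd : Dense U) (h : ∀ x ∈ U, f.1 x = g.1 x) :
    Ideal.Quotient.mk (meroNull W) f = Ideal.Quotient.mk (meroNull W) g := by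
  rw [Ideal.Quotient.eq]
  change Dense (interior {x | (f - g).1 x = 0})
  refine hd.mono (interior_maximal (fun x hx => ?_) hU)
  simp [h x hx]

lemma exists_apply_cartanDiff {n : ℕ} {i j : Fin n} (h : i ≠ j) :
    ∃ ζ : CartanDual n, ζ (cartanDiff i j) ≠ 0 := by
  refine ⟨wt i, ?_⟩
  simp [wt, cartanDiff, h]

lemma isOpenMap_apply_cartanDiff {n : ℕ} {i j : Fin n} (h : i ≠ j) :
    IsOpenMap fun ζ : CartanDual n => ζ (cartanDiff i j) := by
  obtain ⟨ζ, hζ⟩ := exists_apply_cartanDiff h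
  have hs : Function.Surjective (ContinuousLinearMap.apply ℂ ℂ (cartanDiff i j) :
      CartanDual n →L[ℂ] ℂ) := fun c =>
    ⟨(c / ζ (cartanDiff i j)) • ζ, by simp [hζ]⟩
  exact LinearMap.isOpenMap_of_finiteDimensional
    (ContinuousLinearMap.apply ℂ ℂ (cartanDiff i j) : CartanDual n →L[ℂ] ℂ).toLinearMap hs

lemma cartanDiff_apply_add {n : ℕ} (ζ : CartanDual n) (i j k : Fin n) :
    ζ (cartanDiff i k) = ζ (cartanDiff i j) + ζ (cartanDiff j k) := by
  rw [← map_add]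
  congr 1
  exact Subtype.ext (by simp [cartanDiff])

lemma cartanDiff_apply_swap {n : ℕ} (ζ : CartanDual n) (i j : Fin n) :
    ζ (cartanDiff j i) = -ζ (cartanDiff i j) := by
  rw [← map_neg]
  congr 1
  exact Subtype.ext (by simp [cartanDiff])

lemma wt_apply_cartanDiff {n : ℕ} {i j k : Fin n} (hi : k ≠ i) (hj : k ≠ j) :
    (wt k : CartanDual n) (cartanDiff i j) = 0 := by
  simp [wt, cartanDiff, hi, hj]

namespace EllParams

variable (P : EllParams) {n : ℕ}

/-- `E(ζ_ij + c)` as a function. -/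
noncomputable def EFun (i j : Fin n) (c : ℂ) : meroFun (CartanDual n) :=
  ⟨fun ζ => P.E (ζ (cartanDiff i j) + c),
    IsMeroFun.of_analytic fun ζ => P.E_analyticAt ((root_analyticAt i j ζ).add analyticAt_const)⟩

/-- `E(ζ_ij + c)⁻¹` as a function. -/
noncomputable def EInvFun (i j : Fin n) (c : ℂ) : meroFun (CartanDual n) :=
  ⟨fun ζ => 1 / P.E (ζ (cartanDiff i j) + c),
    IsMeroFun.div_analytic (fun _ => analyticAt_const)
      fun ζ => P.E_analyticAt ((root_analyticAt i j ζ).add analyticAt_const)⟩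

/-- `E(ζ_ij + c)` as a meromorphic function. -/
noncomputable def EM (i j : Fin n) (c : ℂ) : MF n := Ideal.Quotient.mk _ (P.EFun i j c)

/-- `E(ζ_ij + c)⁻¹` as a meromorphic function. -/
noncomputable def EMInv (i j : Fin n) (c : ℂ) : MF n := Ideal.Quotient.mk _ (P.EInvFun i j c)

lemma isOpen_E_ne_zero (i j : Fin n) (c : ℂ) :
    IsOpen {ζ : CartanDual n | P.E (ζ (cartanDiff i j) + c) ≠ 0} := by
  refine isOpen_ne_fun ?_ continuous_const
  exact P.E_differentiable.continuous.comp (continuous_iff_continuousAt.mpr fun ζ =>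
    ((root_analyticAt i j ζ).add analyticAt_const).continuousAt)

lemma dense_E_ne_zero {i j : Fin n} (h : i ≠ j) (c : ℂ) :
    Dense {ζ : CartanDual n | P.E (ζ (cartanDiff i j) + c) ≠ 0} := by
  have h1 : Dense {s : ℂ | P.E (s + c) ≠ 0} :=
    P.dense_setOf_E_ne_zero.preimage (Homeomorph.addRight c).isOpenMap
  exact h1.preimage (isOpenMap_apply_cartanDiff h)

/-- The set of those `ζ` for which no `E(ζ_ij)` with `i ≠ j` vanishes. -/
def regularSet (n : ℕ) : Set (CartanDual n) :=
  ⋂₀ Set.range fun x : {x : Fin n × Fin n // x.1 ≠ x.2} =>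
    {ζ : CartanDual n | P.E (ζ (cartanDiff x.1.1 x.1.2) + 0) ≠ 0}

lemma isOpen_regularSet : IsOpen (P.regularSet n) :=
  (Set.finite_range _).isOpen_sInter (Set.forall_mem_range.mpr fun _ => P.isOpen_E_ne_zero _ _ _)

lemma dense_regularSet : Dense (P.regularSet n) :=
  (Set.finite_range _).dense_sInter (Set.forall_mem_range.mpr fun _ => P.isOpen_E_ne_zero _ _ _)
    (Set.forall_mem_range.mpr fun x => P.dense_E_ne_zero x.2 _)

lemma E_ne_zero_of_mem_regularSet {ζ : CartanDual n} (hζ : ζ ∈ P.regularSet n) {i j : Fin n}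
    (h : i ≠ j) : P.E (ζ (cartanDiff i j)) ≠ 0 := by
  simpa using Set.mem_sInter.mp hζ _ ⟨⟨(i, j), h⟩, rfl⟩

lemma EM_mul_EMInv {i j : Fin n} (h : i ≠ j) (c : ℂ) : P.EM i j c * P.EMInv i j c = 1 := by
  rw [EM, EMInv, ← map_mul, ← map_one (Ideal.Quotient.mk _)]
  exact meroFun_mk_eq (P.isOpen_E_ne_zero i j c) (P.dense_E_ne_zero h c)
    fun ζ hζ => mul_one_div_cancel hζ

lemma EM_neg (i j : Fin n) (c : ℂ) : P.EM j i (-c) = -P.EM i j c := by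
  rw [EM, EM, ← map_neg]
  congr 1
  refine Subtype.ext (funext fun ζ => ?_)
  change P.E (ζ (cartanDiff j i) + -c) = -P.E (ζ (cartanDiff i j) + c)
  rw [cartanDiff_apply_swap, ← neg_add, E_neg]

lemma EMInv_neg (i j : Fin n) (c : ℂ) : P.EMInv j i (-c) = -P.EMInv i j c := by
  rw [EMInv, EMInv, ← map_neg]
  congr 1
  refine Subtype.ext (funext fun ζ => ?_)
  change 1 / P.E (ζ (cartanDiff j i) + -c) = -(1 / P.E (ζ (cartanDiff i j) + c))
  rw [cartanDiff_apply_swap, ← neg_add, E_neg, div_neg]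

lemma shift_EM {i j k : Fin n} (hi : k ≠ i) (hj : k ≠ j) (c : ℂ) :
    Mero.shift (wt k) (P.EM i j c) = P.EM i j c := by
  change Ideal.Quotient.mk _ (meroFunShift (wt k) (P.EFun i j c)) = _
  rw [EM]
  congr 1
  refine Subtype.ext (funext fun ζ => ?_)
  change P.E ((ζ + wt k) (cartanDiff i j) + c) = P.E (ζ (cartanDiff i j) + c)
  rw [add_apply, wt_apply_cartanDiff hi hj, add_zero]

lemma shift_EMInv {i j k : Fin n} (hi : k ≠ i) (hj : k ≠ j) (c : ℂ) :
    Mero.shift (wt k) (P.EMInv i j c) = P.EMInv i j c := by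
  change Ideal.Quotient.mk _ (meroFunShift (wt k) (P.EInvFun i j c)) = _
  rw [EMInv]
  congr 1
  refine Subtype.ext (funext fun ζ => ?_)
  change 1 / P.E ((ζ + wt k) (cartanDiff i j) + c) = 1 / P.E (ζ (cartanDiff i j) + c)
  rw [add_apply, wt_apply_cartanDiff hi hj, add_zero]

/-! ### The elliptic R-matrix at special values of the spectral parameter -/

lemma theta_qpow_two_mul (s : ℂ) : P.theta (P.qpow (2 * s)) = -(P.qpow s * P.E s) := by
  have := P.theta_qpow (-s)
  rw [neg_neg, E_neg, show -2 * -s = 2 * s by ring] at this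
  rw [this]; ring

lemma qpow_one : P.qpow 1 = P.q := Complex.cpow_one _

lemma alpha_eq (x w : ℂ) :
    P.alpha x w = P.theta w / P.theta ((P.q : ℂ) ^ 2 * w) * P.q * (P.E (x + 1) * (1 / P.E x)) := by
  rw [alpha, theta_qpow_two_mul, theta_qpow_two_mul, qpow_add, qpow_one]
  rw [mul_div_mul_comm, neg_div_neg_eq, mul_assoc (P.qpow x),
    mul_div_mul_left _ _ (P.qpow_ne_zero x)]
  ring

lemma beta_eq (x w : ℂ) :
    P.beta x w = P.theta ((P.q : ℂ) ^ 2) / P.theta ((P.q : ℂ) ^ 2 * w) * P.qpow x *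
      (P.theta (P.qpow (-2 * x) * w) * (1 / P.E x)) := by
  rw [beta, theta_qpow, qpow_neg, mul_div_mul_comm, mul_comm (P.qpow x)⁻¹, ← div_eq_mul_inv,
    div_div_eq_mul_div]
  ring

/-- The common scalar factor of `α(x, q^2)` and `β(x, q^2)`. -/
noncomputable def kappa : ℂ :=
  P.theta ((P.q : ℂ) ^ 2) / P.theta ((P.q : ℂ) ^ 2 * (P.q : ℂ) ^ 2) * P.q

lemma theta_q_pow_ne_zero {N : ℕ} (hN : N ≠ 0) : P.theta ((P.q : ℂ) ^ (2 * N)) ≠ 0 := by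
  have h1 : (P.q : ℂ) ^ (2 * N) = P.qpow (2 * N) := by
    rw [← qpow_natCast]; push_cast; rfl
  rw [h1, theta_qpow_two_mul]
  exact neg_ne_zero.mpr (mul_ne_zero (P.qpow_ne_zero _) (P.E_natCast_ne_zero hN))

lemma kappa_ne_zero : P.kappa ≠ 0 := by
  have h1 := P.theta_q_pow_ne_zero (N := 1) one_ne_zero
  have h2 := P.theta_q_pow_ne_zero (N := 2) two_ne_zero
  rw [mul_one] at h1
  rw [show 2 * 2 = 2 + 2 from rfl, pow_add] at h2
  exact mul_ne_zero (div_ne_zero h1 h2) P.q_ne_zero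

lemma algebraMap_MF (c : ℂ) :
    algebraMap ℂ (MF n) c = Ideal.Quotient.mk _ (algebraMap ℂ (meroFun (CartanDual n)) c) := rfl

lemma alphaM_qU_sq (i j : Fin n) :
    P.alphaM i j (P.qU ^ 2) = algebraMap ℂ _ P.kappa * (P.EM i j 1 * P.EMInv i j 0) := by
  rw [alphaM, Mero.mk, EM, EMInv, algebraMap_MF, ← map_mul, ← map_mul]
  congr 1
  refine Subtype.ext (funext fun ζ => ?_)
  change P.alpha _ ((P.q : ℂ) ^ 2) = P.kappa * (P.E _ * (1 / P.E (_ + 0)))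
  rw [alpha_eq, add_zero, kappa]

lemma betaM_qU_sq (i j : Fin n) :
    P.betaM i j (P.qU ^ 2) = algebraMap ℂ _ P.kappa * (P.EM i j (-1) * P.EMInv i j 0) := by
  rw [betaM, Mero.mk, EM, EMInv, algebraMap_MF, ← map_mul, ← map_mul]
  congr 1
  refine Subtype.ext (funext fun ζ => ?_)
  set x := ζ (cartanDiff i j)
  change P.beta x ((P.q : ℂ) ^ 2) = P.kappa * (P.E (x + -1) * (1 / P.E (x + 0)))
  have h : P.qpow (-2 * x) * (P.q : ℂ) ^ 2 = P.qpow (-2 * (x + -1)) := by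
    rw [← qpow_natCast, ← qpow_add]; congr 1; push_cast; ring
  rw [beta_eq, add_zero, kappa, h, theta_qpow, neg_add, neg_neg, qpow_add, qpow_one, qpow_neg]
  have := P.qpow_ne_zero x
  field_simp

/-- The function `E(N) E(ζ_ij + 1) / E(ζ_ij)`: up to a scalar factor, the limit of
`θ(q^2 w) α(ζ_ij, w)` at `w = q^(-2N)`. -/
noncomputable def alphaRes (N : ℕ) (i j : Fin n) : MF n :=
  algebraMap ℂ _ (P.E N) * (P.EM i j 1 * P.EMInv i j 0)

/-- The function `-E(1) E(ζ_ij + N) / E(ζ_ij)`: up to the same scalar factor as for `alphaRes`, the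
limit of `θ(q^2 w) β(ζ_ij, w)` at `w = q^(-2N)`. -/
noncomputable def betaRes (N : ℕ) (i j : Fin n) : MF n :=
  algebraMap ℂ _ (-P.E 1) * (P.EM i j N * P.EMInv i j 0)

/-- The factor `q^(N-1) θ(q^2 w)`, by which the R-matrix is multiplied to make it regular at
`w = q^(-2N)`. -/
noncomputable def resFactor (N : ℕ) (w : ℂ) : ℂ :=
  P.qpow (N - 1) * P.theta ((P.q : ℂ) ^ 2 * w)

lemma theta_q_sq_mul_analyticAt {w : ℂ} (hw : w ≠ 0) :
    AnalyticAt ℂ (fun v => P.theta ((P.q : ℂ) ^ 2 * v)) w :=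
  AnalyticAt.fun_comp (g := P.theta) (f := fun w => (P.q : ℂ) ^ 2 * w)
    (P.theta_analyticAt _ (mul_ne_zero (pow_ne_zero _ P.q_ne_zero) hw))
    (analyticAt_const.mul analyticAt_id)

lemma resFactor_meromorphicOn (N : ℕ) : MeromorphicOn (P.resFactor N) {0}ᶜ := fun _ hw =>
  (analyticAt_const.mul (P.theta_q_sq_mul_analyticAt hw)).meromorphicAt

lemma eventually_theta_q_sq_mul_ne_zero {u : ℂ} (hu : u ≠ 0) :
    ∀ᶠ w in 𝓝[≠] u, P.theta ((P.q : ℂ) ^ 2 * w) ≠ 0 := by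
  rcases (P.theta_q_sq_mul_analyticAt hu).eventually_eq_zero_or_eventually_ne_zero with h | h
  · exfalso
    have hq : (P.q : ℂ) ^ 2 ≠ 0 := pow_ne_zero _ P.q_ne_zero
    have hc : (Set.range fun k : ℤ => (P.p : ℂ) ^ k / (P.q : ℂ) ^ 2).Countable :=
      Set.countable_range _
    have hd := hc.dense_compl ℝ
    obtain ⟨w, hw, hw'⟩ := (mem_closure_iff_frequently.mp (hd u)).and_eventually
      (h.and (isOpen_compl_singleton.mem_nhds hu)) |>.exists
    refine P.theta_ne_zero _ (mul_ne_zero hq hw'.2) (fun k hk => hw ⟨k, ?_⟩) hw'.1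
    change (P.p : ℂ) ^ k / (P.q : ℂ) ^ 2 = w
    rw [← hk, mul_div_cancel_left₀ _ hq]
  · exact h

lemma tendsto_resFactor_alpha (N : ℕ) (x : ℂ) :
    Tendsto (fun w => P.resFactor N w * P.alpha x w) (𝓝[≠] (P.qpow (-2 * N)))
      (𝓝 (P.E N * (P.E (x + 1) * (1 / P.E x)))) := by
  have hu := P.qpow_ne_zero (-2 * N)
  have h1 := (P.tendsto_theta_mul 1 _ one_ne_zero hu).const_mul (P.qpow (N - 1) * P.q)
  have h2 := h1.mul_const (P.E (x + 1) * (1 / P.E x))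
  have h3 : P.qpow (N - 1) * P.q * P.theta (1 * P.qpow (-2 * N)) = P.E N := by
    rw [one_mul, theta_qpow, ← qpow_one, ← mul_assoc, ← qpow_add, ← qpow_add]
    rw [show (N : ℂ) - 1 + 1 + -N = 0 by ring, qpow_zero, one_mul]
  rw [h3] at h2
  refine h2.congr' ?_
  filter_upwards [P.eventually_theta_q_sq_mul_ne_zero hu] with w hw
  rw [alpha_eq, resFactor, one_mul]
  field_simp

lemma tendsto_resFactor_beta (N : ℕ) (x : ℂ) :
    Tendsto (fun w => P.resFactor N w * P.beta x w) (𝓝[≠] (P.qpow (-2 * N)))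
      (𝓝 (-P.E 1 * (P.E (x + N) * (1 / P.E x)))) := by
  have hu := P.qpow_ne_zero (-2 * N)
  have h1 := (P.tendsto_theta_mul _ _ (P.qpow_ne_zero (-2 * x)) hu).const_mul
    (P.qpow (N - 1) * P.theta ((P.q : ℂ) ^ 2) * P.qpow x)
  have h2 := h1.mul_const (1 / P.E x)
  have h3 : P.qpow (N - 1) * P.theta ((P.q : ℂ) ^ 2) * P.qpow x *
      P.theta (P.qpow (-2 * x) * P.qpow (-2 * N)) = -P.E 1 * P.E (x + N) := by
    have e1 : (P.q : ℂ) ^ 2 = P.qpow (2 * 1) := by rw [← qpow_natCast]; norm_num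
    have e2 : P.qpow (N - 1) * P.qpow 1 * P.qpow x * P.qpow (-(x + N)) = 1 := by
      rw [← qpow_add, ← qpow_add, ← qpow_add,
        show (N : ℂ) - 1 + 1 + x + -(x + N) = 0 by ring, qpow_zero]
    rw [e1, theta_qpow_two_mul, ← qpow_add, ← mul_add, theta_qpow]
    linear_combination -(P.E 1 * P.E (x + N)) * e2
  rw [h3, mul_assoc (-P.E 1)] at h2
  refine Tendsto.congr' (f₁ := fun w => P.qpow (N - 1) * P.theta ((P.q : ℂ) ^ 2) * P.qpow x *
    P.theta (P.qpow (-2 * x) * w) * (1 / P.E x)) ?_ h2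
  filter_upwards [P.eventually_theta_q_sq_mul_ne_zero hu] with w hw
  rw [beta_eq, resFactor]
  field_simp

lemma isMeroLimit_alphaRes (N : ℕ) (i j : Fin n) :
    IsMeroLimit (P.resFactor N) (fun ζ w => P.alpha (ζ (cartanDiff i j)) w) (P.qpow (-2 * N))
      (P.alphaRes N i j) := by
  refine ⟨algebraMap ℂ _ (P.E N) * (P.EFun i j 1 * P.EInvFun i j 0), rfl, ?_⟩
  rw [Set.eq_univ_of_forall (s := {x | _}), interior_univ]
  · exact dense_univ
  · intro ζ
    change Tendsto _ _ (𝓝 (P.E N * (P.E _ * (1 / P.E (_ + 0)))))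
    rw [add_zero]
    exact P.tendsto_resFactor_alpha N (ζ (cartanDiff i j))

lemma isMeroLimit_betaRes (N : ℕ) (i j : Fin n) :
    IsMeroLimit (P.resFactor N) (fun ζ w => P.beta (ζ (cartanDiff i j)) w) (P.qpow (-2 * N))
      (P.betaRes N i j) := by
  refine ⟨algebraMap ℂ _ (-P.E 1) * (P.EFun i j N * P.EInvFun i j 0), rfl, ?_⟩
  rw [Set.eq_univ_of_forall (s := {x | _}), interior_univ]
  · exact dense_univ
  · intro ζ
    change Tendsto _ _ (𝓝 (-P.E 1 * (P.E _ * (1 / P.E (_ + 0)))))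
    rw [add_zero]
    exact P.tendsto_resFactor_beta N (ζ (cartanDiff i j))

/-- The off-diagonal part of the limit of the R-matrix, multiplied by `resFactor`, at
`w = q^(-2N)`. -/
noncomputable def RmatRes (N : ℕ) (a b x y : Fin n) : MF n :=
  if x = a ∧ y = b then P.alphaRes N x y
  else if x = b ∧ y = a then P.betaRes N x y
  else 0

lemma isMeroLimit_zero (φ : ℂ → ℂ) (w₀ : ℂ) :
    IsMeroLimit φ (fun (_ : CartanDual n) _ => (0 : ℂ)) w₀ (0 : MF n) :=
  ⟨0, map_zero _, by simp⟩

lemma isMeroLimit_RmatRes_upper (N : ℕ) {a b : Fin n} (hab : a ≠ b) (x y : Fin n) :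
    IsMeroLimit (P.resFactor N) (P.Rmat a b x y) (P.qpow (-2 * N)) (P.RmatRes N a b x y) := by
  unfold Rmat RmatRes
  simp only [if_neg hab]
  split_ifs
  · exact P.isMeroLimit_alphaRes N x y
  · exact P.isMeroLimit_betaRes N x y
  · exact isMeroLimit_zero _ _

lemma isMeroLimit_RmatRes_lower (N : ℕ) (a b : Fin n) {x y : Fin n} (hxy : x ≠ y) :
    IsMeroLimit (P.resFactor N) (P.Rmat a b x y) (P.qpow (-2 * N)) (P.RmatRes N a b x y) := by
  by_cases hab : a = b
  · subst hab
    have h : ¬ (x = a ∧ y = a) := fun h => hxy (h.1.trans h.2.symm)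
    unfold Rmat RmatRes
    simp only [if_true, if_neg h]
    exact isMeroLimit_zero _ _
  · exact P.isMeroLimit_RmatRes_upper N hab x y

/-- The partial fraction identity for `E` in terms of the limits of the R-matrix. -/
lemma sum_betaRes_mul_prod (K : Finset (Fin n)) (hK : K.Nonempty) {b : Fin n} (hb : b ∉ K) :
    ∑ a ∈ K, P.betaRes K.card a b * ∏ k ∈ K.erase a, (P.EM k a 1 * P.EMInv a k 0) =
      algebraMap ℂ _ (P.E K.card) * ∏ k ∈ K, (P.EM k b 1 * P.EMInv b k 0) := by
  simp only [betaRes, EM, EMInv, algebraMap_MF, ← map_mul, ← map_prod, ← map_sum]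
  refine meroFun_mk_eq P.isOpen_regularSet P.dense_regularSet fun ζ hζ => ?_
  have hE : ∀ {i j : Fin n}, i ≠ j → P.E (ζ (cartanDiff i j)) ≠ 0 :=
    P.E_ne_zero_of_mem_regularSet hζ
  have hne : ∀ a ∈ K, a ≠ b := fun a ha h => hb (h ▸ ha)
  have hsub : ∀ k a, ζ (cartanDiff k b) - ζ (cartanDiff a b) = ζ (cartanDiff k a) := fun k a => by
    rw [cartanDiff_apply_add ζ k a b, add_sub_cancel_right]
  have key := P.E_partial_fractions K hK (fun k => ζ (cartanDiff k b))
    (fun a ha => hE (hne a ha)) (fun a _ k _ hka => by rw [hsub]; exact hE hka)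
  simp only [hsub] at key
  have hEM : ∀ i j c, (P.EFun i j c).1 ζ = P.E (ζ (cartanDiff i j) + c) := fun _ _ _ => rfl
  have hEI' : ∀ i j, (P.EInvFun i j 0).1 ζ = 1 / P.E (ζ (cartanDiff i j)) := fun i j => by
    change 1 / P.E (ζ (cartanDiff i j) + 0) = _
    rw [add_zero]
  have hc : ∀ c : ℂ, (algebraMap ℂ (meroFun (CartanDual n)) c).1 ζ = c := fun _ => rfl
  have hmul : ∀ f g : meroFun (CartanDual n), (f * g).1 ζ = f.1 ζ * g.1 ζ := fun _ _ => rfl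
  have hprod : ∀ (s : Finset (Fin n)) (f : Fin n → meroFun (CartanDual n)),
      (∏ k ∈ s, f k).1 ζ = ∏ k ∈ s, (f k).1 ζ := fun s f => by
    rw [SubmonoidClass.coe_finsetProd, Finset.prod_apply]
  have hsum : ∀ (s : Finset (Fin n)) (f : Fin n → meroFun (CartanDual n)),
      (∑ k ∈ s, f k).1 ζ = ∑ k ∈ s, (f k).1 ζ := fun s f => by
    rw [AddSubmonoidClass.coe_finsetSum, Finset.sum_apply]
  simp only [hsum, hmul, hprod, hc, hEM, hEI']
  have e1 : ∀ (s : Finset (Fin n)) (b : Fin n),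
      ∏ k ∈ s, P.E (ζ (cartanDiff k b) + 1) * (1 / P.E (ζ (cartanDiff b k))) =
        (-1) ^ s.card * ∏ k ∈ s, P.E (ζ (cartanDiff k b) + 1) / P.E (ζ (cartanDiff k b)) := by
    intro s b
    rw [← Finset.prod_const, ← Finset.prod_mul_distrib]
    refine Finset.prod_congr rfl fun k _ => ?_
    rw [cartanDiff_apply_swap ζ k b, E_neg, div_neg]
    ring
  rw [e1, mul_left_comm, ← key, Finset.mul_sum, Finset.mul_sum]
  refine Finset.sum_congr rfl fun a ha => ?_
  have hcard : (-1 : ℂ) ^ K.card = -(-1) ^ (K.erase a).card := by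
    rw [← Finset.card_erase_add_one ha, pow_succ]; ring
  rw [e1, hcard]
  ring

end EllParams

/-! ### Products over pairs -/

section PairProd

variable {ι M : Type*} [CommMonoid M]

/-- The product of `g i j` over all pairs of entries of a list in which `i` stands before `j`. -/
def pairProd (g : ι → ι → M) : List ι → M
  | [] => 1
  | i :: t => (t.map (g i)).prod * pairProd g t

lemma map_pairProd {M' H : Type*} [CommMonoid M'] [FunLike H M M'] [MonoidHomClass H M M'] (φ : H)
    {g : ι → ι → M} {g' : ι → ι → M'} {l : List ι} (h : ∀ i ∈ l, ∀ j ∈ l, φ (g i j) = g' i j) :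
    φ (pairProd g l) = pairProd g' l := by
  induction l with
  | nil => exact map_one φ
  | cons i t ih =>
    rw [pairProd, pairProd, map_mul, map_list_prod, List.map_map,
      ih fun i hi j hj => h i (List.mem_cons_of_mem _ hi) j (List.mem_cons_of_mem _ hj)]
    congr 2
    exact List.map_congr_left fun k hk =>
      h i List.mem_cons_self k (List.mem_cons_of_mem _ hk)

lemma prod_prod_eq_pairProd [DecidableEq ι] (r : ι → ι → Prop) [DecidableRel r]
    (hr : ∀ i j, r i j → ¬ r j i) (g : ι → ι → M) {l : List ι} (hl : l.Pairwise r) :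
    ∏ i ∈ l.toFinset, ∏ j ∈ l.toFinset with r i j, g i j = pairProd g l := by
  have hirr : ∀ i, ¬ r i i := fun i h => hr i i h h
  induction l with
  | nil => simp [pairProd]
  | cons i t ih =>
    obtain ⟨hi, ht⟩ := List.pairwise_cons.mp hl
    have hnd : t.Nodup := ht.imp fun hab => by rintro rfl; exact hirr _ hab
    have hit : i ∉ t.toFinset := fun h => hirr i (hi i (List.mem_toFinset.mp h))
    rw [List.toFinset_cons, Finset.prod_insert hit, pairProd, ← ih ht]
    congr 1
    · rw [Finset.filter_insert, if_neg (hirr i), Finset.filter_true_of_mem fun j hj =>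
        hi j (List.mem_toFinset.mp hj), List.prod_toFinset _ hnd]
    · refine Finset.prod_congr rfl fun j hj => ?_
      rw [Finset.filter_insert, if_neg (hr i j (hi j (List.mem_toFinset.mp hj)))]

end PairProd

/-! ### Raising operators -/

section Raising

variable {ι M : Type*} [CommRing M] [Algebra ℂ M]

/-- Multiplication by a function. -/
def mulOp (g : M) : Module.End ℂ (Finset ι → M) where
  toFun φ I := g * φ I
  map_add' φ ψ := by ext I; simp [mul_add]
  map_smul' c φ := by ext I; simp

lemma mulOp_apply (g : M) (φ : Finset ι → M) (I : Finset ι) : mulOp g φ I = g * φ I := rfl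

/-- A vector is supported on the set `K` alone. -/
def IsSupportedOn (φ : Finset ι → M) (K : Finset ι) : Prop := ∀ I, I ≠ K → φ I = 0

lemma IsSupportedOn.mulOp {φ : Finset ι → M} {K : Finset ι} (h : IsSupportedOn φ K) (g : M) :
    IsSupportedOn (mulOp g φ) K := fun I hI => by rw [mulOp_apply, h I hI, mul_zero]

variable [DecidableEq ι] {c : ι → ι → M} {σ : ι → M →ₐ[ℂ] M}

/-- The operator which sends the basis vector of a set `I` with `i ∉ I` and `|I| ∈ A` to
`∏_{k ∈ I} c i k` times the basis vector of `I ∪ {i}`, and all other basis vectors to zero; it is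
semilinear with respect to the translation `σ i`. -/
noncomputable def raiseOp (c : ι → ι → M) (σ : ι → M →ₐ[ℂ] M) (i : ι) (A : Set ℕ) :
    Module.End ℂ (Finset ι → M) := by
  classical
  exact
  { toFun := fun φ I => if i ∈ I ∧ (I.erase i).card ∈ A then
      (∏ k ∈ I.erase i, c i k) * σ i (φ (I.erase i)) else 0
    map_add' := fun φ ψ => by ext I; simp only [Pi.add_apply]; split_ifs <;> simp [mul_add]
    map_smul' := fun a φ => by ext I; simp only [Pi.smul_apply]; split_ifs <;> simp }

open Classical in
lemma raiseOp_apply (i : ι) (A : Set ℕ) (φ : Finset ι → M) (I : Finset ι) :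
    raiseOp c σ i A φ I = if i ∈ I ∧ (I.erase i).card ∈ A then
      (∏ k ∈ I.erase i, c i k) * σ i (φ (I.erase i)) else 0 := rfl

lemma raiseOp_mulOp (i : ι) (A : Set ℕ) (g : M) :
    raiseOp c σ i A * mulOp g = mulOp (σ i g) * raiseOp c σ i A := by
  ext φ I
  simp only [Module.End.mul_apply, raiseOp_apply, mulOp_apply, map_mul]
  split_ifs
  · ring
  · rw [mul_zero]

lemma raiseOp_raiseOp_self (i : ι) (A B : Set ℕ) : raiseOp c σ i A * raiseOp c σ i B = 0 := by
  ext φ I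
  simp [Module.End.mul_apply, raiseOp_apply]

lemma raiseOp_raiseOp_eq_zero (i j : ι) {A B : Set ℕ} (h : ∀ m ∈ B, m + 1 ∉ A) :
    raiseOp c σ i A * raiseOp c σ j B = 0 := by
  ext φ I
  simp only [Module.End.mul_apply, raiseOp_apply, LinearMap.zero_apply, Pi.zero_apply]
  split_ifs with h1 h2
  · exfalso
    refine h _ h2.2 ?_
    rw [Finset.card_erase_add_one h2.1]
    exact h1.2
  · rw [map_zero, mul_zero]
  · rfl

open Classical in
lemma raiseOp_exchange (hσ : ∀ i j g, σ i (σ j g) = σ j (σ i g))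
    (hc : ∀ {i j k}, k ≠ i → k ≠ j → σ k (c i j) = c i j) {i j : ι} (hij : i ≠ j) (A B : Set ℕ) :
    mulOp (c j i) * (raiseOp c σ i A * raiseOp c σ j B) =
      mulOp (c i j) * (raiseOp c σ j A * raiseOp c σ i B) := by
  have key : ∀ {i j : ι}, i ≠ j → ∀ φ I, (raiseOp c σ i A * raiseOp c σ j B) φ I =
      if i ∈ I ∧ j ∈ I ∧ (I.erase i).card ∈ A ∧ ((I.erase i).erase j).card ∈ B then
        c i j * ((∏ k ∈ (I.erase i).erase j, c i k) * ∏ k ∈ (I.erase i).erase j, c j k) *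
          σ i (σ j (φ ((I.erase i).erase j))) else 0 := by
    intro i j hij φ I
    simp only [Module.End.mul_apply, raiseOp_apply, Finset.mem_erase]
    by_cases h : i ∈ I ∧ j ∈ I ∧ (I.erase i).card ∈ A ∧ ((I.erase i).erase j).card ∈ B
    · rw [if_pos h, if_pos ⟨h.1, h.2.2.1⟩, if_pos ⟨⟨hij.symm, h.2.1⟩, h.2.2.2⟩, map_mul, map_prod,
        ← Finset.mul_prod_erase (I.erase i) (c i) (Finset.mem_erase.mpr ⟨hij.symm, h.2.1⟩),
        Finset.prod_congr rfl fun k hk => hc (k := i) hij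
          (Finset.ne_of_mem_erase (Finset.mem_of_mem_erase hk)).symm]
      ring
    · rw [if_neg h]
      split_ifs with h1 h2
      · exact absurd ⟨h1.1, h2.1.2, h1.2, h2.2⟩ h
      · simp
      · rfl
  ext φ I
  rw [Module.End.mul_apply (mulOp _), Module.End.mul_apply (mulOp _), mulOp_apply, mulOp_apply,
    key hij,
    key hij.symm, Finset.erase_right_comm (a := j)]
  by_cases hi : i ∈ I
  · by_cases hj : j ∈ I
    · rw [Finset.card_erase_of_mem hi, Finset.card_erase_of_mem hj]
      simp only [hi, hj, true_and, hσ i j]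
      split_ifs
      · ring
      · ring
    · simp [hj]
  · simp [hi]

lemma raiseOp_single {i : ι} {A : Set ℕ} {I : Finset ι} (hi : i ∉ I) (hA : I.card ∈ A) :
    raiseOp c σ i A (Pi.single I 1) = mulOp (∏ k ∈ I, c i k) (Pi.single (insert i I) 1) := by
  ext J
  rw [raiseOp_apply, mulOp_apply]
  by_cases hJ : J = insert i I
  · subst hJ
    simp [Finset.erase_insert hi, hA]
  · rw [Pi.single_eq_of_ne hJ, mul_zero]
    split_ifs with h
    · have : J.erase i ≠ I := by
        rintro rfl
        exact hJ (Finset.insert_erase h.1).symm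
      rw [Pi.single_eq_of_ne this, map_zero, mul_zero]
    · rfl

lemma IsSupportedOn.raiseOp {φ : Finset ι → M} {K : Finset ι} (h : IsSupportedOn φ K) (i : ι)
    (A : Set ℕ) : IsSupportedOn (raiseOp c σ i A φ) (insert i K) := fun I hI => by
  rw [raiseOp_apply]
  split_ifs with h1
  · rw [h, map_zero, mul_zero]
    rintro rfl
    exact hI (Finset.insert_erase h1.1).symm
  · rfl

end Raising

/-! ### Exterior algebras with quadratic exchange relations -/

section ExchangeData

variable {ι M Λ : Type*} [DecidableEq ι] [CommRing M] [Algebra ℂ M] [Ring Λ] [Algebra ℂ Λ]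

/-- The features of the algebras `Λ` and `Λ'` that matter for words of the form
`v_{i_d}(y_{d-1}) ⋯ v_{i_1}(y_0)`, where `y` is a fixed sequence of spectral parameters: functions
`f(g)`, generators `v i m = v_i(y_m)`, translations `σ_i`, and functions `c i j` with inverses
`ci i j` such that `c j i` and `c i j` are the coefficients of the exchange relation. -/
structure ExchangeData (ι M Λ : Type*) [DecidableEq ι] [CommRing M] [Algebra ℂ M] [Ring Λ]
    [Algebra ℂ Λ] where
  f : M →ₐ[ℂ] Λ
  v : ι → ℕ → Λ
  σ : ι → M →ₐ[ℂ] M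
  c : ι → ι → M
  ci : ι → ι → M
  v_f : ∀ i m g, v i m * f g = f (σ i g) * v i m
  c_ci : ∀ {i j}, i ≠ j → c i j * ci i j = 1
  σ_ci : ∀ {i j k}, k ≠ i → k ≠ j → σ k (ci i j) = ci i j
  v_v : ∀ i m, v i (m + 1) * v i m = 0
  exchange : ∀ {i j} (m), i ≠ j →
    f (c j i) * (v i (m + 1) * v j m) = f (c i j) * (v j (m + 1) * v i m)

namespace ExchangeData

variable (D : ExchangeData ι M Λ)

/-- The product `v_{i_d}(y_{d-1}) ⋯ v_{i_1}(y_0)` for a list `[i_d, …, i_1]`, normalized so that it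
does not depend on the order of the list. -/
def word : List ι → Λ
  | [] => 1
  | i :: t => D.f (t.map (D.ci i)).prod * (D.v i t.length * word t)

lemma exchange' {i j : ι} (m : ℕ) (h : i ≠ j) :
    D.f (D.ci i j) * (D.v i (m + 1) * D.v j m) = D.f (D.ci j i) * (D.v j (m + 1) * D.v i m) := by
  have h1 := congrArg (fun x => D.f (D.ci i j * D.ci j i) * x) (D.exchange m h)
  simp only [← mul_assoc, ← map_mul] at h1
  have e1 : D.ci i j * D.ci j i * D.c j i = D.ci i j := by
    linear_combination D.ci i j * D.c_ci h.symm
  have e2 : D.ci i j * D.ci j i * D.c i j = D.ci j i := by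
    linear_combination D.ci j i * D.c_ci h
  rw [e1, e2] at h1
  simpa only [mul_assoc] using h1

lemma v_f_ci_prod {i j : ι} (m : ℕ) (h : i ≠ j) {t : List ι} (ht : i ∉ t) :
    D.v i m * D.f (t.map (D.ci j)).prod = D.f (t.map (D.ci j)).prod * D.v i m := by
  rw [D.v_f]
  congr 2
  rw [map_list_prod, List.map_map]
  congr 1
  refine List.map_congr_left fun k hk => ?_
  exact D.σ_ci h fun hik => ht (hik ▸ hk)

lemma word_perm {l l' : List ι} (h : l.Perm l') (hl : l.Nodup) : D.word l = D.word l' := by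
  induction h with
  | nil => rfl
  | cons i h ih =>
    rw [word, word, ih (List.nodup_cons.mp hl).2, h.length_eq, (h.map _).prod_eq]
  | swap j i t =>
    simp only [List.nodup_cons, List.mem_cons, not_or] at hl
    have key : ∀ i j : ι, i ≠ j → i ∉ t → D.word (i :: j :: t) =
        D.f ((t.map (D.ci i)).prod * (t.map (D.ci j)).prod) *
          (D.f (D.ci i j) * (D.v i (t.length + 1) * D.v j t.length) * D.word t) := by
      intro i j hij hi
      rw [word, word, List.map_cons, List.prod_cons, List.length_cons, ← mul_assoc (D.v i _),
        D.v_f_ci_prod _ hij hi]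
      simp only [map_mul, mul_assoc]
      simp only [← mul_assoc, ← map_mul]
      congr 4
      ring
    rw [key i j hl.1.1 hl.1.2, key j i (Ne.symm hl.1.1) hl.2.1,
      mul_comm (t.map (D.ci i)).prod, D.exchange' _ hl.1.1]
  | trans h₁ _ ih₁ ih₂ => exact (ih₁ hl).trans (ih₂ (h₁.nodup hl))

/-- The normalized word of a finite set. -/
noncomputable def setWord (I : Finset ι) : Λ := D.word I.toList

lemma word_eq_setWord {l : List ι} (hl : l.Nodup) : D.word l = D.setWord l.toFinset :=
  D.word_perm ((List.perm_ext_iff_of_nodup hl (Finset.nodup_toList _)).mpr (by simp)) hl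

lemma setWord_insert {i : ι} {I : Finset ι} (hi : i ∉ I) :
    D.setWord (insert i I) =
      D.f (∏ k ∈ I, D.ci i k) * (D.v i I.card * D.setWord I) := by
  have h1 : (i :: I.toList).Nodup := List.nodup_cons.mpr ⟨by simpa using hi, I.nodup_toList⟩
  have h2 := D.word_eq_setWord h1
  rw [List.toFinset_cons, Finset.toList_toFinset] at h2
  rw [← h2, word, Finset.length_toList, Finset.prod_map_toList, setWord]

lemma v_mul_setWord {i : ι} {I : Finset ι} (hi : i ∉ I) :
    D.v i I.card * D.setWord I = D.f (∏ k ∈ I, D.c i k) * D.setWord (insert i I) := by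
  rw [D.setWord_insert hi, ← mul_assoc, ← map_mul, ← Finset.prod_mul_distrib,
    Finset.prod_eq_one (f := fun k => D.c i k * D.ci i k)
      fun k hk => D.c_ci fun h => hi (h ▸ hk), map_one, one_mul]

lemma v_mul_setWord_of_mem {i : ι} {I : Finset ι} (hi : i ∈ I) :
    D.v i I.card * D.setWord I = 0 := by
  rw [← Finset.insert_erase hi, D.setWord_insert (Finset.notMem_erase i I),
    Finset.card_insert_of_notMem (Finset.notMem_erase i I), ← mul_assoc, D.v_f, mul_assoc,
    ← mul_assoc (D.v i _), D.v_v, zero_mul, mul_zero]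

/-- The product `v_{i_d}(y_{d-1}) ⋯ v_{i_1}(y_0)` for a list `[i_d, …, i_1]`. -/
def rawWord : List ι → Λ
  | [] => 1
  | i :: t => D.v i t.length * rawWord t

lemma word_eq_rawWord {l : List ι} (hl : l.Nodup) :
    D.word l = D.f (pairProd D.ci l) * D.rawWord l := by
  induction l with
  | nil => simp [word, rawWord, pairProd]
  | cons i t ih =>
    obtain ⟨hi, ht⟩ := List.nodup_cons.mp hl
    have h : D.σ i (pairProd D.ci t) = pairProd D.ci t :=
      map_pairProd _ fun j hj k hk => D.σ_ci (fun h => hi (h ▸ hj)) (fun h => hi (h ▸ hk))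
    rw [word, rawWord, pairProd, ih ht, ← mul_assoc (D.v i _), D.v_f, h, map_mul]
    simp only [mul_assoc]

lemma rep_word (N : Λ →ₐ[ℂ] Module.End ℂ (Finset ι → M)) (hf : ∀ g, N (D.f g) = mulOp g)
    (hv : ∀ i m, ∃ A : Set ℕ, m ∈ A ∧ N (D.v i m) = raiseOp D.c D.σ i A) {l : List ι}
    (hl : l.Nodup) : N (D.word l) (Pi.single ∅ 1) = Pi.single l.toFinset 1 := by
  induction l with
  | nil => simp [word]
  | cons i t ih =>
    obtain ⟨hi, ht⟩ := List.nodup_cons.mp hl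
    obtain ⟨A, hA, hvA⟩ := hv i t.length
    have hi' : i ∉ t.toFinset := by simpa using hi
    rw [word, map_mul, map_mul, hf, hvA, Module.End.mul_apply, Module.End.mul_apply, ih ht,
      raiseOp_single hi' (by rwa [List.toFinset_card_of_nodup ht]), List.toFinset_cons]
    funext J
    rw [mulOp_apply, mulOp_apply, ← mul_assoc, List.prod_toFinset _ ht, ← List.prod_map_mul,
      List.prod_eq_one, one_mul]
    intro x hx
    obtain ⟨k, hk, rfl⟩ := List.mem_map.mp hx
    rw [mul_comm]
    exact D.c_ci fun h => hi (h ▸ hk)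

end ExchangeData

end ExchangeData

lemma sum_sum_erase {ι A : Type*} [Fintype ι] [DecidableEq ι] [AddCommMonoid A]
    (g : ι → Finset ι → A) :
    ∑ J : Finset ι, ∑ j ∈ J, g j (J.erase j) = ∑ j, ∑ J : Finset ι, if j ∈ J then 0 else g j J := by
  rw [Finset.sum_comm' (t' := Finset.univ) (s' := fun j => Finset.univ.filter (j ∈ ·)) (by simp)]
  refine Finset.sum_congr rfl fun j _ => ?_
  have h : ∑ J : Finset ι, (if j ∈ J then 0 else g j J) = ∑ J : Finset ι with j ∉ J, g j J := by
    rw [Finset.sum_filter]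
    exact Finset.sum_congr rfl fun J _ => (ite_not _ _ _).symm
  rw [h]
  refine Finset.sum_nbij' (fun J => J.erase j) (fun J => insert j J) ?_ ?_ ?_ ?_ ?_
  · simp
  · simp
  · intro J hJ
    exact Finset.insert_erase (by simpa using hJ)
  · intro J hJ
    exact Finset.erase_insert (by simpa using hJ)
  · simp

/-! ### The coaction on words -/

section CoactionData

variable {ι M Λ F T : Type*} [DecidableEq ι] [Fintype ι] [CommRing M] [Algebra ℂ M] [Ring Λ]
  [Algebra ℂ Λ] [Ring F] [Algebra ℂ F] [Semiring T] [Algebra ℂ T]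

/-- A coaction `Δ : Λ → F ⊗̃ Λ` of the kind considered here. The algebra `T = F ⊗̃ Λ` is given by a
subalgebra `S` of `F ⊗ Λ` and a homomorphism `S → T` that identifies `s(g) ⊗ 1` with `1 ⊗ f(g)`,
and `Δ(f(g)) = o(g) ⊗ 1`, `Δ(v_i(y_m)) = ∑_j ε_ij(m) ⊗ v_j(y_m)`. -/
structure CoactionData (D : ExchangeData ι M Λ) (F T : Type*) [Ring F] [Algebra ℂ F] [Semiring T]
    [Algebra ℂ T] where
  s : M →ₐ[ℂ] F
  o : M →ₐ[ℂ] F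
  ε : ι → ι → ℕ → F
  S : Subalgebra ℂ (F ⊗[ℂ] Λ)
  proj : S →ₐ[ℂ] T
  Δ : Λ →ₐ[ℂ] T
  s_mem : ∀ g, s g ⊗ₜ[ℂ] (1 : Λ) ∈ S
  o_mem : ∀ g, o g ⊗ₜ[ℂ] (1 : Λ) ∈ S
  f_mem : ∀ g, (1 : F) ⊗ₜ[ℂ] D.f g ∈ S
  ε_mem : ∀ i j m, ε i j m ⊗ₜ[ℂ] D.v j m ∈ S
  balance : ∀ g, proj ⟨_, s_mem g⟩ = proj ⟨_, f_mem g⟩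
  Δ_f : ∀ g, Δ (D.f g) = proj ⟨_, o_mem g⟩
  Δ_v : ∀ i m, Δ (D.v i m) = ∑ j, proj ⟨_, ε_mem i j m⟩

namespace CoactionData

variable {D : ExchangeData ι M Λ} (C : CoactionData D F T)

/-- The minors: the coefficients of the coaction on words. The defining recursion is the Laplace
expansion along the first entry of the list. -/
def minor : List ι → Finset ι → F
  | [], J => if J = ∅ then 1 else 0
  | i :: t, J => C.o (t.map (D.ci i)).prod *
      ∑ j ∈ J, C.s (∏ k ∈ J.erase j, D.c j k) * (C.ε i j t.length * minor t (J.erase j))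

lemma minor_cons_toList (i : ι) (K J : Finset ι) {o' : F} {s' ε' m' : ι → F}
    (ho : C.o (∏ k ∈ K, D.ci i k) = o') (hs : ∀ j, C.s (∏ k ∈ J.erase j, D.c j k) = s' j)
    (hε : ∀ j, C.ε i j K.card = ε' j) (hm : ∀ j, C.minor K.toList (J.erase j) = m' j) :
    C.minor (i :: K.toList) J = o' * ∑ j ∈ J, s' j * (ε' j * m' j) := by
  rw [minor, Finset.prod_map_toList, Finset.length_toList, ho]
  simp only [hs, hε, hm]

lemma minor_eq_zero {l : List ι} {J : Finset ι} (h : J.card ≠ l.length) : C.minor l J = 0 := by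
  induction l generalizing J with
  | nil =>
    rw [minor, if_neg]
    rintro rfl
    exact h rfl
  | cons i t ih =>
    rw [minor, Finset.sum_eq_zero, mul_zero]
    intro j hj
    rw [ih, mul_zero, mul_zero]
    intro h'
    rw [List.length_cons, ← h', Finset.card_erase_add_one hj] at h
    exact h rfl

open Classical in
/-- The map `S → T`, extended by zero to `F ⊗ Λ`. -/
noncomputable def proj₀ (x : F ⊗[ℂ] Λ) : T := if h : x ∈ C.S then C.proj ⟨x, h⟩ else 0

lemma proj₀_of_mem {x : F ⊗[ℂ] Λ} (h : x ∈ C.S) : C.proj₀ x = C.proj ⟨x, h⟩ := dif_pos h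

lemma proj₀_zero : C.proj₀ 0 = 0 := by
  rw [C.proj₀_of_mem (zero_mem _)]; exact map_zero C.proj

lemma proj₀_mul {x y : F ⊗[ℂ] Λ} (hx : x ∈ C.S) (hy : y ∈ C.S) :
    C.proj₀ (x * y) = C.proj₀ x * C.proj₀ y := by
  rw [C.proj₀_of_mem hx, C.proj₀_of_mem hy, C.proj₀_of_mem (mul_mem hx hy), ← map_mul]; rfl

lemma proj₀_sum {κ : Type*} (s : Finset κ) {x : κ → F ⊗[ℂ] Λ} (hx : ∀ k ∈ s, x k ∈ C.S) :
    C.proj₀ (∑ k ∈ s, x k) = ∑ k ∈ s, C.proj₀ (x k) := by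
  classical
  induction s using Finset.induction_on with
  | empty => simp [proj₀_zero]
  | insert a s ha ih =>
    have h1 := hx a (Finset.mem_insert_self a s)
    have h2 : ∀ k ∈ s, x k ∈ C.S := fun k hk => hx k (Finset.mem_insert_of_mem hk)
    rw [Finset.sum_insert ha, Finset.sum_insert ha, ← ih h2, C.proj₀_of_mem h1,
      C.proj₀_of_mem (sum_mem h2), C.proj₀_of_mem (add_mem h1 (sum_mem h2)), ← map_add]
    rfl

/-- A single term of the expansion of a minor is again matched: reordering the word of
`insert j J` inserts only functions of degree zero. -/
lemma term_mem {t : List ι} (ht : ∀ J, C.minor t J ⊗ₜ[ℂ] D.setWord J ∈ C.S) (i : ι) {j : ι}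
    {J : Finset ι} (hj : j ∉ J) :
    (C.ε i j t.length * C.minor t J) ⊗ₜ[ℂ] D.setWord (insert j J) ∈ C.S := by
  by_cases hJ : J.card = t.length
  · have := mul_mem (C.f_mem (∏ k ∈ J, D.ci j k)) (mul_mem (C.ε_mem i j t.length) (ht J))
    rwa [Algebra.TensorProduct.tmul_mul_tmul, Algebra.TensorProduct.tmul_mul_tmul, one_mul, ← hJ,
      ← D.setWord_insert hj, hJ] at this
  · rw [C.minor_eq_zero hJ, mul_zero, TensorProduct.zero_tmul]
    exact zero_mem _

lemma minor_cons_tmul (i : ι) (t : List ι) (J : Finset ι) (w : Λ) :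
    C.minor (i :: t) J ⊗ₜ[ℂ] w = (C.o (t.map (D.ci i)).prod ⊗ₜ[ℂ] (1 : Λ)) *
      ∑ j ∈ J, (C.s (∏ k ∈ J.erase j, D.c j k) ⊗ₜ[ℂ] (1 : Λ)) *
        ((C.ε i j t.length * C.minor t (J.erase j)) ⊗ₜ[ℂ] w) := by
  simp only [minor, Algebra.TensorProduct.tmul_mul_tmul, one_mul, ← TensorProduct.sum_tmul]

lemma minor_mem (l : List ι) (J : Finset ι) : C.minor l J ⊗ₜ[ℂ] D.setWord J ∈ C.S := by
  induction l generalizing J with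
  | nil =>
    rw [minor]
    split_ifs with h
    · rw [h]
      rw [ExchangeData.setWord, Finset.toList_empty, ExchangeData.word]
      exact one_mem C.S
    · rw [TensorProduct.zero_tmul]
      exact zero_mem _
  | cons i t ih =>
    rw [minor_cons_tmul]
    refine mul_mem (C.o_mem _) (sum_mem fun j hj => mul_mem (C.s_mem _) ?_)
    have := C.term_mem ih i (Finset.notMem_erase j J)
    rwa [Finset.insert_erase hj] at this

/-- The coaction of a word: expand each factor, reorder the words that occur, and move the
coefficients to the other tensor factor. -/
theorem coaction_word (l : List ι) :
    C.Δ (D.word l) = ∑ J, C.proj₀ (C.minor l J ⊗ₜ[ℂ] D.setWord J) := by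
  induction l with
  | nil =>
    rw [Finset.sum_eq_single ∅]
    · have : (1 : F ⊗[ℂ] Λ) = (1 : F) ⊗ₜ (1 : Λ) := rfl
      rw [minor, if_pos rfl, ExchangeData.setWord, Finset.toList_empty, ExchangeData.word, ← this,
        C.proj₀_of_mem (one_mem _), map_one]
      exact (map_one C.proj).symm
    · intro J _ hJ
      rw [minor, if_neg hJ, TensorProduct.zero_tmul, proj₀_zero]
    · simp
  | cons i t ih =>
    have e1 : ∀ j J, C.proj₀ (C.ε i j t.length ⊗ₜ D.v j t.length) *
        C.proj₀ (C.minor t J ⊗ₜ[ℂ] D.setWord J) = if j ∈ J then 0 else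
          C.proj₀ (C.s (∏ k ∈ J, D.c j k) ⊗ₜ[ℂ] (1 : Λ)) *
            C.proj₀ ((C.ε i j t.length * C.minor t J) ⊗ₜ[ℂ] D.setWord (insert j J)) := by
      intro j J
      rw [← C.proj₀_mul (C.ε_mem i j _) (C.minor_mem t J), Algebra.TensorProduct.tmul_mul_tmul]
      -- Only sets `J` with as many elements as `t` contribute, and for these the parameter of the
      -- new generator is the one that the word of `J` expects.
      by_cases hJ : J.card = t.length
      · split_ifs with hj
        · rw [← hJ, D.v_mul_setWord_of_mem hj, TensorProduct.tmul_zero, proj₀_zero]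
        · have hm := C.term_mem (C.minor_mem t) i hj
          rw [C.proj₀_of_mem (C.s_mem _), C.balance, ← C.proj₀_of_mem (C.f_mem _),
            ← C.proj₀_mul (C.f_mem _) hm, Algebra.TensorProduct.tmul_mul_tmul, one_mul,
            ← D.v_mul_setWord hj, hJ]
      · rw [C.minor_eq_zero hJ]
        simp [proj₀_zero]
    have e2 : ∀ J, C.proj₀ (C.minor (i :: t) J ⊗ₜ[ℂ] D.setWord J) =
        C.proj₀ (C.o (t.map (D.ci i)).prod ⊗ₜ[ℂ] (1 : Λ)) *
          ∑ j ∈ J, C.proj₀ (C.s (∏ k ∈ J.erase j, D.c j k) ⊗ₜ[ℂ] (1 : Λ)) *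
            C.proj₀ ((C.ε i j t.length * C.minor t (J.erase j)) ⊗ₜ[ℂ]
              D.setWord (insert j (J.erase j))) := by
      intro J
      have hm : ∀ j ∈ J, (C.ε i j t.length * C.minor t (J.erase j)) ⊗ₜ[ℂ] D.setWord J ∈ C.S := by
        intro j hj
        have := C.term_mem (C.minor_mem t) i (Finset.notMem_erase j J)
        rwa [Finset.insert_erase hj] at this
      rw [minor_cons_tmul,
        C.proj₀_mul (C.o_mem _) (sum_mem fun j hj => mul_mem (C.s_mem _) (hm j hj)),
        C.proj₀_sum _ fun j hj => mul_mem (C.s_mem _) (hm j hj)]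
      congr 1
      refine Finset.sum_congr rfl fun j hj => ?_
      rw [C.proj₀_mul (C.s_mem _) (hm j hj), Finset.insert_erase hj]
    simp only [e2]
    rw [← Finset.mul_sum, sum_sum_erase fun j J =>
      C.proj₀ (C.s (∏ k ∈ J, D.c j k) ⊗ₜ[ℂ] (1 : Λ)) *
        C.proj₀ ((C.ε i j t.length * C.minor t J) ⊗ₜ[ℂ] D.setWord (insert j J))]
    simp only [← e1]
    rw [ExchangeData.word, map_mul, map_mul, ih, C.Δ_f, C.Δ_v, C.proj₀_of_mem (C.o_mem _),
      Finset.sum_mul_sum]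
    simp only [C.proj₀_of_mem (C.ε_mem _ _ _)]

lemma sum_minor_mem (l : List ι) : ∑ J, C.minor l J ⊗ₜ[ℂ] D.setWord J ∈ C.S :=
  sum_mem fun J _ => C.minor_mem l J

lemma coaction_word' (l : List ι) :
    C.Δ (D.word l) = C.proj ⟨∑ J, C.minor l J ⊗ₜ[ℂ] D.setWord J, C.sum_minor_mem l⟩ := by
  rw [coaction_word, ← C.proj₀_sum _ fun J _ => C.minor_mem l J, C.proj₀_of_mem (C.sum_minor_mem l)]

lemma exists_coaction_eq {V : Finset ι → Λ} {l : List ι} {I : Finset ι} (hl : l.Nodup)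
    (hI : l.toFinset = I) (hV : ∀ J, J.card = I.card → D.setWord J = V J) :
    ∃ h : ∑ J, C.minor l J ⊗ₜ[ℂ] V J ∈ C.S, C.Δ (V I) = C.proj ⟨_, h⟩ := by
  have hlen : l.length = I.card := by rw [← hI, List.toFinset_card_of_nodup hl]
  have e : ∑ J, C.minor l J ⊗ₜ[ℂ] D.setWord J = ∑ J, C.minor l J ⊗ₜ[ℂ] V J := by
    refine Finset.sum_congr rfl fun J _ => ?_
    by_cases h : J.card = I.card
    · rw [hV J h]
    · rw [C.minor_eq_zero fun h' => h (h'.trans hlen), TensorProduct.zero_tmul,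
        TensorProduct.zero_tmul]
  refine ⟨e ▸ C.sum_minor_mem l, ?_⟩
  rw [← hV I rfl, ← hI, ← D.word_eq_setWord hl, C.coaction_word']
  exact congrArg C.proj (Subtype.ext e)

end CoactionData

end CoactionData

/-! ### Coefficients in `F ⊗̃ Λ` are unique -/

section Coefficients

variable {κ M Λ F T : Type*} [DecidableEq κ] [Fintype κ] [CommRing M] [Algebra ℂ M] [Ring Λ]
  [Algebra ℂ Λ] [Ring F] [Algebra ℂ F]

/-- A representation of `Λ` on `M^κ` induces a map `F ⊗ Λ → End(F^κ)`, where `F^κ` is regarded as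
`F ⊗_M M^κ`. It is multiplicative only on the matrix tensor product. -/
noncomputable def tensorRep (s : M →ₐ[ℂ] F) (N : Λ →ₐ[ℂ] Module.End ℂ (κ → M)) :
    F ⊗[ℂ] Λ →ₗ[ℂ] Module.End ℂ (κ → F) :=
  TensorProduct.lift (LinearMap.mk₂ ℂ
    (fun a v =>
      { toFun := fun φ I => ∑ J, s (N v (Pi.single J 1) I) * (a * φ J)
        map_add' := fun φ ψ => by
          ext I; simp [mul_add, Finset.sum_add_distrib]
        map_smul' := fun c φ => by
          ext I; simp [Finset.smul_sum] })
    (fun a b v => by ext φ I; simp [add_mul, mul_add, Finset.sum_add_distrib])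
    (fun c a v => by ext φ I; simp [Finset.smul_sum])
    (fun a v w => by ext φ I; simp [add_mul, Finset.sum_add_distrib])
    (fun c a v => by ext φ I; simp [Finset.smul_sum]))

lemma tensorRep_tmul (s : M →ₐ[ℂ] F) (N : Λ →ₐ[ℂ] Module.End ℂ (κ → M)) (a : F) (v : Λ)
    (φ : κ → F) (I : κ) :
    tensorRep s N (a ⊗ₜ v) φ I = ∑ J, s (N v (Pi.single J 1) I) * (a * φ J) := rfl

variable {s : M →ₐ[ℂ] F} {f : M →ₐ[ℂ] Λ} {N : Λ →ₐ[ℂ] Module.End ℂ (κ → M)}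

lemma tensorRep_one : tensorRep s N 1 = 1 := by
  refine LinearMap.ext fun φ => funext fun I => ?_
  rw [Algebra.TensorProduct.one_def, tensorRep_tmul, map_one, Finset.sum_eq_single I]
  · simp
  · intro J _ hJ
    simp [Pi.single_eq_of_ne hJ.symm]
  · simp

/-- The tensors `a ⊗ v` for which `a` and `v` have the same translation behaviour. -/
def matchedTensors (s : M →ₐ[ℂ] F) (f : M →ₐ[ℂ] Λ) : Set (F ⊗[ℂ] Λ) :=
  {t | ∃ (a : F) (v : Λ) (τ : M → M), (∀ g, a * s g = s (τ g) * a) ∧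
    (∀ g, v * f g = f (τ g) * v) ∧ t = a ⊗ₜ v}

lemma tensorRep_mul (hN : ∀ g φ, N (f g) φ = fun I => g * φ I) {t : F ⊗[ℂ] Λ}
    (ht : t ∈ Algebra.adjoin ℂ (matchedTensors s f)) (t' : F ⊗[ℂ] Λ) :
    tensorRep s N (t * t') = tensorRep s N t * tensorRep s N t' := by
  induction ht using Algebra.adjoin_induction generalizing t' with
  | mem t ht =>
    obtain ⟨a, v, τ, ha, hv, rfl⟩ := ht
    induction t' using TensorProduct.induction_on with
    | zero => simp
    | add x y hx hy => rw [mul_add, map_add, hx, hy, map_add, mul_add]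
    | tmul a' v' =>
      refine LinearMap.ext fun φ => funext fun I => ?_
      rw [Algebra.TensorProduct.tmul_mul_tmul, Module.End.mul_apply, tensorRep_tmul, tensorRep_tmul]
      have e1 : ∀ J, N (v * v') (Pi.single J 1) I =
          ∑ K, τ (N v' (Pi.single J 1) K) * N v (Pi.single K 1) I := by
        intro J
        have h1 : N v' (Pi.single J 1) = ∑ K, N (f (N v' (Pi.single J 1) K)) (Pi.single K 1) := by
          funext I
          rw [Finset.sum_apply, Finset.sum_eq_single I]
          · simp [hN]
          · intro K _ hK
            simp [hN, Pi.single_eq_of_ne hK.symm]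
          · simp
        rw [map_mul, Module.End.mul_apply]
        nth_rewrite 1 [h1]
        rw [map_sum, Finset.sum_apply]
        refine Finset.sum_congr rfl fun K _ => ?_
        rw [← Module.End.mul_apply, ← map_mul, hv, map_mul, Module.End.mul_apply, hN]
      simp only [e1, tensorRep_tmul]
      simp only [map_sum, map_mul, Finset.sum_mul, Finset.mul_sum]
      rw [Finset.sum_comm]
      refine Finset.sum_congr rfl fun K _ => Finset.sum_congr rfl fun J _ => ?_
      rw [← mul_assoc a (s _), ha, ← map_mul, mul_comm (τ _), map_mul]
      simp only [mul_assoc]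
  | algebraMap c =>
    rw [Algebra.algebraMap_eq_smul_one, smul_mul_assoc, one_mul, map_smul, map_smul, tensorRep_one,
      smul_mul_assoc, one_mul]
  | add x y _ _ hx hy => rw [add_mul, map_add, hx, hy, map_add, add_mul]
  | mul x y _ _ hx hy => rw [mul_assoc, hx, hy, hx, mul_assoc]

lemma tensorRep_balance (hN : ∀ g φ, N (f g) φ = fun I => g * φ I) (g : M) :
    tensorRep s N (s g ⊗ₜ 1) = tensorRep s N (1 ⊗ₜ f g) := by
  refine LinearMap.ext fun φ => funext fun I => ?_
  rw [tensorRep_tmul, tensorRep_tmul, map_one]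
  refine Finset.sum_congr rfl fun J _ => ?_
  rw [hN]
  by_cases h : I = J
  · subst h; simp
  · simp [Pi.single_eq_of_ne h]

lemma map_eq_of_mkAlgHom_eq {S A : Type*} [Semiring S] [Algebra ℂ S] [Semiring A] [Algebra ℂ A]
    (Θ : S →ₐ[ℂ] A) {r : S → S → Prop} (hr : ∀ ⦃x y⦄, r x y → Θ x = Θ y) {x y : S}
    (h : RingQuot.mkAlgHom ℂ r x = RingQuot.mkAlgHom ℂ r y) : Θ x = Θ y := by
  have h2 := congrArg (RingQuot.liftAlgHom ℂ ⟨Θ, hr⟩) h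
  rwa [RingQuot.liftAlgHom_mkAlgHom_apply, RingQuot.liftAlgHom_mkAlgHom_apply] at h2

/-- If `v_J` acts on the basis vector `b` with `I`-th coefficient `δ_IJ`, then the `I`-th
coefficient of `∑_J a_J ⊗ v_J` is `a_I`. -/
lemma tensorRep_sum_apply {b : κ} {V : κ → Λ} {I : κ}
    (hV : ∀ J, N (V J) (Pi.single b 1) I = if J = I then 1 else 0) (a : κ → F) :
    tensorRep s N (∑ J, a J ⊗ₜ V J) (Pi.single b 1) I = a I := by
  rw [map_sum, LinearMap.sum_apply, Finset.sum_apply, Finset.sum_eq_single I]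
  · rw [tensorRep_tmul, Finset.sum_eq_single b]
    · simp [hV]
    · intro J _ hJ
      simp [Pi.single_eq_of_ne hJ]
    · simp
  · intro J _ hJ
    rw [tensorRep_tmul, Finset.sum_eq_single b]
    · simp [hV, hJ]
    · intro K _ hK
      simp [Pi.single_eq_of_ne hK]
    · simp
  · simp

/-- The map `tensorRep`, restricted to a matrix tensor product. -/
noncomputable def gradedRep (S : Subalgebra ℂ (F ⊗[ℂ] Λ))
    (hS : S ≤ Algebra.adjoin ℂ (matchedTensors s f))
    (hN : ∀ g φ, N (f g) φ = fun I => g * φ I) : S →ₐ[ℂ] Module.End ℂ (κ → F) :=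
  AlgHom.ofLinearMap ((tensorRep s N).comp S.val.toLinearMap) tensorRep_one
    fun x y => tensorRep_mul hN (hS x.2) y.1

/-- Coefficients with respect to elements `v_J` in a matrix tensor product are unique, provided that
some representation separates the elements `v_J`. The matrix tensor product is the quotient of an
algebra `S` of matched tensors; the map `proj` to this quotient is only known by its universal
property. -/
theorem coeff_eq_of_proj_eq {S : Subalgebra ℂ (F ⊗[ℂ] Λ)}
    (hS : S ≤ Algebra.adjoin ℂ (matchedTensors s f)) {proj : S → T}
    (hproj : ∀ Θ : S →ₐ[ℂ] Module.End ℂ (κ → F),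
      (∀ g (h₁ : s g ⊗ₜ[ℂ] (1 : Λ) ∈ S) (h₂ : (1 : F) ⊗ₜ[ℂ] f g ∈ S), Θ ⟨_, h₁⟩ = Θ ⟨_, h₂⟩) →
      ∀ x y, proj x = proj y → Θ x = Θ y)
    (hN : ∀ g φ, N (f g) φ = fun I => g * φ I) {b : κ} {V : κ → Λ} {I : κ}
    (hV : ∀ J, N (V J) (Pi.single b 1) I = if J = I then 1 else 0) {a a' : κ → F}
    (h₁ : ∑ J, a J ⊗ₜ[ℂ] V J ∈ S) (h₂ : ∑ J, a' J ⊗ₜ[ℂ] V J ∈ S)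
    (h : proj ⟨_, h₁⟩ = proj ⟨_, h₂⟩) : a I = a' I := by
  have key : tensorRep s N (∑ J, a J ⊗ₜ[ℂ] V J) = tensorRep s N (∑ J, a' J ⊗ₜ[ℂ] V J) :=
    hproj (gradedRep S hS hN) (fun g _ _ => tensorRep_balance hN g) _ _ h
  rw [← tensorRep_sum_apply (s := s) hV a, ← tensorRep_sum_apply (s := s) hV a', key]

end Coefficients

/-! ### Translations and degrees -/

lemma Mero.shift_shift {W : Type*} [NormedAddCommGroup W] [NormedSpace ℂ W] (a b : W) (f : Mero W) :
    Mero.shift a (Mero.shift b f) = Mero.shift (a + b) f := by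
  obtain ⟨g, rfl⟩ := Ideal.Quotient.mk_surjective f
  change Ideal.Quotient.mk _ (meroFunShift a (meroFunShift b g)) =
    Ideal.Quotient.mk _ (meroFunShift (a + b) g)
  congr 1
  refine Subtype.ext (funext fun x => ?_)
  change g.1 (x + a + b) = g.1 (x + (a + b))
  rw [add_assoc]

lemma Mero.shift_zero {W : Type*} [NormedAddCommGroup W] [NormedSpace ℂ W] (f : Mero W) :
    Mero.shift 0 f = f := by
  obtain ⟨g, rfl⟩ := Ideal.Quotient.mk_surjective f
  change Ideal.Quotient.mk _ (meroFunShift 0 g) = _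
  congr 1
  refine Subtype.ext (funext fun x => ?_)
  change g.1 (x + 0) = g.1 x
  rw [add_zero]

lemma Mero.shift_neg_zero {W : Type*} [NormedAddCommGroup W] [NormedSpace ℂ W] (f : Mero W) :
    Mero.shift (-0) f = f := by
  rw [neg_zero, Mero.shift_zero]

lemma Mero.shift_neg_shift {W : Type*} [NormedAddCommGroup W] [NormedSpace ℂ W] (a : W)
    (f : Mero W) : Mero.shift (-a) (Mero.shift a f) = f := by
  rw [Mero.shift_shift, neg_add_cancel, Mero.shift_zero]

lemma Mero.shift_shift_neg {W : Type*} [NormedAddCommGroup W] [NormedSpace ℂ W] (a : W)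
    (f : Mero W) : Mero.shift a (Mero.shift (-a) f) = f := by
  rw [Mero.shift_shift, add_neg_cancel, Mero.shift_zero]

lemma Mero.shift_neg_shift_neg {W : Type*} [NormedAddCommGroup W] [NormedSpace ℂ W] (a b : W)
    (f : Mero W) : Mero.shift (-a) (Mero.shift (-b) f) = Mero.shift (-(a + b)) f := by
  rw [Mero.shift_shift, neg_add]

lemma Mero.shift_comm {W : Type*} [NormedAddCommGroup W] [NormedSpace ℂ W] (a b : W)
    (f : Mero W) : Mero.shift a (Mero.shift b f) = Mero.shift b (Mero.shift a f) := by
  rw [Mero.shift_shift, Mero.shift_shift, add_comm]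

/-- Algebra homomorphisms from `MF n` to a quotient ring are functions. This special case of the
general instance shortens instance search considerably. -/
noncomputable instance MF.coeFunRingQuot {n : ℕ} {A : Type*} [Ring A] [Algebra ℂ A]
    {rel : A → A → Prop} : CoeFun (MF n →ₐ[ℂ] RingQuot rel) fun _ => MF n → RingQuot rel :=
  ⟨fun f => f⟩

/-- Algebra endomorphisms of `MF n` are functions. This special case of the general instance
shortens instance search considerably. -/
noncomputable instance MF.coeFunEnd {n : ℕ} : CoeFun (MF n →ₐ[ℂ] MF n) fun _ => MF n → MF n :=
  ⟨fun f => f⟩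

/-- The translation by `-ω(i)`. -/
noncomputable def wtShift {n : ℕ} (i : Fin n) : MF n →ₐ[ℂ] MF n := Mero.shift (-wt i)

lemma wtShift_shift {n : ℕ} (i : Fin n) (f : MF n) :
    wtShift i (Mero.shift (wt i) f) = f :=
  Mero.shift_neg_shift _ f

lemma shift_wtShift {n : ℕ} (i : Fin n) (f : MF n) :
    Mero.shift (wt i) (wtShift i f) = f :=
  Mero.shift_shift_neg _ f

lemma wtShift_comm {n : ℕ} (i j : Fin n) (f : MF n) :
    wtShift i (wtShift j f) = wtShift j (wtShift i f) :=
  Mero.shift_comm _ _ f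

lemma wtShift_eq_self {n : ℕ} {i : Fin n} {f : MF n} (h : Mero.shift (wt i) f = f) :
    wtShift i f = f := by
  conv_lhs => rw [← h]
  exact wtShift_shift i f

variable (P : EllParams) {n : ℕ}

namespace FEll

/-- The left moment map as an algebra homomorphism. -/
noncomputable def lHom : MF n →ₐ[ℂ] FEll P n where
  toFun := l P
  map_one' := by simpa using l_scalar P (n := n) 1
  map_mul' := l_mul P
  map_zero' := l_zero P
  map_add' := l_add P
  commutes' := l_scalar P

/-- The right moment map as an algebra homomorphism. -/
noncomputable def rHom : MF n →ₐ[ℂ] FEll P n where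
  toFun := r P
  map_one' := by simpa using r_scalar P (n := n) 1
  map_mul' := r_mul P
  map_zero' := r_zero P
  map_add' := r_add P
  commutes' := r_scalar P

lemma l_r (f g : MF n) : l P f * r P g = r P g * l P f := by
  simp only [l, r, ← map_mul, RingQuot.mkAlgHom_rel ℂ (FRel.l_r f g)]

lemma e_l (f : MF n) (i j : Fin n) (z : ℂˣ) :
    e P i j z * l P f = l P (wtShift i f) * e P i j z := by
  rw [l_e, shift_wtShift]

lemma e_r (f : MF n) (i j : Fin n) (z : ℂˣ) :
    e P i j z * r P f = r P (wtShift j f) * e P i j z := by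
  rw [r_e, shift_wtShift]

lemma IsMonomial.mul_r {α β : CartanDual n} {a : FEll P n} (ha : IsMonomial P a α β) (g : MF n) :
    a * r P g = r P (Mero.shift (-β) g) * a := by
  induction ha with
  | one => rw [Mero.shift_neg_zero, one_mul, mul_one]
  | l_mul f _ ih => rw [mul_assoc, ih, ← mul_assoc, l_r, mul_assoc]
  | r_mul f _ ih => rw [mul_assoc, ih, ← mul_assoc, ← FEll.r_mul, mul_comm f, FEll.r_mul, mul_assoc]
  | e_mul i j z _ ih =>
    rw [mul_assoc, ih, ← mul_assoc, e_r, wtShift, Mero.shift_neg_shift_neg, mul_assoc]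

lemma IsMonomial.mul_l {α β : CartanDual n} {a : FEll P n} (ha : IsMonomial P a α β) (g : MF n) :
    a * l P g = l P (Mero.shift (-α) g) * a := by
  induction ha with
  | one => rw [Mero.shift_neg_zero, one_mul, mul_one]
  | r_mul f _ ih => rw [mul_assoc, ih, ← mul_assoc, ← l_r, mul_assoc]
  | l_mul f _ ih => rw [mul_assoc, ih, ← mul_assoc, ← FEll.l_mul, mul_comm f, FEll.l_mul, mul_assoc]
  | e_mul i j z _ ih =>
    rw [mul_assoc, ih, ← mul_assoc, e_l, wtShift, Mero.shift_neg_shift_neg, mul_assoc]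

lemma mul_r_of_mem {α β : CartanDual n} {a : FEll P n} (ha : a ∈ component P α β) (g : MF n) :
    a * r P g = r P (Mero.shift (-β) g) * a := by
  induction ha using Submodule.span_induction with
  | mem a ha => exact IsMonomial.mul_r P ha g
  | zero => rw [zero_mul, mul_zero]
  | add a b _ _ ha hb => rw [add_mul, mul_add, ha, hb]
  | smul c a _ ha => rw [smul_mul_assoc, ha, mul_smul_comm]

lemma mul_l_of_mem {α β : CartanDual n} {a : FEll P n} (ha : a ∈ component P α β) (g : MF n) :
    a * l P g = l P (Mero.shift (-α) g) * a := by
  induction ha using Submodule.span_induction with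
  | mem a ha => exact IsMonomial.mul_l P ha g
  | zero => rw [zero_mul, mul_zero]
  | add a b _ _ ha hb => rw [add_mul, mul_add, ha, hb]
  | smul c a _ ha => rw [smul_mul_assoc, ha, mul_smul_comm]

end FEll

namespace LeftExt

/-- The map `g ↦ g(ζ)` as an algebra homomorphism. -/
noncomputable def fHom : MF n →ₐ[ℂ] LeftExt P n where
  toFun := f P
  map_one' := f_one P
  map_mul' := f_mul P
  map_zero' := f_zero P
  map_add' := f_add P
  commutes' := f_scalar P

lemma v_f (g : MF n) (i : Fin n) (z : ℂˣ) :
    v P i z * f P g = f P (wtShift i g) * v P i z := by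
  have h : f P (wtShift i g) * v P i z = v P i z * f P (Mero.shift (wt i) (wtShift i g)) := by
    simp only [f, v, ← map_mul, RingQuot.mkAlgHom_rel ℂ (LeftExtRel.f_v (wtShift i g) i z)]
  rw [h, shift_wtShift]

lemma IsMonomial.mul_f {α : CartanDual n} {a : LeftExt P n} (ha : IsMonomial P a α) (g : MF n) :
    a * f P g = f P (Mero.shift (-α) g) * a := by
  induction ha with
  | one => rw [Mero.shift_neg_zero, one_mul, mul_one]
  | f_mul h _ ih =>
    rw [mul_assoc, ih, ← mul_assoc, ← LeftExt.f_mul, mul_comm h, LeftExt.f_mul, mul_assoc]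
  | v_mul i z _ ih =>
    rw [mul_assoc, ih, ← mul_assoc, v_f, wtShift, Mero.shift_neg_shift_neg, mul_assoc]

lemma mul_f_of_mem {α : CartanDual n} {a : LeftExt P n} (ha : a ∈ component P α) (g : MF n) :
    a * f P g = f P (Mero.shift (-α) g) * a := by
  induction ha using Submodule.span_induction with
  | mem a ha => exact IsMonomial.mul_f P ha g
  | zero => rw [zero_mul, mul_zero]
  | add a b _ _ ha hb => rw [add_mul, mul_add, ha, hb]
  | smul c a _ ha => rw [smul_mul_assoc, ha, mul_smul_comm]

end LeftExt

namespace RightExt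

lemma f_add (g h : MF n) : f P (g + h) = f P g + f P h := by
  simp only [f, RingQuot.mkAlgHom_rel ℂ (RightExtRel.add g h), map_add]

lemma f_mul (g h : MF n) : f P (g * h) = f P g * f P h := by
  simp only [f, RingQuot.mkAlgHom_rel ℂ (RightExtRel.mul g h), map_mul]

/-- The map `g ↦ g(ζ)` as an algebra homomorphism. -/
noncomputable def fHom : MF n →ₐ[ℂ] RightExt P n where
  toFun := f P
  map_one' := by simpa using f_scalar P (n := n) 1
  map_mul' := f_mul P
  map_zero' := f_zero P
  map_add' := f_add P
  commutes' := f_scalar P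

lemma w_f (g : MF n) (i : Fin n) (z : ℂˣ) :
    w P i z * f P g = f P (wtShift i g) * w P i z := by
  have h : f P (wtShift i g) * w P i z = w P i z * f P (Mero.shift (wt i) (wtShift i g)) := by
    simp only [f, w, ← map_mul, RingQuot.mkAlgHom_rel ℂ (RightExtRel.f_w (wtShift i g) i z)]
  rw [h, shift_wtShift]

lemma IsMonomial.mul_f {α : CartanDual n} {a : RightExt P n} (ha : IsMonomial P a α) (g : MF n) :
    a * f P g = f P (Mero.shift (-α) g) * a := by
  induction ha with
  | one => rw [Mero.shift_neg_zero, one_mul, mul_one]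
  | f_mul h _ ih =>
    rw [mul_assoc, ih, ← mul_assoc, ← RightExt.f_mul, mul_comm h, RightExt.f_mul, mul_assoc]
  | w_mul i z _ ih =>
    rw [mul_assoc, ih, ← mul_assoc, w_f, wtShift, Mero.shift_neg_shift_neg, mul_assoc]

lemma mul_f_of_mem {α : CartanDual n} {a : RightExt P n} (ha : a ∈ component P α) (g : MF n) :
    a * f P g = f P (Mero.shift (-α) g) * a := by
  induction ha using Submodule.span_induction with
  | mem a ha => exact IsMonomial.mul_f P ha g
  | zero => rw [zero_mul, mul_zero]
  | add a b _ _ ha hb => rw [add_mul, mul_add, ha, hb]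
  | smul c a _ ha => rw [smul_mul_assoc, ha, mul_smul_comm]

end RightExt

lemma leftGraded_le_adjoin :
    leftGraded P n ≤ Algebra.adjoin ℂ (matchedTensors (M := MF n) (FEll.rHom P (n := n))
      (LeftExt.fHom P (n := n))) := by
  refine Algebra.adjoin_mono ?_
  rintro t ⟨α, β, a, ha, v, hv, rfl⟩
  exact ⟨a, v, Mero.shift (-β), FEll.mul_r_of_mem P ha, LeftExt.mul_f_of_mem P hv, rfl⟩

/-- The subalgebra `⨁ Λ'_α ⊗ F_{αβ}` with exchanged tensor factors. -/
noncomputable def swappedRightGraded (n : ℕ) : Subalgebra ℂ (FEll P n ⊗[ℂ] RightExt P n) :=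
  (rightGraded P n).comap (Algebra.TensorProduct.comm ℂ (FEll P n) (RightExt P n)).toAlgHom

lemma comm_mem_swappedRightGraded {x : RightExt P n ⊗[ℂ] FEll P n} (hx : x ∈ rightGraded P n) :
    Algebra.TensorProduct.comm ℂ (RightExt P n) (FEll P n) x ∈ swappedRightGraded P n := by
  change (Algebra.TensorProduct.comm ℂ (FEll P n) (RightExt P n))
    ((Algebra.TensorProduct.comm ℂ (RightExt P n) (FEll P n)) x) ∈ rightGraded P n
  rwa [show (Algebra.TensorProduct.comm ℂ (FEll P n) (RightExt P n))
      ((Algebra.TensorProduct.comm ℂ (RightExt P n) (FEll P n)) x) = x from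
    (Algebra.TensorProduct.comm ℂ (RightExt P n) (FEll P n)).symm_apply_apply x]

lemma swappedRightGraded_le_adjoin :
    swappedRightGraded P n ≤ Algebra.adjoin ℂ (matchedTensors (M := MF n) (FEll.lHom P (n := n))
      (RightExt.fHom P (n := n))) := by
  intro x hx
  have h : rightGraded P n ≤
      (Algebra.adjoin ℂ (matchedTensors (M := MF n) (FEll.lHom P (n := n))
        (RightExt.fHom P (n := n)))).comap
        (Algebra.TensorProduct.comm ℂ (RightExt P n) (FEll P n)).toAlgHom := by
    refine Algebra.adjoin_le ?_
    rintro t ⟨α, β, v, hv, a, ha, rfl⟩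
    exact Algebra.subset_adjoin
      ⟨a, v, Mero.shift (-α), FEll.mul_l_of_mem P ha, RightExt.mul_f_of_mem P hv, rfl⟩
  have h1 := h hx
  have h2 : (Algebra.TensorProduct.comm ℂ (RightExt P n) (FEll P n))
      ((Algebra.TensorProduct.comm ℂ (FEll P n) (RightExt P n)) x) = x :=
    (Algebra.TensorProduct.comm ℂ (FEll P n) (RightExt P n)).symm_apply_apply x
  rw [← h2]
  exact h1

/-! ### The exchange relations of the elliptic exterior algebras -/

namespace EllParams

lemma wtShift_EM {i j k : Fin n} (hi : k ≠ i) (hj : k ≠ j) (c : ℂ) :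
    wtShift k (P.EM i j c) = P.EM i j c := wtShift_eq_self (P.shift_EM hi hj c)

lemma wtShift_EMInv {i j k : Fin n} (hi : k ≠ i) (hj : k ≠ j) (c : ℂ) :
    wtShift k (P.EMInv i j c) = P.EMInv i j c := wtShift_eq_self (P.shift_EMInv hi hj c)

lemma not_isPole_qU_sq : ¬ P.IsPole (P.qU ^ 2) := by
  rintro ⟨k, hk⟩
  have h1 : P.pU ^ k * P.qU ^ (-4 : ℤ) = 1 := by
    have h2 : P.qU ^ (-4 : ℤ) = P.qU ^ (-2 : ℤ) * (P.qU ^ 2)⁻¹ := by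
      rw [← zpow_natCast, ← zpow_neg, ← zpow_add]; rfl
    rw [h2, ← mul_assoc, ← hk, mul_inv_cancel]
  have h3 := congrArg Units.val h1
  rw [Units.val_mul, Units.val_zpow_eq_zpow_val, Units.val_zpow_eq_zpow_val] at h3
  have h4 : P.p ^ k * P.q ^ (-4 : ℤ) = 1 := by
    have : (P.p : ℂ) ^ k * (P.q : ℂ) ^ (-4 : ℤ) = 1 := h3
    exact_mod_cast this
  have := (P.generic _ _ h4).2
  omega

lemma algebraMap_kappa_inv_mul_self :
    algebraMap ℂ (MF n) P.kappa⁻¹ * algebraMap ℂ (MF n) P.kappa = 1 := by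
  rw [← map_mul, inv_mul_cancel₀ P.kappa_ne_zero, map_one]

lemma mul_mul_mul_cancel_of_inv {M : Type*} [CommRing M] {k k' a b c : M} (hk : k' * k = 1)
    (ha : a * b = 1) : k' * a * (k * (c * b)) = c := by
  linear_combination c * a * b * hk + c * ha

/-- The cleared form of `α(ζ_ij, q^2)`. -/
lemma mul_alphaM_qU_sq {i j : Fin n} (h : i ≠ j) :
    algebraMap ℂ (MF n) P.kappa⁻¹ * P.EM i j 0 * P.alphaM i j (P.qU ^ 2) = P.EM i j 1 := by
  rw [alphaM_qU_sq]
  exact mul_mul_mul_cancel_of_inv (M := MF n) (P.algebraMap_kappa_inv_mul_self (n := n))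
    (P.EM_mul_EMInv h 0)

/-- The cleared form of `β(ζ_ij, q^2)`. -/
lemma mul_betaM_qU_sq {i j : Fin n} (h : i ≠ j) :
    algebraMap ℂ (MF n) P.kappa⁻¹ * P.EM i j 0 * P.betaM i j (P.qU ^ 2) = P.EM i j (-1) := by
  rw [betaM_qU_sq]
  exact mul_mul_mul_cancel_of_inv (M := MF n) (P.algebraMap_kappa_inv_mul_self (n := n))
    (P.EM_mul_EMInv h 0)

lemma mul_mul_mul_mul_cancel_of_inv {M : Type*} [CommRing M] {k k' a b c c' x : M}
    (hk : k' * k = 1) (ha : a * b = 1) (hc : c * c' = 1) :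
    x * c' * (k' * a) * (k * (c * b)) = x := by
  linear_combination x * a * b * c * c' * hk + x * c * c' * ha + x * hc

lemma EMInv_mul_EM {i j : Fin n} (h : i ≠ j) (c : ℂ) : P.EMInv i j c * P.EM i j c = 1 := by
  rw [mul_comm (P.EMInv i j c), P.EM_mul_EMInv h c]

lemma EMInv_swap (i j : Fin n) : P.EMInv j i 0 = -P.EMInv i j 0 := by
  have h := P.EMInv_neg i j 0
  rwa [neg_zero] at h

/-- The coefficient `α(ζ_ij, q^2)` is invertible. -/
lemma mul_alphaM_qU_sq' {i j : Fin n} (h : i ≠ j) :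
    P.EMInv i j 0 * P.EMInv i j 1 * (algebraMap ℂ (MF n) P.kappa⁻¹ * P.EM i j 0) *
      P.alphaM i j (P.qU ^ 2) = P.EMInv i j 0 := by
  rw [alphaM_qU_sq]
  exact mul_mul_mul_mul_cancel_of_inv (M := MF n) (P.algebraMap_kappa_inv_mul_self (n := n))
    (P.EM_mul_EMInv h 0) (P.EM_mul_EMInv h 1)

lemma betaM_qU_sq_swap (i j : Fin n) : P.betaM j i (P.qU ^ 2) = P.alphaM i j (P.qU ^ 2) := by
  rw [alphaM_qU_sq, betaM_qU_sq, EM_neg, EMInv_swap]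
  exact congrArg _ (neg_mul_neg (P.EM i j 1) (P.EMInv i j 0))

lemma mul_betaM_qU_sq' {i j : Fin n} (h : i ≠ j) :
    P.EMInv j i 0 * P.EMInv j i 1 * (algebraMap ℂ (MF n) P.kappa⁻¹ * P.EM j i 0) *
      P.betaM i j (P.qU ^ 2) = -P.EMInv i j 0 := by
  rw [betaM_qU_sq_swap, mul_alphaM_qU_sq' P h.symm, EMInv_swap]

lemma qU_pow_div (z : ℂˣ) (m : ℕ) :
    P.qU ^ (2 * (m + 1)) * z / (P.qU ^ (2 * m) * z) = P.qU ^ 2 := by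
  rw [mul_div_mul_right_eq_div, mul_add, pow_add, mul_one, mul_div_cancel_left]

lemma qU_zpow_div (z : ℂˣ) (d m : ℕ) :
    P.qU ^ (2 * ((d : ℤ) - 1 - m)) * z / (P.qU ^ (2 * ((d : ℤ) - 1 - (m + 1 : ℕ))) * z) =
      P.qU ^ 2 := by
  rw [mul_div_mul_right_eq_div, div_eq_mul_inv, ← zpow_neg, ← zpow_add, ← zpow_natCast]
  congr 1
  push_cast
  ring

end EllParams

lemma eq_of_mul_add_mul_eq_zero {Λ : Type*} [Ring Λ] {a b a' b' k x y x' y' : Λ}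
    (h : a * x * y + b * x' * y' = 0) (ha : k * a = a') (hb : k * b = -b') :
    a' * (x * y) = b' * (x' * y') := by
  have h2 := congrArg (k * ·) h
  simp only [mul_add, mul_zero, ← mul_assoc, ha, hb, neg_mul] at h2
  rw [← sub_eq_add_neg, sub_eq_zero] at h2
  simpa only [mul_assoc] using h2

lemma LeftExt.f_neg (g : MF n) : LeftExt.f P (-g) = -LeftExt.f P g := map_neg (LeftExt.fHom P) g

lemma RightExt.f_neg (g : MF n) : RightExt.f P (-g) = -RightExt.f P g :=
  map_neg (RightExt.fHom P) g

lemma LeftExt.exchange {i j : Fin n} (hij : i ≠ j) {y y' : ℂˣ} (hy : y' / y = P.qU ^ 2) :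
    LeftExt.f P (P.EM i j 1) * (LeftExt.v P i y' * LeftExt.v P j y) =
      LeftExt.f P (P.EM j i 1) * (LeftExt.v P j y' * LeftExt.v P i y) := by
  have h := RingQuot.mkAlgHom_rel ℂ (LeftExtRel.wedge (P := P) i j hij y' y
    (by rw [hy]; exact P.not_isPole_qU_sq))
  rw [hy] at h
  simp only [map_mul, map_add, map_zero] at h
  have h' : LeftExt.f P (P.alphaM i j (P.qU ^ 2)) * LeftExt.v P i y' * LeftExt.v P j y +
      LeftExt.f P (P.betaM i j (P.qU ^ 2)) * LeftExt.v P j y' * LeftExt.v P i y = 0 := h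
  refine eq_of_mul_add_mul_eq_zero (k := LeftExt.f P _) h'
    (by rw [← LeftExt.f_mul]; exact congrArg _ (P.mul_alphaM_qU_sq hij)) ?_
  rw [← LeftExt.f_mul, ← LeftExt.f_neg]
  exact congrArg _ ((P.mul_betaM_qU_sq hij).trans (P.EM_neg j i 1))

lemma RightExt.exchange {i j : Fin n} (hij : i ≠ j) {y y' : ℂˣ} (hy : y / y' = P.qU ^ 2) :
    RightExt.f P (P.EMInv j i 0) * (RightExt.w P i y' * RightExt.w P j y) =
      RightExt.f P (P.EMInv i j 0) * (RightExt.w P j y' * RightExt.w P i y) := by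
  have h := RingQuot.mkAlgHom_rel ℂ (RightExtRel.wedge (P := P) j i hij.symm y y'
    (by rw [hy]; exact P.not_isPole_qU_sq))
  rw [hy] at h
  simp only [map_mul, map_add, map_zero] at h
  have h' : RightExt.f P (P.alphaM j i (P.qU ^ 2)) * RightExt.w P i y' * RightExt.w P j y +
      RightExt.f P (P.betaM i j (P.qU ^ 2)) * RightExt.w P j y' * RightExt.w P i y = 0 := h
  refine eq_of_mul_add_mul_eq_zero (k := RightExt.f P _) h'
    (by rw [← RightExt.f_mul]; exact congrArg _ (P.mul_alphaM_qU_sq' hij.symm)) ?_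
  rw [← RightExt.f_mul, ← RightExt.f_neg]
  exact congrArg _ (P.mul_betaM_qU_sq' hij)

/-- The exchange data of the left elliptic exterior algebra with parameters `y_m = q^(2m) z`. -/
noncomputable def leftExchange (z : ℂˣ) : ExchangeData (Fin n) (MF n) (LeftExt P n) where
  f := LeftExt.fHom P
  v i m := LeftExt.v P i (P.qU ^ (2 * m) * z)
  σ := wtShift
  c i k := P.EM k i 1
  ci i k := P.EMInv k i 1
  v_f i _ g := LeftExt.v_f P g i _
  c_ci h := P.EM_mul_EMInv h.symm 1
  σ_ci hi hj := P.wtShift_EMInv hj hi 1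
  v_v i _ := LeftExt.v_v P i _ _
  exchange m hij := LeftExt.exchange P hij (P.qU_pow_div z m)

/-- The exchange data of the right elliptic exterior algebra with parameters
`y_m = q^(2(d-1-m)) z`. -/
noncomputable def rightExchange (d : ℕ) (z : ℂˣ) :
    ExchangeData (Fin n) (MF n) (RightExt P n) where
  f := RightExt.fHom P
  v i m := RightExt.w P i (P.qU ^ (2 * ((d : ℤ) - 1 - m)) * z)
  σ := wtShift
  c i k := P.EMInv i k 0
  ci i k := P.EM i k 0
  v_f i _ g := RightExt.w_f P g i _
  c_ci h := P.EMInv_mul_EM h 0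
  σ_ci hi hj := P.wtShift_EM hi hj 0
  v_v i _ := RightExt.w_w P i _ _
  exchange m hij := RightExt.exchange P hij (P.qU_zpow_div z d m)

/-! ### Representations of the elliptic exterior algebras -/

section Rep

lemma mul_add_neg_mul_eq_zero {A : Type*} [Ring A] {a b x y x' y' : A}
    (h : a * (x * y) = b * (x' * y')) (u : A) : u * a * x * y + -(u * b) * x' * y' = 0 := by
  rw [neg_mul, neg_mul, mul_assoc, mul_assoc u, h]
  simp only [mul_assoc, add_neg_cancel]

/-- The algebra of `ℂ`-linear endomorphisms of `M^{subsets of ι}`. -/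
abbrev SubsetEnd (ι M : Type*) [CommRing M] [Algebra ℂ M] : Type _ :=
  Module.End ℂ (Finset ι → M)

variable {ι M : Type*} [CommRing M] [Algebra ℂ M] {c : ι → ι → M} {σ : ι → M →ₐ[ℂ] M}

lemma mulOp_mul (g h : M) : mulOp (ι := ι) (g * h) = mulOp g * mulOp h := by
  ext φ I
  simp only [Module.End.mul_apply, mulOp_apply, mul_assoc]

lemma mulOp_add (g h : M) : mulOp (ι := ι) (g + h) = mulOp g + mulOp h := by
  ext φ I
  simp only [LinearMap.add_apply, Pi.add_apply, mulOp_apply, add_mul]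

lemma mulOp_algebraMap (a : ℂ) :
    mulOp (ι := ι) (algebraMap ℂ M a) = algebraMap ℂ (Module.End ℂ (Finset ι → M)) a := by
  ext φ I
  simp [mulOp_apply, Module.algebraMap_end_apply, Algebra.smul_def]

/-- The operators `mulOp` as an algebra homomorphism. -/
def mulHom : M →ₐ[ℂ] SubsetEnd ι M where
  toFun := mulOp
  map_one' := by ext φ I; simp [mulOp_apply]
  map_mul' := mulOp_mul
  map_zero' := by ext φ I; simp [mulOp_apply]
  map_add' := mulOp_add
  commutes' := mulOp_algebraMap

variable [DecidableEq ι]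

lemma mulHom_mul_raiseOp {i : ι} {A : Set ℕ} {g g' : M} (h : σ i g' = g) :
    mulHom g * raiseOp c σ i A = raiseOp c σ i A * mulHom g' := by
  rw [← h]
  exact (raiseOp_mulOp i A g').symm

/-- The operators `raiseOp` for the sets of positions of two parameters satisfy a quadratic
relation: if the parameters are not adjacent in the sequence `y`, the products vanish, and otherwise
they satisfy the exchange relation. -/
lemma raiseOp_wedge {Y : Type*} (y : ℕ → Y) (hσ : ∀ i j g, σ i (σ j g) = σ j (σ i g))
    (hc : ∀ {i j k}, k ≠ i → k ≠ j → σ k (c i j) = c i j) {i j : ι} (hij : i ≠ j) {z w : Y}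
    {a b : M} (h : ∀ m, w = y m → z = y (m + 1) → ∃ u, a = u * c j i ∧ b = -(u * c i j)) :
    mulHom a * raiseOp c σ i {m | z = y m} * raiseOp c σ j {m | w = y m} +
      mulHom b * raiseOp c σ j {m | z = y m} * raiseOp c σ i {m | w = y m} = 0 := by
  by_cases hm : ∃ m, w = y m ∧ z = y (m + 1)
  · obtain ⟨m, hw, hz⟩ := hm
    obtain ⟨u, rfl, rfl⟩ := h m hw hz
    rw [map_neg, map_mul, map_mul]
    exact mul_add_neg_mul_eq_zero (a := mulHom (c j i)) (b := mulHom (c i j))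
      (raiseOp_exchange hσ hc hij _ _) _
  · have h0 : ∀ m ∈ {m | w = y m}, m + 1 ∉ {m | z = y m} := fun m h1 h2 => hm ⟨m, h1, h2⟩
    rw [mul_assoc, mul_assoc, raiseOp_raiseOp_eq_zero i j h0, raiseOp_raiseOp_eq_zero j i h0,
      mul_zero, mul_zero, add_zero]

end Rep

lemma EllParams.alphaM_betaM_left {i j : Fin n} : ∃ u, P.alphaM i j (P.qU ^ 2) = u * P.EM i j 1 ∧
    P.betaM i j (P.qU ^ 2) = -(u * P.EM j i 1) := by
  have key : ∀ {M : Type} [CommRing M] (k a a' b : M), k * (a * b) = k * b * a ∧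
      k * (-a' * b) = -(k * b * a') := fun k a a' b => ⟨by ring, by ring⟩
  refine ⟨algebraMap ℂ (MF n) P.kappa * P.EMInv i j 0, ?_⟩
  rw [alphaM_qU_sq, betaM_qU_sq, P.EM_neg j i 1]
  exact key (M := MF n) _ _ _ _

lemma EllParams.alphaM_betaM_right {i j : Fin n} :
    ∃ u, P.alphaM j i (P.qU ^ 2) = u * P.EMInv j i 0 ∧
      P.betaM i j (P.qU ^ 2) = -(u * P.EMInv i j 0) := by
  have key : ∀ {M : Type} [CommRing M] (k a b b' : M), b = -b' → k * (a * b) = k * a * b ∧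
      k * (a * b) = -(k * a * b') := fun k a b b' h => ⟨by ring, by rw [h]; ring⟩
  refine ⟨algebraMap ℂ (MF n) P.kappa * P.EM j i 1, ?_⟩
  rw [betaM_qU_sq_swap, alphaM_qU_sq]
  exact key (M := MF n) _ _ _ _ (P.EMInv_swap i j)

lemma EllParams.qU_sq_ne_pole {z w : ℂˣ} (h : P.IsPole (z / w)) : z / w ≠ P.qU ^ 2 := fun h' =>
  P.not_isPole_qU_sq (h' ▸ h)

section Lift

variable {A : Type*} [Ring A] [Algebra ℂ A]

/-- The universal property of `Λ`. -/
theorem LeftExt.exists_lift (μ : MF n →ₐ[ℂ] A) (ν : Fin n → ℂˣ → A)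
    (f_v : ∀ f i y, μ f * ν i y = ν i y * μ (Mero.shift (wt i) f))
    (v_v : ∀ i y y', ν i y * ν i y' = 0)
    (wedge : ∀ k j, k ≠ j → ∀ y y' : ℂˣ, ¬ P.IsPole (y / y') →
      μ (P.alphaM k j (y / y')) * ν k y * ν j y' + μ (P.betaM k j (y / y')) * ν j y * ν k y' = 0)
    (pole : ∀ k j, ∀ y y' : ℂˣ, P.IsPole (y / y') → ν k y * ν j y' = 0) :
    ∃ N : LeftExt P n →ₐ[ℂ] A, (∀ g, N (LeftExt.f P g) = μ g) ∧
      ∀ i y, N (LeftExt.v P i y) = ν i y := by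
  let G : ExtGen n → A := fun x => match x with
    | .f g => μ g
    | .v i y => ν i y
  have hG : ∀ ⦃s t : FreeAlgebra ℂ (ExtGen n)⦄, LeftExtRel P n s t →
      FreeAlgebra.lift ℂ G s = FreeAlgebra.lift ℂ G t := by
    intro s t h
    induction h with
    | scalar c => simp only [FreeAlgebra.lift_ι_apply, AlgHom.commutes, G]
    | add f g => simp only [FreeAlgebra.lift_ι_apply, map_add, G]
    | mul f g => simp only [FreeAlgebra.lift_ι_apply, map_mul, G]
    | f_v f i y => simpa only [FreeAlgebra.lift_ι_apply, map_mul, G] using f_v f i y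
    | v_v i y y' =>
      simpa only [FreeAlgebra.lift_ι_apply, map_mul, map_zero, G] using v_v i y y'
    | wedge k j hkj y y' h =>
      simpa only [FreeAlgebra.lift_ι_apply, map_mul, map_add, map_zero, G] using
        wedge k j hkj y y' h
    | pole k j y y' h =>
      simpa only [FreeAlgebra.lift_ι_apply, map_mul, map_zero, G] using pole k j y y' h
  refine ⟨RingQuot.liftAlgHom ℂ ⟨FreeAlgebra.lift ℂ G, hG⟩, fun g => ?_, fun i y => ?_⟩
  · rw [LeftExt.f, RingQuot.liftAlgHom_mkAlgHom_apply, FreeAlgebra.lift_ι_apply]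
  · rw [LeftExt.v, RingQuot.liftAlgHom_mkAlgHom_apply, FreeAlgebra.lift_ι_apply]

/-- The universal property of `Λ'`. -/
theorem RightExt.exists_lift (μ : MF n →ₐ[ℂ] A) (ν : Fin n → ℂˣ → A)
    (f_w : ∀ f i y, μ f * ν i y = ν i y * μ (Mero.shift (wt i) f))
    (w_w : ∀ i y y', ν i y * ν i y' = 0)
    (wedge : ∀ k j, k ≠ j → ∀ y y' : ℂˣ, ¬ P.IsPole (y / y') →
      μ (P.alphaM k j (y / y')) * ν j y' * ν k y + μ (P.betaM j k (y / y')) * ν k y' * ν j y = 0)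
    (pole : ∀ k j, ∀ y y' : ℂˣ, P.IsPole (y / y') → ν j y' * ν k y = 0) :
    ∃ N : RightExt P n →ₐ[ℂ] A, (∀ g, N (RightExt.f P g) = μ g) ∧
      ∀ i y, N (RightExt.w P i y) = ν i y := by
  let G : ExtGen n → A := fun x => match x with
    | .f g => μ g
    | .v i y => ν i y
  have hG : ∀ ⦃s t : FreeAlgebra ℂ (ExtGen n)⦄, RightExtRel P n s t →
      FreeAlgebra.lift ℂ G s = FreeAlgebra.lift ℂ G t := by
    intro s t h
    induction h with
    | scalar c => simp only [FreeAlgebra.lift_ι_apply, AlgHom.commutes, G]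
    | add f g => simp only [FreeAlgebra.lift_ι_apply, map_add, G]
    | mul f g => simp only [FreeAlgebra.lift_ι_apply, map_mul, G]
    | f_w f i y => simpa only [FreeAlgebra.lift_ι_apply, map_mul, G] using f_w f i y
    | w_w i y y' =>
      simpa only [FreeAlgebra.lift_ι_apply, map_mul, map_zero, G] using w_w i y y'
    | wedge k j hkj y y' h =>
      simpa only [FreeAlgebra.lift_ι_apply, map_mul, map_add, map_zero, G] using
        wedge k j hkj y y' h
    | pole k j y y' h =>
      simpa only [FreeAlgebra.lift_ι_apply, map_mul, map_zero, G] using pole k j y y' h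
  refine ⟨RingQuot.liftAlgHom ℂ ⟨FreeAlgebra.lift ℂ G, hG⟩, fun g => ?_, fun i y => ?_⟩
  · rw [RightExt.f, RingQuot.liftAlgHom_mkAlgHom_apply, FreeAlgebra.lift_ι_apply]
  · rw [RightExt.w, RingQuot.liftAlgHom_mkAlgHom_apply, FreeAlgebra.lift_ι_apply]

end Lift

/-- A representation of `Λ` on `M^{subsets}` in which `v_I(z)` sends the basis vector of the
empty set to the one of `I`. -/
theorem LeftExt.exists_rep (z : ℂˣ) : ∃ N : LeftExt P n →ₐ[ℂ] SubsetEnd (Fin n) (MF n),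
    (∀ g, N (LeftExt.f P g) = mulHom g) ∧ ∀ i y, N (LeftExt.v P i y) =
      raiseOp (fun i k => P.EM k i 1) (wtShift (n := n)) i {m | y = P.qU ^ (2 * m) * z} := by
  refine LeftExt.exists_lift P (A := SubsetEnd (Fin n) (MF n)) (mulHom (M := MF n))
    (fun i y => raiseOp (fun i k => P.EM k i 1) (wtShift (n := n)) i {m | y = P.qU ^ (2 * m) * z})
    (fun f i y => mulHom_mul_raiseOp (M := MF n) (wtShift_shift i f))
    (fun i y y' => raiseOp_raiseOp_self (M := MF n) i _ _) (fun k j hkj y y' h => ?_)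
    fun k j y y' h => ?_
  · refine raiseOp_wedge (M := MF n) (fun m => P.qU ^ (2 * m) * z) wtShift_comm
      (fun hi hj => P.wtShift_EM hj hi 1) hkj fun m hw hz => ?_
    rw [hw, hz, P.qU_pow_div]
    exact P.alphaM_betaM_left
  · refine raiseOp_raiseOp_eq_zero (M := MF n) k j fun m hw hz => P.qU_sq_ne_pole h ?_
    have hw' : y' = P.qU ^ (2 * m) * z := hw
    have hz' : y = P.qU ^ (2 * (m + 1)) * z := hz
    rw [hw', hz', P.qU_pow_div]

/-- A representation of `Λ'` on `M^{subsets}` in which `w^I(z)`, for sets `I` with `d` elements,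
sends the basis vector of the empty set to the one of `I`. -/
theorem RightExt.exists_rep (d : ℕ) (z : ℂˣ) :
    ∃ N : RightExt P n →ₐ[ℂ] SubsetEnd (Fin n) (MF n),
      (∀ g, N (RightExt.f P g) = mulHom g) ∧ ∀ i y, N (RightExt.w P i y) =
        raiseOp (fun i k => P.EMInv i k 0) (wtShift (n := n)) i
          {m : ℕ | y = P.qU ^ (2 * ((d : ℤ) - 1 - m)) * z} := by
  refine RightExt.exists_lift P (A := SubsetEnd (Fin n) (MF n)) (mulHom (M := MF n))
    (fun i y => raiseOp (fun i k => P.EMInv i k 0) (wtShift (n := n)) i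
      {m : ℕ | y = P.qU ^ (2 * ((d : ℤ) - 1 - m)) * z})
    (fun f i y => mulHom_mul_raiseOp (M := MF n) (wtShift_shift i f))
    (fun i y y' => raiseOp_raiseOp_self (M := MF n) i _ _) (fun k j hkj y y' h => ?_)
    fun k j y y' h => ?_
  · refine raiseOp_wedge (M := MF n) (fun m : ℕ => P.qU ^ (2 * ((d : ℤ) - 1 - m)) * z) wtShift_comm
      (fun hi hj => P.wtShift_EMInv hi hj 0) hkj.symm fun m hw hz => ?_
    rw [hw, hz, P.qU_zpow_div]
    exact P.alphaM_betaM_right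
  · refine raiseOp_raiseOp_eq_zero (M := MF n) j k fun m hw hz => P.qU_sq_ne_pole h ?_
    have hw' : y = P.qU ^ (2 * ((d : ℤ) - 1 - m)) * z := hw
    have hz' : y' = P.qU ^ (2 * ((d : ℤ) - 1 - (m + 1 : ℕ))) * z := hz
    rw [hw', hz', P.qU_zpow_div]

/-! ### The elements `v_I(z)` and `w^I(z)` -/

lemma LeftExt.word_append_singleton (t : List (Fin n)) (i : Fin n) (z : ℂˣ) :
    word P (t ++ [i]) z = v P i (P.qU ^ (2 * t.length) * z) * word P t z := by
  induction t generalizing z with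
  | nil => simp [word]
  | cons j t ih =>
    rw [List.cons_append, word, word, ih, List.length_cons, mul_add, pow_add, mul_assoc,
      mul_assoc, mul_one]

lemma leftExchange_rawWord (l : List (Fin n)) (z : ℂˣ) :
    (leftExchange P z).rawWord l = LeftExt.word P l.reverse z := by
  induction l with
  | nil => rfl
  | cons i t ih =>
    rw [ExchangeData.rawWord, ih, List.reverse_cons, LeftExt.word_append_singleton,
      List.length_reverse]
    rfl

lemma rightExchange_rawWord (d : ℕ) (l : List (Fin n)) (z : ℂˣ) :
    (rightExchange P d z).rawWord l =
      RightExt.word P l (P.qU ^ (2 * ((d : ℤ) - l.length)) * z) := by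
  induction l with
  | nil => rfl
  | cons i t ih =>
    rw [ExchangeData.rawWord, ih, RightExt.word, ← mul_assoc, ← zpow_natCast, ← zpow_add]
    have e1 : 2 * ((d : ℤ) - (i :: t).length) = 2 * ((d : ℤ) - 1 - t.length) := by
      rw [List.length_cons]; push_cast; ring
    have e2 : ((2 : ℕ) : ℤ) + 2 * ((d : ℤ) - 1 - t.length) = 2 * ((d : ℤ) - t.length) := by
      push_cast; ring
    rw [e1, e2]
    rfl

lemma leftExchange_setWord (I : Finset (Fin n)) (z : ℂˣ) :
    (leftExchange P z).setWord I = LeftExt.vI P I z := by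
  have hl : (I.sort.reverse).Nodup := List.nodup_reverse.mpr (Finset.sort_nodup _ _)
  have hI : I.sort.reverse.toFinset = I := by
    rw [List.toFinset_reverse, Finset.sort_toFinset]
  have h := (leftExchange P z).word_eq_setWord hl
  rw [hI] at h
  rw [← h, ExchangeData.word_eq_rawWord _ hl, leftExchange_rawWord, List.reverse_reverse,
    LeftExt.vI]
  congr 1
  refine congrArg (LeftExt.f P) ?_
  rw [← prod_prod_eq_pairProd (fun i j : Fin n => j < i) (fun i j h => h.asymm) _
    (List.pairwise_reverse.mpr (Finset.sortedLT_sort I).pairwise), hI,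
    EllParams.FlowInv]
  refine (Finset.prod_comm' ?_).trans rfl
  intro i j
  simp only [Finset.mem_filter]
  tauto

lemma rightExchange_setWord (I : Finset (Fin n)) (z : ℂˣ) :
    (rightExchange P I.card z).setWord I = RightExt.wI P I z := by
  have hl : I.sort.Nodup := Finset.sort_nodup _ _
  have h := (rightExchange P I.card z).word_eq_setWord hl
  rw [Finset.sort_toFinset] at h
  rw [← h, ExchangeData.word_eq_rawWord _ hl, rightExchange_rawWord, Finset.length_sort, sub_self,
    mul_zero, zpow_zero, one_mul, RightExt.wI]
  congr 1
  refine congrArg (RightExt.f P) ?_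
  rw [← prod_prod_eq_pairProd (fun i j : Fin n => i < j) (fun i j h => h.asymm) _
    (Finset.sortedLT_sort I).pairwise, Finset.sort_toFinset, EllParams.Fup]
  refine Finset.prod_congr rfl fun i _ => Finset.prod_congr rfl fun j _ => ?_
  change P.EM i j 0 = _
  rw [EllParams.EM, Mero.mk]
  congr 1
  exact Subtype.ext (funext fun ζ => congrArg P.E (add_zero _))

/-! ### Left and right minors -/

lemma leftCoaction_f (g : MF n) :
    leftCoaction P (LeftExt.f P g) = LeftTensor.mk P (LeftTensor.lElt P g) := by
  rw [leftCoaction, LeftExt.f, RingQuot.liftAlgHom_mkAlgHom_apply, FreeAlgebra.lift_ι_apply]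
  rfl

lemma leftCoaction_v (i : Fin n) (z : ℂˣ) :
    leftCoaction P (LeftExt.v P i z) = ∑ j, LeftTensor.mk P (LeftTensor.evElt P i j z) := by
  rw [leftCoaction, LeftExt.v, RingQuot.liftAlgHom_mkAlgHom_apply, FreeAlgebra.lift_ι_apply]
  rfl

lemma rightCoaction_f (g : MF n) :
    rightCoaction P (RightExt.f P g) = RightTensor.mk P (RightTensor.rElt P g) := by
  rw [rightCoaction, RightExt.f, RingQuot.liftAlgHom_mkAlgHom_apply, FreeAlgebra.lift_ι_apply]
  rfl

lemma rightCoaction_w (j : Fin n) (z : ℂˣ) :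
    rightCoaction P (RightExt.w P j z) = ∑ i, RightTensor.mk P (RightTensor.weElt P i j z) := by
  rw [rightCoaction, RightExt.w, RingQuot.liftAlgHom_mkAlgHom_apply, FreeAlgebra.lift_ι_apply]
  rfl

/-- The left coaction on words with parameters `y_m = q^(2m) z`. -/
noncomputable def leftCoactionData (z : ℂˣ) :
    CoactionData (leftExchange P (n := n) z) (FEll P n) (LeftTensor P n) where
  s := FEll.rHom P
  o := FEll.lHom P
  ε i j m := FEll.e P i j (P.qU ^ (2 * m) * z)
  S := leftGraded P n
  proj := LeftTensor.mk P
  Δ := leftCoaction P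
  s_mem g := (LeftTensor.rElt P g).2
  o_mem g := (LeftTensor.lElt P g).2
  f_mem g := (LeftTensor.fElt P g).2
  ε_mem i j m := (LeftTensor.evElt P i j (P.qU ^ (2 * m) * z)).2
  balance g := LeftTensor.mk_rElt P g
  Δ_f g := leftCoaction_f P g
  Δ_v i _ := leftCoaction_v P i _

/-- The projection onto `Λ' ⊗̃ F`, after exchanging the tensor factors. -/
noncomputable def swappedMk : swappedRightGraded P n →ₐ[ℂ] RightTensor P n :=
  (RightTensor.mk P).comp
    (((Algebra.TensorProduct.comm ℂ (FEll P n) (RightExt P n)).toAlgHom.comp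
      (swappedRightGraded P n).val).codRestrict (rightGraded P n) fun x => x.2)

/-- The right coaction on words with parameters `y_m = q^(2(d-1-m)) z`. -/
noncomputable def rightCoactionData (d : ℕ) (z : ℂˣ) :
    CoactionData (rightExchange P (n := n) d z) (FEll P n) (RightTensor P n) where
  s := FEll.lHom P
  o := FEll.rHom P
  ε j i m := FEll.e P i j (P.qU ^ (2 * ((d : ℤ) - 1 - m)) * z)
  S := swappedRightGraded P n
  proj := swappedMk P
  Δ := rightCoaction P
  s_mem g := (RightTensor.lElt P g).2
  o_mem g := (RightTensor.rElt P g).2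
  f_mem g := (RightTensor.fElt P g).2
  ε_mem j i m := (RightTensor.weElt P i j (P.qU ^ (2 * ((d : ℤ) - 1 - m)) * z)).2
  balance g := (RightTensor.mk_fElt P g).symm
  Δ_f g := rightCoaction_f P g
  Δ_v j _ := rightCoaction_w P j _

/-- The left elliptic minors. -/
noncomputable def leftMinor (z : ℂˣ) (I J : Finset (Fin n)) : FEll P n :=
  (leftCoactionData P z).minor I.toList J

/-- The right elliptic minors. -/
noncomputable def rightMinor (z : ℂˣ) (I J : Finset (Fin n)) : FEll P n :=
  (rightCoactionData P J.card z).minor J.toList I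

/-- Left minors exist, computed from any enumeration of the row sets. -/
theorem isLeftMinors_of_minor (z : ℂˣ) {L : Finset (Fin n) → List (Fin n)}
    (hL : ∀ I, (L I).Nodup ∧ (L I).toFinset = I) :
    IsLeftMinors P z fun I J => (leftCoactionData P z).minor (L I) J := fun I =>
  (leftCoactionData P z).exists_coaction_eq (V := fun J => LeftExt.vI P J z) (hL I).1 (hL I).2
    fun J _ => leftExchange_setWord P J z

lemma comm_sum_tmul {κ : Type*} [Fintype κ] (a : κ → FEll P n) (V : κ → RightExt P n) :
    Algebra.TensorProduct.comm ℂ (FEll P n) (RightExt P n) (∑ I, a I ⊗ₜ[ℂ] V I) =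
      ∑ I, V I ⊗ₜ[ℂ] a I := by
  rw [map_sum]
  exact Finset.sum_congr rfl fun I _ => Algebra.TensorProduct.comm_tmul ..

lemma swappedMk_sum {κ : Type*} [Fintype κ] {a : κ → FEll P n} {V : κ → RightExt P n}
    {x : RightTensor P n}
    (h : ∃ h : ∑ I, a I ⊗ₜ[ℂ] V I ∈ swappedRightGraded P n, x = swappedMk P ⟨_, h⟩) :
    ∃ h : ∑ I, V I ⊗ₜ[ℂ] a I ∈ rightGraded P n, x = RightTensor.mk P ⟨_, h⟩ := by
  obtain ⟨h, rfl⟩ := h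
  have h' : Algebra.TensorProduct.comm ℂ (FEll P n) (RightExt P n) (∑ I, a I ⊗ₜ[ℂ] V I) ∈
    rightGraded P n := h
  exact ⟨comm_sum_tmul P a V ▸ h', congrArg (RightTensor.mk P) (Subtype.ext (comm_sum_tmul P a V))⟩

/-- Right minors exist, computed from any enumeration of the column sets. -/
theorem isRightMinors_of_minor (z : ℂˣ) {L : Finset (Fin n) → List (Fin n)}
    (hL : ∀ I, (L I).Nodup ∧ (L I).toFinset = I) :
    IsRightMinors P z fun I J => (rightCoactionData P J.card z).minor (L J) I := fun J =>
  swappedMk_sum P ((rightCoactionData P J.card z).exists_coaction_eq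
    (V := fun I => RightExt.wI P I z) (hL J).1 (hL J).2
    fun I hI => hI ▸ rightExchange_setWord P I z)

/-- The representation of `LeftExt.exists_rep` separates the elements `v_I(z)`. -/
lemma leftExchange_rep {z : ℂˣ} {N : LeftExt P n →ₐ[ℂ] SubsetEnd (Fin n) (MF n)}
    (hf : ∀ g, N (LeftExt.f P g) = mulHom g) (hv : ∀ i y, N (LeftExt.v P i y) =
      raiseOp (fun i k => P.EM k i 1) (wtShift (n := n)) i {m | y = P.qU ^ (2 * m) * z})
    (I J : Finset (Fin n)) :
    N (LeftExt.vI P I z) (Pi.single ∅ 1) J = if I = J then 1 else 0 := by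
  rw [← leftExchange_setWord, ExchangeData.setWord, ExchangeData.rep_word _ N hf
    (fun i m => ⟨{m' | P.qU ^ (2 * m) * z = P.qU ^ (2 * m') * z}, rfl, hv i _⟩) I.nodup_toList,
    Finset.toList_toFinset, Pi.single_apply]
  exact if_congr eq_comm rfl rfl

/-- The `I`-th coefficient of `w^K(z)` acting on the basis vector of the empty set is `δ_IK`. The
representation depends on `|I|`, so for `K ≠ I` only the support of the result is used. -/
lemma rightExchange_rep {z : ℂˣ} {I : Finset (Fin n)}
    {N : RightExt P n →ₐ[ℂ] SubsetEnd (Fin n) (MF n)}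
    (hf : ∀ g, N (RightExt.f P g) = mulHom g) (hv : ∀ i y, N (RightExt.w P i y) =
      raiseOp (fun i k => P.EMInv i k 0) (wtShift (n := n)) i
        {m : ℕ | y = P.qU ^ (2 * ((I.card : ℤ) - 1 - m)) * z}) (K : Finset (Fin n)) :
    N (RightExt.wI P K z) (Pi.single ∅ 1) I = if K = I then 1 else 0 := by
  split_ifs with h
  · subst h
    rw [← rightExchange_setWord, ExchangeData.setWord, ExchangeData.rep_word _ N hf
      (fun i m => ⟨{m' : ℕ | P.qU ^ (2 * ((K.card : ℤ) - 1 - m)) * z =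
        P.qU ^ (2 * ((K.card : ℤ) - 1 - m')) * z}, rfl, hv i _⟩) K.nodup_toList,
      Finset.toList_toFinset, Pi.single_eq_same]
  · have key : ∀ (l : List (Fin n)) (y : ℂˣ),
        IsSupportedOn (M := MF n) (N (RightExt.word P l y) (Pi.single ∅ 1)) l.toFinset := by
      intro l
      induction l with
      | nil =>
        intro y J hJ
        rw [RightExt.word, map_one]
        exact Pi.single_eq_of_ne hJ 1
      | cons i t ih =>
        intro y
        rw [RightExt.word, map_mul, hv, List.toFinset_cons, Module.End.mul_apply]
        exact (ih _).raiseOp i _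
    have h2 := (key K.sort z).mulOp (P.Fup K) I (by rw [Finset.sort_toFinset]; exact Ne.symm h)
    rw [RightExt.wI, map_mul, hf]
    exact h2

variable {P}

lemma LeftTensor.map_eq_of_mk_eq {A : Type*} [Semiring A] [Algebra ℂ A]
    (Θ : leftGraded P n →ₐ[ℂ] A) (hΘ : ∀ g, Θ (rElt P g) = Θ (fElt P g)) {x y : leftGraded P n}
    (h : mk P x = mk P y) : Θ x = Θ y := by
  refine map_eq_of_mkAlgHom_eq Θ (r := LeftBalance P n) (fun x y ⟨g, hx, hy⟩ => ?_) h
  rw [show x = rElt P g from Subtype.ext hx, show y = fElt P g from Subtype.ext hy, hΘ]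

theorem IsLeftMinors.unique {z : ℂˣ} {ξ ξ' : Finset (Fin n) → Finset (Fin n) → FEll P n}
    (h : IsLeftMinors P z ξ) (h' : IsLeftMinors P z ξ') : ξ = ξ' := by
  funext I J
  obtain ⟨N, hf, hv⟩ := LeftExt.exists_rep P (n := n) z
  obtain ⟨m, e⟩ := h I
  obtain ⟨m', e'⟩ := h' I
  have hN : ∀ g φ, N (LeftExt.fHom P g) φ = fun I => g * φ I := fun g φ => by
    rw [show N (LeftExt.fHom P g) = mulHom g from hf g]; rfl
  exact coeff_eq_of_proj_eq (κ := Finset (Fin n)) (M := MF n) (N := N) (leftGraded_le_adjoin P)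
    (proj := LeftTensor.mk P)
    (fun Θ hΘ x y hxy => LeftTensor.map_eq_of_mk_eq Θ (fun g => hΘ g _ _) hxy) hN (b := ∅) (I := J)
    (V := fun J => LeftExt.vI P J z) (fun K => leftExchange_rep P hf hv K J) (a := ξ I) (a' := ξ' I)
    m m' (e.symm.trans e')

lemma RightTensor.map_eq_of_mk_eq {A : Type*} [Semiring A] [Algebra ℂ A]
    (Θ : rightGraded P n →ₐ[ℂ] A) (hΘ : ∀ g, Θ (fElt P g) = Θ (lElt P g)) {x y : rightGraded P n}
    (h : mk P x = mk P y) : Θ x = Θ y := by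
  refine map_eq_of_mkAlgHom_eq Θ (r := RightBalance P n) (fun x y ⟨g, hx, hy⟩ => ?_) h
  rw [show x = fElt P g from Subtype.ext hx, show y = lElt P g from Subtype.ext hy, hΘ]

/-- The exchange of tensor factors, from `⨁ Λ'_α ⊗ F_{αβ}`. -/
noncomputable def swapRightGraded (P : EllParams) (n : ℕ) :
    rightGraded P n →ₐ[ℂ] swappedRightGraded P n :=
  ((Algebra.TensorProduct.comm ℂ (RightExt P n) (FEll P n)).toAlgHom.comp
    (rightGraded P n).val).codRestrict (swappedRightGraded P n)
    fun x => comm_mem_swappedRightGraded P x.2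

/-- A homomorphism that identifies `f(λ) ⊗ 1` with `1 ⊗ f(ζ)` factors through `swappedMk`. -/
lemma swappedMk_universal {A : Type*} [Semiring A] [Algebra ℂ A]
    (Θ : swappedRightGraded P n →ₐ[ℂ] A)
    (hΘ : ∀ g (h₁ : FEll.lHom P g ⊗ₜ[ℂ] (1 : RightExt P n) ∈ swappedRightGraded P n)
      (h₂ : (1 : FEll P n) ⊗ₜ[ℂ] RightExt.fHom P g ∈ swappedRightGraded P n),
      Θ ⟨_, h₁⟩ = Θ ⟨_, h₂⟩) {x y : swappedRightGraded P n}
    (h : swappedMk P x = swappedMk P y) : Θ x = Θ y := by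
  have h1 : ∀ x : swappedRightGraded P n, swapRightGraded P n ⟨Algebra.TensorProduct.comm ℂ
      (FEll P n) (RightExt P n) x.1, x.2⟩ = x := fun x => Subtype.ext
    ((Algebra.TensorProduct.comm ℂ (FEll P n) (RightExt P n)).symm_apply_apply x.1)
  have h2 := RightTensor.map_eq_of_mk_eq (Θ.comp (swapRightGraded P n))
    (fun g => (hΘ g (swapRightGraded P n (RightTensor.lElt P g)).2
      (swapRightGraded P n (RightTensor.fElt P g)).2).symm) h
  exact (congrArg Θ (h1 x)).symm.trans (h2.trans (congrArg Θ (h1 y)))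

lemma exists_swappedMk_eq {κ : Type*} [Fintype κ] {a : κ → FEll P n} {V : κ → RightExt P n}
    (m : ∑ I, V I ⊗ₜ[ℂ] a I ∈ rightGraded P n) :
    ∃ h : ∑ I, a I ⊗ₜ[ℂ] V I ∈ swappedRightGraded P n,
      RightTensor.mk P ⟨_, m⟩ = swappedMk P ⟨_, h⟩ := by
  have e := comm_sum_tmul P a V
  have h : ∑ I, a I ⊗ₜ[ℂ] V I ∈ swappedRightGraded P n := by
    change Algebra.TensorProduct.comm ℂ (FEll P n) (RightExt P n) (∑ I, a I ⊗ₜ[ℂ] V I) ∈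
      rightGraded P n
    rwa [e]
  exact ⟨h, congrArg (RightTensor.mk P) (Subtype.ext e.symm)⟩

theorem IsRightMinors.unique {z : ℂˣ} {ξ ξ' : Finset (Fin n) → Finset (Fin n) → FEll P n}
    (h : IsRightMinors P z ξ) (h' : IsRightMinors P z ξ') : ξ = ξ' := by
  funext I J
  obtain ⟨N, hf, hv⟩ := RightExt.exists_rep P (n := n) I.card z
  obtain ⟨m, e⟩ := h J
  obtain ⟨m', e'⟩ := h' J
  obtain ⟨h₁, e₁⟩ := exists_swappedMk_eq m
  obtain ⟨h₂, e₂⟩ := exists_swappedMk_eq m'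
  have hN : ∀ g φ, N (RightExt.fHom P g) φ = fun I => g * φ I := fun g φ => by
    rw [show N (RightExt.fHom P g) = mulHom g from hf g]; rfl
  exact coeff_eq_of_proj_eq (κ := Finset (Fin n)) (M := MF n) (N := N)
    (swappedRightGraded_le_adjoin P) (proj := swappedMk P)
    (fun Θ hΘ x y hxy => swappedMk_universal Θ hΘ hxy) hN (b := ∅) (I := I)
    (V := fun J => RightExt.wI P J z) (fun K => rightExchange_rep P hf hv K) (a := fun I => ξ I J)
    (a' := fun I => ξ' I J) h₁ h₂ ((e₁.symm.trans (e.symm.trans e')).trans e₂)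

variable (P)

/-! ### Laplace expansions -/

theorem isLeftMinors_leftMinor (z : ℂˣ) : IsLeftMinors P z (leftMinor P z (n := n)) :=
  isLeftMinors_of_minor P z fun I => ⟨I.nodup_toList, I.toList_toFinset⟩

theorem isRightMinors_rightMinor (z : ℂˣ) : IsRightMinors P z (rightMinor P z (n := n)) :=
  isRightMinors_of_minor P z fun I => ⟨I.nodup_toList, I.toList_toFinset⟩

/-- A list that enumerates `K`, and that begins with `c` for `K = I`. -/
noncomputable def listFrom {ι : Type*} [DecidableEq ι] (I : Finset ι) (c : ι) (K : Finset ι) :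
    List ι :=
  if K = I then c :: (I.erase c).toList else K.toList

lemma listFrom_spec {ι : Type*} [DecidableEq ι] {I : Finset ι} {c : ι} (hc : c ∈ I)
    (K : Finset ι) : (listFrom I c K).Nodup ∧ (listFrom I c K).toFinset = K := by
  rw [listFrom]
  split_ifs with h
  · subst h
    refine ⟨List.nodup_cons.mpr ⟨by simp, Finset.nodup_toList _⟩, ?_⟩
    rw [List.toFinset_cons, Finset.toList_toFinset, Finset.insert_erase hc]
  · exact ⟨K.nodup_toList, K.toList_toFinset⟩

lemma listFrom_self {ι : Type*} [DecidableEq ι] (I : Finset ι) (c : ι) :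
    listFrom I c I = c :: (I.erase c).toList := if_pos rfl

/-- Since left minors are unique, they can be computed from an enumeration of `I` that begins with
any given element. -/
lemma leftMinor_eq_minor_cons (z : ℂˣ) {I : Finset (Fin n)} {c : Fin n} (hc : c ∈ I)
    (J : Finset (Fin n)) :
    leftMinor P z I J = (leftCoactionData P z).minor (c :: (I.erase c).toList) J := by
  have h := (isLeftMinors_leftMinor P z).unique (isLeftMinors_of_minor P z (listFrom_spec hc))
  refine (congrFun (congrFun h I) J).trans ?_
  rw [listFrom_self]

/-- Since right minors are unique, they can be computed from an enumeration of `J` that begins with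
any given element. -/
lemma rightMinor_eq_minor_cons (z : ℂˣ) {J : Finset (Fin n)} {b : Fin n} (hb : b ∈ J)
    (I : Finset (Fin n)) : rightMinor P z I J =
      (rightCoactionData P J.card z).minor (b :: (J.erase b).toList) I := by
  have h := (isRightMinors_rightMinor P z).unique (isRightMinors_of_minor P z (listFrom_spec hb))
  refine (congrFun (congrFun h I) J).trans ?_
  rw [listFrom_self]

/-- Laplace expansion of a left minor along a row. -/
theorem leftMinor_expand (z : ℂˣ) {I : Finset (Fin n)} {c : Fin n} (hc : c ∈ I)
    (J : Finset (Fin n)) : leftMinor P z I J =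
      FEll.lHom P (∏ k ∈ I.erase c, P.EMInv k c 1) *
        ∑ j ∈ J, FEll.rHom P (∏ k ∈ J.erase j, P.EM k j 1) *
          (FEll.e P c j (P.qU ^ (2 * (I.erase c).card) * z) *
            leftMinor P z (I.erase c) (J.erase j)) := by
  rw [leftMinor_eq_minor_cons P z hc]
  exact CoactionData.minor_cons_toList _ c (I.erase c) J rfl (fun _ => rfl) (fun _ => rfl)
    fun _ => rfl

lemma rightCoactionData_minor_succ (d : ℕ) (z : ℂˣ) (l : List (Fin n)) (I : Finset (Fin n)) :
    (rightCoactionData P (d + 1) z).minor l I =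
      (rightCoactionData P d (P.qU ^ 2 * z)).minor l I := by
  induction l generalizing I with
  | nil => rfl
  | cons j t ih =>
    have hz : P.qU ^ (2 * (((d + 1 : ℕ) : ℤ) - 1 - t.length)) * z =
        P.qU ^ (2 * ((d : ℤ) - 1 - t.length)) * (P.qU ^ 2 * z) := by
      rw [← mul_assoc, ← zpow_natCast, ← zpow_add]
      congr 2
      push_cast
      ring
    have hε : ∀ i, (rightCoactionData P (d + 1) z).ε j i t.length =
        (rightCoactionData P d (P.qU ^ 2 * z)).ε j i t.length := fun i =>
      congrArg (FEll.e P i j) hz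
    rw [CoactionData.minor, CoactionData.minor]
    simp only [ih, hε]
    rfl

lemma rightCoactionData_minor_toList {d : ℕ} {K : Finset (Fin n)} (hd : d = K.card + 1) (z : ℂˣ)
    (I : Finset (Fin n)) :
    (rightCoactionData P d z).minor K.toList I = rightMinor P (P.qU ^ 2 * z) I K := by
  subst hd
  rw [rightMinor, rightCoactionData_minor_succ]

/-- Laplace expansion of a right minor along a column. -/
theorem rightMinor_expand (z : ℂˣ) (I : Finset (Fin n)) {J : Finset (Fin n)} {b : Fin n}
    (hb : b ∈ J) : rightMinor P z I J =
      FEll.rHom P (∏ k ∈ J.erase b, P.EM b k 0) *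
        ∑ i ∈ I, FEll.lHom P (∏ k ∈ I.erase i, P.EMInv i k 0) *
          (FEll.e P i b z * rightMinor P (P.qU ^ 2 * z) (I.erase i) (J.erase b)) := by
  have hz : P.qU ^ (2 * ((J.card : ℤ) - 1 - (J.erase b).card)) * z = z := by
    rw [← Finset.card_erase_add_one hb]
    push_cast
    rw [add_sub_cancel_right, sub_self, mul_zero, zpow_zero, one_mul]
  have hε : ∀ i, (rightCoactionData P J.card z).ε b i (J.erase b).card = FEll.e P i b z := fun i =>
    congrArg (FEll.e P i b) hz
  have hm : ∀ i : Fin n,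
      (rightCoactionData P (n := n) J.card z).minor (J.erase b).toList (I.erase i) =
      rightMinor P (P.qU ^ 2 * z) (I.erase i) (J.erase b) := fun i =>
    rightCoactionData_minor_toList P (Finset.card_erase_add_one hb).symm z _
  rw [rightMinor_eq_minor_cons P z hb]
  exact CoactionData.minor_cons_toList _ b (J.erase b) I rfl (fun _ => rfl) hε hm

lemma leftMinor_eq_zero (z : ℂˣ) {I J : Finset (Fin n)} (h : J.card ≠ I.card) :
    leftMinor P z I J = 0 :=
  CoactionData.minor_eq_zero _ (by rwa [Finset.length_toList])

lemma rightMinor_eq_zero (z : ℂˣ) {I J : Finset (Fin n)} (h : I.card ≠ J.card) :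
    rightMinor P z I J = 0 :=
  CoactionData.minor_eq_zero _ (by rwa [Finset.length_toList])

lemma leftMinor_empty (z : ℂˣ) : leftMinor P z (∅ : Finset (Fin n)) ∅ = 1 := by
  rw [leftMinor, Finset.toList_empty, CoactionData.minor, if_pos rfl]

lemma rightMinor_empty (z : ℂˣ) : rightMinor P z (∅ : Finset (Fin n)) ∅ = 1 := by
  rw [rightMinor, Finset.toList_empty, CoactionData.minor, if_pos rfl]

/-! ### Resummation of the exchange relation -/

section Resummation

variable {ι M F : Type*} [DecidableEq ι] [CommRing M] [Algebra ℂ M] [Ring F] [Algebra ℂ F]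

/-- Resummation of one side of the exchange relation: the terms with coefficient `α` give all but
one summand of a Laplace expansion, and the terms with coefficient `β` add up to the missing one. -/
theorem sum_exchange_side (L : M →ₐ[ℂ] F) {K : Finset ι} {c : ι} (hc : c ∉ K) {p r : ι → ι → M}
    {α β : ι → M} {κ : M} {e g h : ι → F} {Z : Finset ι → F}
    (hg : ∀ a ∈ K, g a = L (∏ k ∈ K.erase a, r c k) * Z ((insert c K).erase a))
    (hh : ∀ a ∈ K, h a = L (∏ k ∈ K.erase a, r a k) * Z K)
    (hα : ∀ a ∈ K, α a = κ * (r c a * p a c))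
    (hβ : ∑ a ∈ K, β a * ∏ k ∈ K.erase a, (r a k * p a k) = κ * ∏ k ∈ K, (r c k * p c k))
    (he : ∀ a ∈ K, Commute (e a) (L (∏ k ∈ K.erase a, r c k)))
    (he' : ∀ a ∈ K, Commute (e c) (L (∏ k ∈ K.erase a, r a k))) :
    ∑ a ∈ K, L (∏ k ∈ K.erase a, p a k) * (L (α a) * (e a * g a) + L (β a) * (e c * h a)) =
      L (κ * ∏ k ∈ K, r c k) * ∑ a ∈ insert c K, L (∏ k ∈ (insert c K).erase a, p a k) *
        (e a * Z ((insert c K).erase a)) := by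
  have h1 : ∀ a ∈ K, L (∏ k ∈ K.erase a, p a k) * (L (α a) * (e a * g a)) =
      L (κ * ∏ k ∈ K, r c k) * (L (∏ k ∈ (insert c K).erase a, p a k) *
        (e a * Z ((insert c K).erase a))) := by
    intro a ha
    have hca : c ≠ a := fun h => hc (h ▸ ha)
    rw [hg a ha, ← mul_assoc (e a), (he a ha).eq]
    simp only [← mul_assoc, ← map_mul]
    congr 3
    rw [hα a ha, Finset.erase_insert_of_ne hca, Finset.prod_insert fun h =>
      hc (Finset.mem_of_mem_erase h), ← Finset.mul_prod_erase K (r c) ha]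
    ring
  have h2 : ∀ a ∈ K, L (∏ k ∈ K.erase a, p a k) * (L (β a) * (e c * h a)) =
      L (β a * ∏ k ∈ K.erase a, (r a k * p a k)) * (e c * Z K) := by
    intro a ha
    rw [hh a ha, ← mul_assoc (e c), (he' a ha).eq]
    simp only [← mul_assoc, ← map_mul]
    congr 3
    rw [Finset.prod_mul_distrib]
    ring
  simp only [mul_add, Finset.sum_add_distrib]
  rw [Finset.sum_congr rfl h1, Finset.sum_congr rfl h2, ← Finset.mul_sum, ← Finset.sum_mul,
    ← map_sum, hβ, Finset.sum_insert hc, Finset.erase_insert hc, mul_add, add_comm]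
  congr 1
  rw [Finset.prod_mul_distrib, ← mul_assoc κ, map_mul, mul_assoc]

/-- If the exchange relation holds and minors of smaller size have Laplace expansions of both kinds,
then the two kinds of Laplace expansions agree. The functions `A i k` and `B i k` stand for the
coefficients of the left and right Laplace expansions, `e` and `e'` for generators with two spectral
parameters, and `X`, `Y`, `Z` for minors. -/
theorem exchange_resummation (L R : M →ₐ[ℂ] F) (hLR : ∀ f g, Commute (L f) (R g)) {I J : Finset ι}
    {c b : ι} (hc : c ∉ I) (hb : b ∉ J) {A B α β : ι → ι → M} {κ : M} {e e' : ι → ι → F}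
    {X : Finset ι → Finset ι → F} {Y Z : Finset ι → F}
    (hα : ∀ i j, α i j = κ * (A i j * B i j))
    (hβ : ∀ (K : Finset ι) (c : ι), c ∉ K → K.card = I.card →
      ∑ a ∈ K, β a c * ∏ k ∈ K.erase a, (A k a * B a k) = κ * ∏ k ∈ K, (A k c * B c k))
    (hIJ : J.card = I.card)
    (heL : ∀ a b, ∀ K : Finset ι, a ∉ K → ∀ i, i ≠ a → Commute (e a b) (L (∏ k ∈ K, A k i)))
    (heR : ∀ a b, ∀ K : Finset ι, b ∉ K → ∀ i, i ≠ b → Commute (e a b) (R (∏ k ∈ K, A k i)))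
    (heL' : ∀ a b, ∀ K : Finset ι, a ∉ K → ∀ i, i ≠ a → Commute (e' a b) (L (∏ k ∈ K, B i k)))
    (heR' : ∀ a b, ∀ K : Finset ι, b ∉ K → ∀ i, i ≠ b → Commute (e' a b) (R (∏ k ∈ K, B i k)))
    (hX : ∀ a ∈ I, ∑ d ∈ J, R (∏ k ∈ J.erase d, A k d) * (e' c d * X (I.erase a) (J.erase d)) =
      L (∏ k ∈ I.erase a, A k c) * Z ((insert c I).erase a))
    (hX' : ∀ a ∈ I, ∑ d ∈ J, R (∏ k ∈ J.erase d, A k d) * (e' a d * X (I.erase a) (J.erase d)) =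
      L (∏ k ∈ I.erase a, A k a) * Z I)
    (hY : ∀ d ∈ J, ∑ a ∈ I, L (∏ k ∈ I.erase a, B a k) * (e a b * X (I.erase a) (J.erase d)) =
      R (∏ k ∈ J.erase d, B b k) * Y ((insert b J).erase d))
    (hY' : ∀ d ∈ J, ∑ a ∈ I, L (∏ k ∈ I.erase a, B a k) * (e a d * X (I.erase a) (J.erase d)) =
      R (∏ k ∈ J.erase d, B d k) * Y J)
    (hrll : ∀ a ∈ I, ∀ d ∈ J, L (α a c) * (e a b * e' c d) + L (β a c) * (e c b * e' a d) =
      R (α b d) * (e' c d * e a b) + R (β d b) * (e' c b * e a d)) :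
    L (κ * ∏ k ∈ I, A k c) * ∑ a ∈ insert c I, L (∏ k ∈ (insert c I).erase a, B a k) *
        (e a b * Z ((insert c I).erase a)) =
      R (κ * ∏ k ∈ J, B b k) * ∑ d ∈ insert b J, R (∏ k ∈ (insert b J).erase d, A k d) *
        (e' c d * Y ((insert b J).erase d)) := by
  have hne : ∀ {K : Finset ι} {x : ι}, x ∉ K → ∀ a ∈ K, a ≠ x := fun hx a ha h => hx (h ▸ ha)
  have hmem : ∀ {K : Finset ι} {x : ι}, x ∉ K → ∀ a, x ∉ K.erase a := fun hx a h =>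
    hx (Finset.mem_of_mem_erase h)
  rw [← sum_exchange_side L hc (p := B) (r := fun i k => A k i) (e := fun a => e a b)
      (α := fun a => α a c) (β := fun a => β a c) hX hX' (fun a _ => hα a c) (hβ I c hc rfl)
      (fun a ha => heL a b _ (Finset.notMem_erase a I) c (hne hc a ha).symm)
      (fun a ha => heL c b _ (hmem hc a) a (hne hc a ha)),
    ← sum_exchange_side R hb (p := fun i k => A k i) (r := B) (e := fun d => e' c d)
      (α := fun d => α b d) (β := fun d => β d b) hY hY'
      (fun d _ => (hα b d).trans (by ring)) ?_
      (fun d hd => heR' c d _ (Finset.notMem_erase d J) b (hne hb d hd).symm)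
      (fun d hd => heR' c b _ (hmem hb d) d (hne hb d hd))]
  · have h1 : ∀ a ∈ I, L (∏ k ∈ I.erase a, B a k) * (L (α a c) * (e a b *
          ∑ d ∈ J, R (∏ k ∈ J.erase d, A k d) * (e' c d * X (I.erase a) (J.erase d))) +
        L (β a c) * (e c b *
          ∑ d ∈ J, R (∏ k ∈ J.erase d, A k d) * (e' a d * X (I.erase a) (J.erase d)))) =
        ∑ d ∈ J, L (∏ k ∈ I.erase a, B a k) * (R (∏ k ∈ J.erase d, A k d) *
          ((L (α a c) * (e a b * e' c d) + L (β a c) * (e c b * e' a d)) *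
            X (I.erase a) (J.erase d))) := by
      intro a ha
      rw [← Finset.mul_sum]
      congr 1
      simp only [Finset.mul_sum]
      rw [← Finset.sum_add_distrib]
      refine Finset.sum_congr rfl fun d hd => ?_
      have hd' := hne hb d hd
      have c1 := heR a b _ (hmem hb d) d hd'
      have c2 := heR c b _ (hmem hb d) d hd'
      rw [← mul_assoc (e a b), c1.eq, ← mul_assoc (e c b), c2.eq, mul_assoc, mul_assoc,
        ← mul_assoc (L _), (hLR _ _).eq, ← mul_assoc (L _), (hLR _ _).eq]
      noncomm_ring
    have h2 : ∀ d ∈ J, R (∏ k ∈ J.erase d, A k d) * (R (α b d) * (e' c d *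
          ∑ a ∈ I, L (∏ k ∈ I.erase a, B a k) * (e a b * X (I.erase a) (J.erase d))) +
        R (β d b) * (e' c b *
          ∑ a ∈ I, L (∏ k ∈ I.erase a, B a k) * (e a d * X (I.erase a) (J.erase d)))) =
        ∑ a ∈ I, L (∏ k ∈ I.erase a, B a k) * (R (∏ k ∈ J.erase d, A k d) *
          ((R (α b d) * (e' c d * e a b) + R (β d b) * (e' c b * e a d)) *
            X (I.erase a) (J.erase d))) := by
      intro d hd
      simp only [Finset.mul_sum, ← Finset.sum_add_distrib]
      refine Finset.sum_congr rfl fun a ha => ?_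
      have ha' := hne hc a ha
      have c1 := heL' c d _ (hmem hc a) a ha'
      have c2 := heL' c b _ (hmem hc a) a ha'
      rw [← mul_assoc (e' c d), c1.eq, ← mul_assoc (e' c b), c2.eq, mul_assoc, mul_assoc,
        ← mul_assoc (R (α b d)), ← (hLR _ _).eq, ← mul_assoc (R (β d b)), ← (hLR _ _).eq,
        mul_assoc, mul_assoc, ← mul_add, ← mul_assoc, ← (hLR _ _).eq]
      noncomm_ring
    refine (Finset.sum_congr rfl h1).trans (Eq.trans ?_ (Finset.sum_congr rfl h2).symm)
    rw [Finset.sum_comm]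
    refine Finset.sum_congr rfl fun d hd => Finset.sum_congr rfl fun a ha => ?_
    rw [hrll a ha d hd]
  · have := hβ J b hb hIJ
    simpa only [mul_comm (B _ _)] using this

end Resummation

/-! ### Left and right minors agree -/

lemma sum_sum_eq_add_swap {ι A : Type*} [Fintype ι] [DecidableEq ι] [AddCommMonoid A]
    (g : ι → ι → A) {a c : ι} (hac : a ≠ c)
    (h0 : ∀ x y, ¬ (x = a ∧ y = c) → ¬ (x = c ∧ y = a) → g x y = 0) :
    ∑ x, ∑ y, g x y = g a c + g c a := by
  rw [← Finset.sum_product', Finset.univ_product_univ, Finset.sum_eq_add (a, c) (c, a)]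
  · exact fun h => hac (Prod.ext_iff.mp h).1
  · rintro ⟨x, y⟩ - ⟨h1, h2⟩
    exact h0 x y (fun h => h1 (Prod.ext h.1 h.2)) fun h => h2 (Prod.ext h.1 h.2)
  · simp
  · simp

lemma EllParams.val_div_qU_pow_mul (N : ℕ) (z : ℂˣ) :
    ((z / (P.qU ^ (2 * N) * z) : ℂˣ) : ℂ) = P.qpow (-2 * N) := by
  have h1 : z / (P.qU ^ (2 * N) * z) = (P.qU ^ (2 * N))⁻¹ := by
    rw [div_mul_cancel_right]
  have h2 : (-2 * N : ℂ) = -((2 * N : ℕ) : ℂ) := by push_cast; ring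
  rw [h1, h2, qpow, Complex.cpow_neg, Complex.cpow_natCast, Units.val_inv_eq_inv_val,
    Units.val_pow_eq_pow_val]
  rfl

/-- The residual exchange relation at `z_1 / z_2 = q^(-2N)`. -/
theorem FEll.residual_rll (N : ℕ) {a b c d : Fin n} (hac : a ≠ c) (hbd : b ≠ d) (z : ℂˣ) :
    FEll.l P (P.alphaRes N a c) * (FEll.e P a b z * FEll.e P c d (P.qU ^ (2 * N) * z)) +
      FEll.l P (P.betaRes N a c) * (FEll.e P c b z * FEll.e P a d (P.qU ^ (2 * N) * z)) =
    FEll.r P (P.alphaRes N b d) * (FEll.e P c d (P.qU ^ (2 * N) * z) * FEll.e P a b z) +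
      FEll.r P (P.betaRes N d b) * (FEll.e P c b (P.qU ^ (2 * N) * z) * FEll.e P a d z) := by
  have hw := P.val_div_qU_pow_mul N z
  have h := RingQuot.mkAlgHom_rel ℂ (FRel.rll (P := P) a b c d z (P.qU ^ (2 * N) * z)
    (P.resFactor N) (P.resFactor_meromorphicOn N) (fun x y => P.RmatRes N x y a c)
    (fun x y => P.RmatRes N b d x y)
    (fun x y => by rw [hw]; exact P.isMeroLimit_RmatRes_lower N x y hac)
    (fun x y => by rw [hw]; exact P.isMeroLimit_RmatRes_upper N hbd x y))
  simp only [map_sum, map_mul] at h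
  have h' : ∑ x, ∑ y, FEll.l P (P.RmatRes N x y a c) * FEll.e P x b z *
        FEll.e P y d (P.qU ^ (2 * N) * z) =
      ∑ x, ∑ y, FEll.r P (P.RmatRes N b d x y) * FEll.e P c y (P.qU ^ (2 * N) * z) *
        FEll.e P a x z := h
  have e1 : P.RmatRes N a c a c = P.alphaRes N a c := if_pos ⟨rfl, rfl⟩
  have e2 : P.RmatRes N c a a c = P.betaRes N a c := by
    rw [EllParams.RmatRes, if_neg fun h => hac h.1, if_pos ⟨rfl, rfl⟩]
  have e3 : P.RmatRes N b d b d = P.alphaRes N b d := if_pos ⟨rfl, rfl⟩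
  have e4 : P.RmatRes N b d d b = P.betaRes N d b := by
    rw [EllParams.RmatRes, if_neg fun h => hbd h.2, if_pos ⟨rfl, rfl⟩]
  rw [sum_sum_eq_add_swap _ hac, sum_sum_eq_add_swap _ hbd, e1, e2, e3, e4] at h'
  · simpa only [mul_assoc] using h'
  · intro x y h1 h2
    rw [EllParams.RmatRes, if_neg h1, if_neg h2, FEll.r_zero, zero_mul, zero_mul]
  · intro x y h1 h2
    rw [EllParams.RmatRes, if_neg fun h => h1 ⟨h.1.symm, h.2.symm⟩,
      if_neg fun h => h2 ⟨h.2.symm, h.1.symm⟩, FEll.l_zero, zero_mul, zero_mul]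

lemma prod_mul_prod_eq_one {ι M : Type*} [CommMonoid M] {K : Finset ι} {f g : ι → M}
    (h : ∀ k ∈ K, f k * g k = 1) : (∏ k ∈ K, f k) * ∏ k ∈ K, g k = 1 := by
  rw [← Finset.prod_mul_distrib, Finset.prod_eq_one h]

lemma EllParams.prod_EM_mul_prod_EMInv {K : Finset (Fin n)} {c : Fin n} (hc : c ∉ K) :
    (∏ k ∈ K, P.EM k c 1) * ∏ k ∈ K, P.EMInv k c 1 = 1 :=
  prod_mul_prod_eq_one fun _ hk => P.EM_mul_EMInv (ne_of_mem_of_not_mem hk hc) 1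

lemma EllParams.prod_EMInv_mul_prod_EM {K : Finset (Fin n)} {b : Fin n} (hb : b ∉ K) :
    (∏ k ∈ K, P.EMInv b k 0) * ∏ k ∈ K, P.EM b k 0 = 1 :=
  prod_mul_prod_eq_one fun _ hk => P.EMInv_mul_EM (ne_of_mem_of_not_mem hk hb).symm 0

lemma map_mul_map_mul_of_mul_eq_one {M F : Type*} [CommRing M] [Algebra ℂ M] [Ring F]
    [Algebra ℂ F] (L : M →ₐ[ℂ] F) {f g : M} (h : f * g = 1) (x : F) : L f * (L g * x) = x := by
  rw [← mul_assoc, ← map_mul, h, map_one, one_mul]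

lemma eq_of_map_mul_eq_map_mul {M F : Type*} [CommRing M] [Algebra ℂ M] [Ring F] [Algebra ℂ F]
    {L R : M →ₐ[ℂ] F} (hLR : ∀ f g, Commute (L f) (R g)) {κ : ℂ} (hκ : κ ≠ 0) {f f' g g' : M}
    (hf : f * f' = 1) (hg : g * g' = 1) {x y : F}
    (h : L (algebraMap ℂ M κ * f) * x = R (algebraMap ℂ M κ * g) * y) :
    L f' * y = R g' * x := by
  simp only [map_mul, AlgHom.commutes, mul_assoc] at h
  simp only [← Algebra.smul_def] at h
  have h2 : L f * x = R g * y := smul_right_injective F hκ h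
  have h3 := congrArg (fun t => R g' * (L f' * t)) h2
  have hf2 : L f' * (L f * x) = x := map_mul_map_mul_of_mul_eq_one L ((mul_comm f' f).trans hf) x
  have hg2 : R g' * (R g * y) = y := map_mul_map_mul_of_mul_eq_one R ((mul_comm g' g).trans hg) y
  have h4 : R g' * (L f' * (R g * y)) = L f' * y := by
    rw [← mul_assoc, ← (hLR f' g').eq, mul_assoc, hg2]
  rw [h4, hf2] at h3
  exact h3.symm

lemma algHom_prod_eq_self {ι M : Type*} [CommRing M] [Algebra ℂ M] (σ : M →ₐ[ℂ] M) {K : Finset ι}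
    {g : ι → M} (h : ∀ k ∈ K, σ (g k) = g k) : σ (∏ k ∈ K, g k) = ∏ k ∈ K, g k :=
  (map_prod σ g K).trans (Finset.prod_congr rfl h)

lemma wtShift_prod {K : Finset (Fin n)} {g : Fin n → MF n} {a : Fin n}
    (h : ∀ k ∈ K, wtShift a (g k) = g k) : wtShift a (∏ k ∈ K, g k) = ∏ k ∈ K, g k :=
  algHom_prod_eq_self (M := MF n) (wtShift a) h

lemma FEll.commute_e_l {f : MF n} {a : Fin n} (h : wtShift a f = f) (b : Fin n) (z : ℂˣ) :
    Commute (FEll.e P a b z) (FEll.lHom P f) :=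
  (FEll.e_l P f a b z).trans (by rw [h]; rfl)

lemma FEll.commute_e_r {f : MF n} {b : Fin n} (h : wtShift b f = f) (a : Fin n) (z : ℂˣ) :
    Commute (FEll.e P a b z) (FEll.rHom P f) :=
  (FEll.e_r P f a b z).trans (by rw [h]; rfl)

lemma wtShift_prod_EM {K : Finset (Fin n)} {a i : Fin n} (ha : a ∉ K) (hi : i ≠ a) :
    wtShift a (∏ k ∈ K, P.EM k i 1) = ∏ k ∈ K, P.EM k i 1 :=
  wtShift_prod fun _ hk => P.wtShift_EM (ne_of_mem_of_not_mem hk ha).symm hi.symm 1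

lemma wtShift_prod_EMInv {K : Finset (Fin n)} {a i : Fin n} (ha : a ∉ K) (hi : i ≠ a) :
    wtShift a (∏ k ∈ K, P.EMInv i k 0) = ∏ k ∈ K, P.EMInv i k 0 :=
  wtShift_prod fun _ hk => P.wtShift_EMInv hi.symm (ne_of_mem_of_not_mem hk ha).symm 0

/-- Laplace expansion along the row `c` of a minor of parameter `q^2 z`, which by induction is both
a left and a right minor. -/
lemma sum_left_expansion {m : ℕ} {z : ℂˣ}
    (ih : ∀ (z : ℂˣ) (I J : Finset (Fin n)), I.card < m → leftMinor P z I J = rightMinor P z I J)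
    {K J : Finset (Fin n)} {c : Fin n} (hcK : c ∈ K) (hK : K.card < m) :
    ∑ d ∈ J, FEll.rHom P (∏ k ∈ J.erase d, P.EM k d 1) *
      (FEll.e P c d (P.qU ^ (2 * K.card) * z) *
        rightMinor P (P.qU ^ 2 * z) (K.erase c) (J.erase d)) =
      FEll.lHom P (∏ k ∈ K.erase c, P.EM k c 1) * rightMinor P (P.qU ^ 2 * z) K J := by
  have hz : P.qU ^ (2 * K.card) * z = P.qU ^ (2 * (K.erase c).card) * (P.qU ^ 2 * z) := by
    rw [← mul_assoc, ← pow_add, ← Finset.card_erase_add_one hcK, mul_add, mul_one]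
  have hm : ∀ J', rightMinor P (P.qU ^ 2 * z) (K.erase c) J' =
      leftMinor P (P.qU ^ 2 * z) (K.erase c) J' := fun J' =>
    (ih _ _ _ ((Finset.card_erase_lt_of_mem hcK).trans hK)).symm
  rw [← ih _ K J hK, leftMinor_expand P _ hcK, hz]
  simp only [hm]
  exact (map_mul_map_mul_of_mul_eq_one (M := MF n) (FEll.lHom P)
    (P.prod_EM_mul_prod_EMInv (Finset.notMem_erase c K)) _).symm

/-- Laplace expansion of a right minor along the column `d`, with the prefactor moved to the other
side. -/
lemma sum_right_expansion (z : ℂˣ) {I K : Finset (Fin n)} {d : Fin n} (hd : d ∈ K) :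
    ∑ a ∈ I, FEll.lHom P (∏ k ∈ I.erase a, P.EMInv a k 0) *
      (FEll.e P a d z * rightMinor P (P.qU ^ 2 * z) (I.erase a) (K.erase d)) =
      FEll.rHom P (∏ k ∈ K.erase d, P.EMInv d k 0) * rightMinor P z I K := by
  rw [rightMinor_expand P z I hd]
  exact (map_mul_map_mul_of_mul_eq_one (M := MF n) (FEll.rHom P)
    (P.prod_EMInv_mul_prod_EM (Finset.notMem_erase d K)) _).symm

lemma leftMinor_singleton (z : ℂˣ) (c b : Fin n) : leftMinor P z {c} {b} = FEll.e P c b z := by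
  rw [leftMinor_expand P z (Finset.mem_singleton_self c), Finset.sum_singleton,
    Finset.erase_singleton, Finset.erase_singleton, leftMinor_empty, Finset.prod_empty,
    Finset.prod_empty, map_one, map_one, one_mul, one_mul, mul_one, Finset.card_empty, mul_zero,
    pow_zero, one_mul]

lemma rightMinor_singleton (z : ℂˣ) (c b : Fin n) : rightMinor P z {c} {b} = FEll.e P c b z := by
  rw [rightMinor_expand P z _ (Finset.mem_singleton_self b), Finset.sum_singleton,
    Finset.erase_singleton, Finset.erase_singleton, rightMinor_empty, Finset.prod_empty,
    Finset.prod_empty, map_one, map_one, one_mul, one_mul, mul_one]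

set_option maxHeartbeats 400000 in
/-- The induction step. Since the residual exchange relation at `z_1 / z_2 = q^(-2N)` exists for all
`N ≥ 1`, `exchange_resummation` turns the Laplace expansion of the left minor along the row `c` into
the Laplace expansion of the right minor along the column `b`. -/
theorem leftMinor_insert_eq_rightMinor_insert {N : ℕ} (hN : N ≠ 0) (z : ℂˣ)
    (ih : ∀ (z : ℂˣ) (I J : Finset (Fin n)), I.card < N + 1 →
      leftMinor P z I J = rightMinor P z I J)
    {I J : Finset (Fin n)} {c b : Fin n} (hc : c ∉ I) (hb : b ∉ J) (hI : I.card = N)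
    (hJ : J.card = N) :
    leftMinor P z (insert c I) (insert b J) = rightMinor P z (insert c I) (insert b J) := by
  have hcard : ∀ a ∈ I, ((insert c I).erase a).card = N := fun a ha => by
    rw [Finset.card_erase_of_mem (Finset.mem_insert_of_mem ha), Finset.card_insert_of_notMem hc,
      hI, Nat.add_sub_cancel]
  have hX : ∀ a ∈ I, ∑ d ∈ J, FEll.rHom P (∏ k ∈ J.erase d, P.EM k d 1) *
      (FEll.e P c d (P.qU ^ (2 * N) * z) *
        rightMinor P (P.qU ^ 2 * z) (I.erase a) (J.erase d)) =
      FEll.lHom P (∏ k ∈ I.erase a, P.EM k c 1) *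
        rightMinor P (P.qU ^ 2 * z) ((insert c I).erase a) J := by
    intro a ha
    have hca : c ≠ a := (ne_of_mem_of_not_mem ha hc).symm
    have hmem : c ∈ (insert c I).erase a :=
      Finset.mem_erase.mpr ⟨hca, Finset.mem_insert_self c I⟩
    have he : ((insert c I).erase a).erase c = I.erase a := by
      rw [Finset.erase_right_comm, Finset.erase_insert hc]
    have h := sum_left_expansion P (z := z) (J := J) ih hmem ((hcard a ha).trans_lt N.lt_succ_self)
    rwa [he, hcard a ha] at h
  have hX' : ∀ a ∈ I, ∑ d ∈ J, FEll.rHom P (∏ k ∈ J.erase d, P.EM k d 1) *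
      (FEll.e P a d (P.qU ^ (2 * N) * z) *
        rightMinor P (P.qU ^ 2 * z) (I.erase a) (J.erase d)) =
      FEll.lHom P (∏ k ∈ I.erase a, P.EM k a 1) * rightMinor P (P.qU ^ 2 * z) I J := by
    intro a ha
    have h := sum_left_expansion P (z := z) (J := J) ih ha (hI.trans_lt N.lt_succ_self)
    rwa [hI] at h
  have hY : ∀ d ∈ J, ∑ a ∈ I, FEll.lHom P (∏ k ∈ I.erase a, P.EMInv a k 0) *
      (FEll.e P a b z * rightMinor P (P.qU ^ 2 * z) (I.erase a) (J.erase d)) =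
      FEll.rHom P (∏ k ∈ J.erase d, P.EMInv b k 0) * rightMinor P z I ((insert b J).erase d) := by
    intro d hd
    have hbd : b ≠ d := (ne_of_mem_of_not_mem hd hb).symm
    have hmem : b ∈ (insert b J).erase d :=
      Finset.mem_erase.mpr ⟨hbd, Finset.mem_insert_self b J⟩
    have he : ((insert b J).erase d).erase b = J.erase d := by
      rw [Finset.erase_right_comm, Finset.erase_insert hb]
    have h := sum_right_expansion P z (I := I) hmem
    rwa [he] at h
  have hβ : ∀ (K : Finset (Fin n)) (c : Fin n), c ∉ K → K.card = I.card →
      ∑ a ∈ K, P.betaRes N a c * ∏ k ∈ K.erase a, (P.EM k a 1 * P.EMInv a k 0) =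
        algebraMap ℂ (MF n) (P.E N) * ∏ k ∈ K, (P.EM k c 1 * P.EMInv c k 0) := by
    intro K c hcK hK
    have hK' : K.card = N := hK.trans hI
    have h := P.sum_betaRes_mul_prod K (Finset.card_ne_zero.mp (hK'.trans_ne hN)) hcK
    rwa [hK'] at h
  have hα : ∀ i j : Fin n, P.alphaRes N i j =
      algebraMap ℂ (MF n) (P.E N) * (P.EM i j 1 * P.EMInv i j 0) := fun _ _ => rfl
  have key := exchange_resummation (M := MF n) (FEll.lHom P) (FEll.rHom P) (FEll.l_r P) hc hb
    (A := fun i j => P.EM i j 1) (B := fun i j => P.EMInv i j 0) (α := P.alphaRes N)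
    (β := P.betaRes N) (κ := algebraMap ℂ (MF n) (P.E N)) (e := fun a d => FEll.e P a d z)
    (e' := fun a d => FEll.e P a d (P.qU ^ (2 * N) * z))
    (X := fun K K' => rightMinor P (P.qU ^ 2 * z) K K') (Y := fun K' => rightMinor P z I K')
    (Z := fun K => rightMinor P (P.qU ^ 2 * z) K J)
    hα hβ (hJ.trans hI.symm)
    (fun a d K ha i hi => FEll.commute_e_l P (wtShift_prod_EM P ha hi) d _)
    (fun a d K hd i hi => FEll.commute_e_r P (wtShift_prod_EM P hd hi) a _)
    (fun a d K ha i hi => FEll.commute_e_l P (wtShift_prod_EMInv P ha hi) d _)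
    (fun a d K hd i hi => FEll.commute_e_r P (wtShift_prod_EMInv P hd hi) a _)
    hX hX' hY (fun d hd => sum_right_expansion P z hd)
    (fun a ha d hd => FEll.residual_rll P N (ne_of_mem_of_not_mem ha hc)
      (ne_of_mem_of_not_mem hd hb).symm z)
  -- The common scalar `E(N)` cancels because `p` and `q` are multiplicatively independent.
  have hfin := eq_of_map_mul_eq_map_mul (M := MF n) (FEll.l_r P) (P.E_natCast_ne_zero hN)
    (P.prod_EM_mul_prod_EMInv hc) (P.prod_EMInv_mul_prod_EM hb) key
  have hm : ∀ J', leftMinor P z I J' = rightMinor P z I J' := fun J' =>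
    ih z I J' (hI.trans_lt N.lt_succ_self)
  rw [leftMinor_expand P z (Finset.mem_insert_self c I),
    rightMinor_expand P z _ (Finset.mem_insert_self b J), Finset.erase_insert hc,
    Finset.erase_insert hb, hI]
  simp only [hm]
  exact hfin

/-- The left and right elliptic minors agree, by induction on the number of rows. -/
theorem leftMinor_eq_rightMinor (z : ℂˣ) (I J : Finset (Fin n)) :
    leftMinor P z I J = rightMinor P z I J := by
  induction hm : I.card using Nat.strong_induction_on generalizing z I J with
  | _ m ih =>
    by_cases hIJ : J.card = I.card
    · rcases I.eq_empty_or_nonempty with rfl | ⟨c, hc⟩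
      · rw [Finset.card_empty, Finset.card_eq_zero] at hIJ
        rw [hIJ, leftMinor_empty, rightMinor_empty]
      · obtain ⟨b, hb⟩ : J.Nonempty := by
          rw [← Finset.card_pos, hIJ]
          exact Finset.card_pos.mpr ⟨c, hc⟩
        have hI' := Finset.card_erase_add_one hc
        have hJ' := Finset.card_erase_add_one hb
        -- For minors of size one the factor `E(N)` with `N = 0` would vanish.
        rcases eq_or_ne (I.erase c).card 0 with h0 | h0
        · have h1 : I.erase c = ∅ := Finset.card_eq_zero.mp h0
          have h2 : J.erase b = ∅ := Finset.card_eq_zero.mp (by omega)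
          rw [← Finset.insert_erase hc, ← Finset.insert_erase hb, h1, h2]
          exact (leftMinor_singleton P z c b).trans (rightMinor_singleton P z c b).symm
        · have h := leftMinor_insert_eq_rightMinor_insert P h0 z
            (fun z I J hI => ih I.card (by omega) z I J rfl) (Finset.notMem_erase c I)
            (Finset.notMem_erase b J) rfl (by omega)
          rwa [Finset.insert_erase hc, Finset.insert_erase hb] at h
    · rw [leftMinor_eq_zero P z hIJ, rightMinor_eq_zero P z (Ne.symm hIJ)]

theorem mainTheorem3 (P : EllParams) (n : ℕ) (z : ℂˣ) :
    (∃! ξ : Finset (Fin n) → Finset (Fin n) → FEll P n, IsLeftMinors P z ξ) ∧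
    (∃! ξ : Finset (Fin n) → Finset (Fin n) → FEll P n, IsRightMinors P z ξ) ∧
    ∀ ξl ξr : Finset (Fin n) → Finset (Fin n) → FEll P n,
      IsLeftMinors P z ξl → IsRightMinors P z ξr →
        ∀ I J : Finset (Fin n), ξl I J = ξr I J := by
  have hl := isLeftMinors_leftMinor P (n := n) z
  have hr := isRightMinors_rightMinor P (n := n) z
  refine ⟨⟨_, hl, fun ξ hξ => hξ.unique hl⟩, ⟨_, hr, fun ξ hξ => hξ.unique hr⟩, ?_⟩
  intro ξl ξr hξl hξr I J
  rw [hξl.unique hl, hξr.unique hr]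
  exact leftMinor_eq_rightMinor P z I J
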